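/- **Setting.** Logarithms are to base $2$, and $h(x)=-x\log x-(1-x)\log(1-x)$. A *sequential random circuit* with $t$ gates on $n$ qubits applies, in each of $t$ independent steps, a random two-qubit gate to a uniformly random pair of distinct qubits; the gate is either Haar-distributed on $U(4)$ or a uniformly random two-qubit Clifford gate (the result holds for each of the two models). *Parallelizing* the circuit means arranging its gates in successive layers so that gates sharing a qubit lie in different layers, in their original order; its *depth* is the least possible number of layers. Parallelization does not change the unitary $U$ that the circuit implements. Let $M$ and $M'$ consist of $m$ qubits and $A'$ of $n-m$ qubits. Let $|\Phi\rangle_{MM'}=2^{-m/2}\sum_{x\in\{0,1\}^m}|x\rangle|x\rangle$, and let $|\psi\rangle_{AA'}$ be a pure state. The circuit is applied to the $n$ qubits of $B=M'A'$, giving $|\rho\rangle_{MBA}=(\mathbb 1_M\otimes U_{B}\otimes \mathbb 1_A)\,|\Phi\rangle_{MM'}|\psi\rangle_{AA'}$; for a set $S$ of qubits of $B$, let $\rho_{MS}$ be the reduced state of $\rho$ on $M$ and $S$. Two cases are considered: 1. (ancillas) $A$ is trivial and $|\psi\rangle=|0\rangle^{\otimes (n-m)}$; 2. (entanglement assistance)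 $A$ consists of $n-m$ qubits and $|\psi\rangle_{AA'}=2^{-(n-m)/2}\sum_{y\in\{0,1\}^{n-m}}|y\rangle|y\rangle$. **Theorem.** For each of the two gate models and each $k\in\mathbb N$ there is a constant $c_0>0$ such that for every $c_1\ge c_0$ there is a constant $C>0$ with the following property. Let $0\le f<1/2$ and let $\beta$ satisfy - in case 1: $\beta<\frac19$ and $\beta<\frac{\log 3}{2}-f\log 3-h(f)$; - in case 2: $\beta<\frac23$ and $\beta<\frac12\left(1+\frac{\log 3}{2}-f\log 3-h(f)\right)$. Then there is $n_0$ such that for all $n\ge n_0$, all $m$ with $0\le m<\beta n$, and all $t$ with $c_0\,n\log^2 n\le t\le c_1\,n\log^2 n$, with probability at least $1-n^{-k}$ over the choice of the sequential random circuit with $t$ gates, the parallelized circuit has depth at most $C\log^3 n$ and $$\left\|\rho_{MS}-\frac{\mathbb 1}{2^m}\otimes\frac{\mathbb 1}{2^{|S|}}\right\|_1\le n^{-k}\qquad\text{for all sets } S \text{ of at most } fn \text{ output qubits.}$$ -/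

import Mathlib

open MeasureTheory Matrix
open scoped Kronecker

noncomputable section

namespace RandomCircuit

/-! ### Bit strings and density operators -/

/-- Computational basis labels of a register of qubits indexed by `ι`. Operators on the register
are complex matrices indexed by `Bits ι`. -/
abbrev Bits (ι : Type) : Type := ι → Fin 2

/-- The density operator `|ψ⟩⟨ψ|` of a state vector. -/
def pureDensity {ι : Type*} (ψ : ι → ℂ) : Matrix ι ι ℂ := Matrix.vecMulVec ψ (star ψ)

/-- The trace norm `‖X‖₁ = tr √(X† X)`, i.e. the sum of the singular values of `X`. -/
def traceNorm {ι : Type*} [Fintype ι] [DecidableEq ι] (X : Matrix ι ι ℂ) : ℝ :=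
  ∑ i, Real.sqrt ((Matrix.isHermitian_conjTranspose_mul_self X).eigenvalues i)

/-- The maximally mixed state `𝟙 / 2^k` of a register of `k` qubits. -/
def maxMixed (ι : Type) [Fintype ι] [DecidableEq ι] : Matrix (Bits ι) (Bits ι) ℂ :=
  ((2 : ℂ) ^ Fintype.card ι)⁻¹ • (1 : Matrix (Bits ι) (Bits ι) ℂ)

/-- The basis label of all qubits that is `s` on `S` and `r` outside `S`. -/
def merge {n : ℕ} (S : Finset (Fin n)) (s : Bits {i // i ∈ S}) (r : Bits {i // i ∉ S}) :
    Bits (Fin n) :=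
  fun i => if h : i ∈ S then s ⟨i, h⟩ else r ⟨i, h⟩

/-- The reduced state `ρ_{MS}` of a state `ρ` on `M ⊗ B ⊗ A`, where `B` consists of `n` qubits:
the partial trace over `A` and over the qubits of `B` outside `S`. -/
def reducedMS {M A : Type} [Fintype A] {n : ℕ}
    (ρ : Matrix (M × Bits (Fin n) × A) (M × Bits (Fin n) × A) ℂ) (S : Finset (Fin n)) :
    Matrix (M × Bits {i // i ∈ S}) (M × Bits {i // i ∈ S}) ℂ :=
  Matrix.of fun p q => ∑ r : Bits {i // i ∉ S}, ∑ a : A,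
    ρ (p.1, merge S p.2 r, a) (q.1, merge S q.2 r, a)

/-! ### Random two-qubit gates -/

/-- Two-qubit gates, with the Borel σ-algebra. -/
abbrev TwoQubitGate : Type := Matrix.unitaryGroup (Fin 2 × Fin 2) ℂ

instance : MeasurableSpace TwoQubitGate := borel _

instance : BorelSpace TwoQubitGate := ⟨rfl⟩

theorem isCompact_unitaryGroup :
    IsCompact (Matrix.unitaryGroup (Fin 2 × Fin 2) ℂ :
      Set (Matrix (Fin 2 × Fin 2) (Fin 2 × Fin 2) ℂ)) := by
  have hK : IsCompact (Set.pi Set.univ fun _ : Fin 2 × Fin 2 =>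
      Set.pi Set.univ fun _ : Fin 2 × Fin 2 => Metric.closedBall (0 : ℂ) 1) :=
    isCompact_univ_pi fun _ => isCompact_univ_pi fun _ => isCompact_closedBall 0 1
  refine IsCompact.of_isClosed_subset hK (isClosed_unitary (R := Matrix _ _ ℂ)) ?_
  intro U hU i _ j _
  simpa using entry_norm_bound_of_unitary hU i j

instance : CompactSpace TwoQubitGate := isCompact_iff_compactSpace.mp isCompact_unitaryGroup

/-- The Pauli matrices `σ₀ = 𝟙, σ₁, σ₂, σ₃`. -/
def pauli : Fin 4 → Matrix (Fin 2) (Fin 2) ℂ :=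
  ![!![1, 0; 0, 1], !![0, 1; 1, 0], !![0, -Complex.I; Complex.I, 0], !![1, 0; 0, -1]]

/-- The two-qubit Pauli group `{i^j σ_a ⊗ σ_b}`. -/
def pauliGroup : Set TwoQubitGate :=
  {U | ∃ a b j : Fin 4, (U : Matrix _ _ ℂ) = Complex.I ^ (j : ℕ) • (pauli a ⊗ₖ pauli b)}

/-- The two-qubit Clifford group (including all global phases): the normalizer of the Pauli
group in the unitary group. -/
def cliffordGroup : Subgroup TwoQubitGate := Subgroup.normalizer pauliGroup

theorem isClosed_pauliGroup : IsClosed pauliGroup := by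
  have h : pauliGroup = ⋃ a : Fin 4, ⋃ b : Fin 4, ⋃ j : Fin 4,
      (fun U : TwoQubitGate => (U : Matrix (Fin 2 × Fin 2) (Fin 2 × Fin 2) ℂ)) ⁻¹'
        {Complex.I ^ (j : ℕ) • (pauli a ⊗ₖ pauli b)} := by
    ext U; simp [pauliGroup]
  rw [h]
  exact isClosed_iUnion_of_finite fun a => isClosed_iUnion_of_finite fun b =>
    isClosed_iUnion_of_finite fun j => isClosed_singleton.preimage continuous_subtype_val

theorem isClosed_cliffordGroup : IsClosed (cliffordGroup : Set TwoQubitGate) := by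
  have h : (cliffordGroup : Set TwoQubitGate) =
      (⋂ P ∈ pauliGroup, (fun g : TwoQubitGate => g * P * g⁻¹) ⁻¹' pauliGroup) ∩
      (⋂ P ∈ pauliGroup, (fun g : TwoQubitGate => g⁻¹ * P * g) ⁻¹' pauliGroup) := by
    ext g
    simp only [cliffordGroup, SetLike.mem_coe, Subgroup.mem_set_normalizer_iff, Set.mem_inter_iff,
      Set.mem_iInter, Set.mem_preimage]
    constructor
    · intro hg
      refine ⟨fun P hP => (hg P).1 hP, fun P hP => (hg _).2 ?_⟩
      simpa [mul_assoc] using hP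
    · rintro ⟨h1, h2⟩ P
      refine ⟨h1 P, fun hP => ?_⟩
      simpa [mul_assoc] using h2 _ hP
  rw [h]
  refine IsClosed.inter ?_ ?_ <;>
  · refine isClosed_biInter fun P _ => isClosed_pauliGroup.preimage ?_
    fun_prop

instance : CompactSpace cliffordGroup :=
  isCompact_iff_compactSpace.mp isClosed_cliffordGroup.isCompact

/-- The two kinds of random gates: Haar-distributed gates and random Clifford gates. -/
inductive GateModel
  | haar
  | clifford

/-- The law of a random two-qubit gate: the Haar probability measure of the full unitary group
`U(4)`, respectively of the two-qubit Clifford group (a uniformly random Clifford gate, with an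
irrelevant uniformly random global phase). -/
def gateLaw : GateModel → Measure TwoQubitGate
  | .haar => Measure.haarMeasure ⊤
  | .clifford => (Measure.haarMeasure (⊤ : TopologicalSpace.PositiveCompacts cliffordGroup)).map
      Subtype.val

theorem isProbabilityMeasure_haar_top (G : Type*) [Group G] [TopologicalSpace G]
    [IsTopologicalGroup G] [CompactSpace G] [MeasurableSpace G] [BorelSpace G] :
    IsProbabilityMeasure (Measure.haarMeasure (⊤ : TopologicalSpace.PositiveCompacts G)) := by
  constructor
  rw [← TopologicalSpace.PositiveCompacts.coe_top]
  exact Measure.haarMeasure_self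

instance (model : GateModel) : IsProbabilityMeasure (gateLaw model) := by
  cases model
  · exact isProbabilityMeasure_haar_top TwoQubitGate
  · have := isProbabilityMeasure_haar_top cliffordGroup
    exact Measure.isProbabilityMeasure_map measurable_subtype_coe.aemeasurable

/-! ### Sequential random circuits and their parallelization -/

/-- Unordered pairs of distinct qubits, written with the smaller index first. -/
abbrev QubitPair (n : ℕ) : Type := {p : Fin n × Fin n // p.1 < p.2}

/-- A sequence of `t` two-qubit gates on `n` qubits, each with the pair of qubits on which it
acts; gate `0` is applied first. -/
abbrev Circuit (n t : ℕ) : Type := Fin t → QubitPair n × TwoQubitGate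

/-- The unitary on `n` qubits that applies the gate `g.2` to the pair of qubits `g.1` and the
identity to the other qubits. -/
def gateMatrix {n : ℕ} (g : QubitPair n × TwoQubitGate) :
    Matrix (Bits (Fin n)) (Bits (Fin n)) ℂ :=
  Matrix.of fun b b' =>
    if ∀ i, i ≠ g.1.1.1 → i ≠ g.1.1.2 → b i = b' i then
      (g.2 : Matrix (Fin 2 × Fin 2) (Fin 2 × Fin 2) ℂ)
        (b g.1.1.1, b g.1.1.2) (b' g.1.1.1, b' g.1.1.2)
    else 0

/-- The unitary `U_t ⋯ U_2 U_1` implemented by a circuit. -/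
def circuitUnitary {n t : ℕ} (ω : Circuit n t) : Matrix (Bits (Fin n)) (Bits (Fin n)) ℂ :=
  (List.ofFn fun i => gateMatrix (ω i)).reverse.prod

/-- Two gates share a qubit. -/
def Overlap {n : ℕ} (p q : QubitPair n) : Prop :=
  p.1.1 = q.1.1 ∨ p.1.1 = q.1.2 ∨ p.1.2 = q.1.1 ∨ p.1.2 = q.1.2

/-- The gates of the circuit can be arranged in `D` successive layers: gates that share a qubit lie
in different layers, in the order in which they are applied. (Gates that share no qubit commute,
so the layered circuit implements the same unitary.) -/
def HasLayering {n t : ℕ} (ω : Circuit n t) (D : ℕ) : Prop :=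
  ∃ layer : Fin t → Fin D, ∀ i j, i < j → Overlap (ω i).1 (ω j).1 → layer i < layer j

/-- The depth of the parallelized circuit: the least number of layers. -/
def parallelDepth {n t : ℕ} (ω : Circuit n t) : ℕ := sInf {D | HasLayering ω D}

/-- The law of the sequential random circuit: `t` independent steps, each of which applies a
random gate to a uniformly random pair of qubits. -/
def circuitLaw (model : GateModel) (n t : ℕ) : Measure (Circuit n t) :=
  Measure.pi fun _ => (ProbabilityTheory.uniformOn Set.univ).prod (gateLaw model)

/-! ### The decoupling setting

The circuit acts on the `n = m + a` qubits of `B = M'A'`, the first `m` of which form `M'`. -/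

/-- The vector `2^{-k/2} ∑_x |x⟩|x⟩` of `k` pairs of maximally entangled qubits. -/
def maxEntangled (k : ℕ) (p : Bits (Fin k) × Bits (Fin k)) : ℂ :=
  if p.1 = p.2 then ((Real.sqrt (2 ^ k))⁻¹ : ℝ) else 0

/-- The ancillas `A'` in the state `|0⟩`, with trivial system `A`. -/
def zeroAncilla (a : ℕ) (p : Unit × Bits (Fin a)) : ℂ := if p.2 = 0 then 1 else 0

/-- The input vector `|Φ⟩_{MM'} ⊗ |ψ⟩_{AA'}` on `M ⊗ B ⊗ A`. -/
def inputState {A : Type} (m a : ℕ) (ψ : A × Bits (Fin a) → ℂ) :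
    Bits (Fin m) × Bits (Fin (m + a)) × A → ℂ :=
  fun p => maxEntangled m (p.1, fun i => p.2.1 (Fin.castAdd a i)) *
    ψ (p.2.2, fun j => p.2.1 (Fin.natAdd m j))

/-- Application of `𝟙_M ⊗ U_B ⊗ 𝟙_A` to a vector. -/
def applyB {M A : Type} {n : ℕ} (U : Matrix (Bits (Fin n)) (Bits (Fin n)) ℂ)
    (φ : M × Bits (Fin n) × A → ℂ) : M × Bits (Fin n) × A → ℂ :=
  fun p => ∑ b, U p.2.1 b * φ (p.1, b, p.2.2)

/-- The output density operator `ρ` on `M ⊗ B ⊗ A`. -/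
def outputState {A : Type} {m a t : ℕ} (ψ : A × Bits (Fin a) → ℂ) (ω : Circuit (m + a) t) :
    Matrix (Bits (Fin m) × Bits (Fin (m + a)) × A) (Bits (Fin m) × Bits (Fin (m + a)) × A) ℂ :=
  pureDensity (applyB (circuitUnitary ω) (inputState m a ψ))

/-- The decoupling error `‖ρ_{MS} - 𝟙/2^m ⊗ 𝟙/2^{|S|}‖₁`. -/
def decouplingError {A : Type} [Fintype A] {m a t : ℕ} (ψ : A × Bits (Fin a) → ℂ)
    (ω : Circuit (m + a) t) (S : Finset (Fin (m + a))) : ℝ :=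
  traceNorm (reducedMS (outputState ψ ω) S - maxMixed (Fin m) ⊗ₖ maxMixed {i // i ∈ S})

/-- The binary entropy function, in bits. -/
def binaryEntropy (x : ℝ) : ℝ := -x * Real.logb 2 x - (1 - x) * Real.logb 2 (1 - x)

/-- The event that the parallelized circuit has depth at most `d` and that the reference `M` is
decoupled, up to `ε`, from every set of at most `f n` output qubits. -/
def goodEvent {A : Type} [Fintype A] {m a t : ℕ} (ψ : A × Bits (Fin a) → ℂ) (f d ε : ℝ) :
    Set (Circuit (m + a) t) :=
  {ω | (parallelDepth ω : ℝ) ≤ d ∧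
    ∀ S : Finset (Fin (m + a)), (S.card : ℝ) ≤ f * (m + a : ℕ) → decouplingError ψ ω S ≤ ε}

/-- For circuits of between `c₀ n log² n` and `c₁ n log² n` gates on `n = m + a` qubits, where
`m < β n` and `n` is large: except with probability `n^{-k}`, the depth of the parallelized circuit
is at most `C log³ n` and `M` is decoupled, up to an error `n^{-k}`, from all sets of at most `f n`
output qubits. Here `ψ a` is the state of `AA'` for `a` ancillas. -/
def DecouplesWHP (model : GateModel) {A : ℕ → Type} [∀ a, Fintype (A a)]
    (ψ : ∀ a, A a × Bits (Fin a) → ℂ) (k : ℕ) (c₀ c₁ C β f : ℝ) : Prop :=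
  ∃ n₀ : ℕ, ∀ m a t : ℕ, n₀ ≤ m + a → (m : ℝ) < β * (m + a : ℕ) →
    c₀ * (m + a : ℕ) * Real.logb 2 (m + a : ℕ) ^ 2 ≤ t →
    (t : ℝ) ≤ c₁ * (m + a : ℕ) * Real.logb 2 (m + a : ℕ) ^ 2 →
    1 - (((m + a : ℕ) : ℝ) ^ k)⁻¹ ≤ (circuitLaw model (m + a) t).real
      (goodEvent (ψ a) f (C * Real.logb 2 (m + a : ℕ) ^ 3) (((m + a : ℕ) : ℝ) ^ k)⁻¹)

end RandomCircuit

end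

/-! Write `n = m + a`. Expand the output in Pauli strings on the `n` qubits of `B`. By
Cauchy–Schwarz for singular values and Parseval on `S`, the squared decoupling error for `S` is at
most `2 ^ m` times the total squared size, over the blocks indexed by the basis of `M`, of the
components along nonidentity strings supported in `S`. Hence the components along all strings of
weight `1, …, ⌊f n⌋` bound the errors of all admissible `S` at once, and no union bound over `S` is
needed. It remains to bound the expectation of this single quantity and to apply Markov's
inequality.

A random gate, Haar or Clifford, averages the squared components over the 15 nonidentity Pauli
operators of its pair: the average is invariant under the Clifford gates `(σ_p + σ_q) / √2`, which
exchange anticommuting `σ_p` and `σ_q` and connect all nonidentity operators (`integral_gateCoeff`).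
Six of the fifteen have weight 1 and nine have weight 2, so after averaging over pairs the expected
weight distribution follows a birth–death chain with rates `upRate` and `downRate`
(`sum_integral_pauliWeightSum`). The chain is reversible with respect to `3 ^ x * C(n, x)`, the
number of strings of weight `x`.

The input contributes `N x` strings of weight `x`, with `N x ≤ 2 ^ x * C(n, x)` in both cases. Let
`H = ⌈n / 2⌉`. A path that ends at low weight either stays in `[1, H)` throughout or visits `H`
(`iterate_le_stayProb_add`). Paths through `H`: by stationarity their probability is at most the
number of low-weight strings divided by `3 ^ H * C(n, H)`. Multiplied by the total number of input
strings, this is exponentially small precisely under the entropy condition on `β`. Paths that stay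
low are sorted by their minimal weight `v`. Reaching `v` from `x` costs a factor `2 ^ v C(n, v) / (2
^ x C(n, x))`, and staying at or above `v` for `s` steps while below `H` costs `(1 - v / (20 n)) ^
s`. The decay rate grows with `v`, which beats the entropy `n ^ O(v)` of the strings once `s` is a
large multiple of `n log n` (`stayProb_sub_le`, `sum_inputWeight_stayProb_le`).

For the depth, gates are stacked greedily. The expectation of `∑ q, 2 ^ height q` grows by a factor
of at most `1 + 6 / n` per gate, so Markov's inequality bounds the maximal height
(`lintegral_sum_two_pow_le`, `depth_bound`). -/

noncomputable section

namespace RandomCircuit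

/-! ### The weight chain -/

/-- Probability that the weight of a Pauli string of weight `x` on `n` qubits increases. -/
def upRate (n x : ℕ) : ℝ := 6 / 5 * x * (n - x) / (n * (n - 1))

/-- Probability that the weight of a Pauli string of weight `x` on `n` qubits decreases. -/
def downRate (n x : ℕ) : ℝ := 2 / 5 * x * (x - 1) / (n * (n - 1))

/-- The transition operator of the weight chain, acting on functions of the weight. -/
def weightStep (n : ℕ) (w : ℕ → ℝ) (x : ℕ) : ℝ :=
  w x + upRate n x * (w (x + 1) - w x) + downRate n x * (w (x - 1) - w x)

variable {n : ℕ}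

theorem denom_pos (hn : 2 ≤ n) : (0 : ℝ) < n * (n - 1) := by
  have : (2 : ℝ) ≤ n := by exact_mod_cast hn
  nlinarith

theorem upRate_nonneg (hn : 2 ≤ n) {x : ℕ} (hx : x ≤ n) : 0 ≤ upRate n x := by
  have h1 := denom_pos hn
  have h2 : (x : ℝ) ≤ n := by exact_mod_cast hx
  have h3 : (0 : ℝ) ≤ n - x := by linarith
  unfold upRate
  positivity

theorem downRate_nonneg (hn : 2 ≤ n) (x : ℕ) : 0 ≤ downRate n x := by
  have h1 := denom_pos hn
  have h2 : (0 : ℝ) ≤ x * (x - 1) := by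
    rcases Nat.eq_zero_or_pos x with rfl | h
    · simp
    · have : (1 : ℝ) ≤ x := by exact_mod_cast h
      nlinarith
  unfold downRate
  rw [mul_assoc]
  positivity

theorem upRate_add_downRate_le (hn : 2 ≤ n) {x : ℕ} (hx : x ≤ n) :
    upRate n x + downRate n x ≤ 1 := by
  have h1 := denom_pos hn
  unfold upRate downRate
  rw [← add_div, div_le_one h1]
  obtain ⟨y, rfl⟩ := Nat.exists_eq_add_of_le hx
  have hy : (0 : ℝ) ≤ y * (y - 1) := by
    rcases Nat.eq_zero_or_pos y with rfl | h
    · simp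
    · have : (1 : ℝ) ≤ y := by exact_mod_cast h
      nlinarith
  have hx : (0 : ℝ) ≤ x * (x - 1) := by
    rcases Nat.eq_zero_or_pos x with rfl | h
    · simp
    · have : (1 : ℝ) ≤ x := by exact_mod_cast h
      nlinarith
  have hxy : (0 : ℝ) ≤ (x : ℝ) * y := by positivity
  push_cast
  nlinarith

/-- The step is a convex combination of the values at `x` and its neighbours. The up rate vanishes
at `n` and the down rate at `0` and `1`, so no comparison is needed across these boundaries; in
particular the truncated `0 - 1` is harmless and weight `0` is unreachable from positive weights. -/
theorem weightStep_mono (hn : 2 ≤ n) {w w' : ℕ → ℝ} {x : ℕ} (hx : x ≤ n) (h0 : w x ≤ w' x)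
    (h1 : x < n → w (x + 1) ≤ w' (x + 1)) (h2 : 1 < x → w (x - 1) ≤ w' (x - 1)) :
    weightStep n w x ≤ weightStep n w' x := by
  have a := upRate_nonneg hn hx
  have b := downRate_nonneg hn x
  have c := upRate_add_downRate_le hn hx
  have e1 : upRate n x * w (x + 1) ≤ upRate n x * w' (x + 1) := by
    rcases hx.lt_or_eq with h | rfl
    · exact mul_le_mul_of_nonneg_left (h1 h) a
    · simp [upRate]
  have e2 : downRate n x * w (x - 1) ≤ downRate n x * w' (x - 1) := by
    rcases lt_or_ge 1 x with h | h
    · exact mul_le_mul_of_nonneg_left (h2 h) b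
    · interval_cases x <;> simp [downRate]
  have e3 := mul_le_mul_of_nonneg_left h0 (sub_nonneg.2 c)
  unfold weightStep
  linarith

theorem weightStep_add_const (w : ℕ → ℝ) (M : ℝ) (x : ℕ) :
    weightStep n (fun y => w y + M) x = weightStep n w x + M := by
  unfold weightStep; ring

theorem weightStep_smul (w : ℕ → ℝ) (M : ℝ) (x : ℕ) :
    weightStep n (fun y => M * w y) x = M * weightStep n w x := by
  unfold weightStep; ring

theorem weightStep_sub (w w' : ℕ → ℝ) (x : ℕ) :
    weightStep n (fun y => w y - w' y) x = weightStep n w x - weightStep n w' x := by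
  unfold weightStep; ring

/-! ### Reversibility and the stationary bound -/

/-- The number of Pauli strings of weight `x`. -/
def stringCount (n x : ℕ) : ℝ := 3 ^ x * n.choose x

theorem choose_succ_cast (n x : ℕ) :
    (n.choose (x + 1) : ℝ) * (x + 1) = n.choose x * (n - x) := by
  rcases le_or_gt x n with h | h
  · have := Nat.choose_succ_right_eq n x
    have h2 : ((n - x : ℕ) : ℝ) = n - x := by push_cast [h]; ring
    rw [← h2]
    exact_mod_cast this
  · rw [Nat.choose_eq_zero_of_lt h, Nat.choose_eq_zero_of_lt (by omega)]; simp

theorem detailed_balance (x : ℕ) :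
    stringCount n x * upRate n x = stringCount n (x + 1) * downRate n (x + 1) := by
  have := choose_succ_cast n x
  unfold stringCount upRate downRate
  push_cast
  rw [pow_succ]
  have e : (3 : ℝ) ^ x * (n.choose x) * (6 / 5 * x * (n - x))
      = 3 ^ x * 3 * (n.choose (x + 1)) * (2 / 5 * (x + 1) * (x + 1 - 1)) := by
    linear_combination (-(3 : ℝ) ^ x * 6 / 5 * x) * this
  rw [mul_div_assoc', mul_div_assoc', e]

/-- Summation by parts: by detailed balance the flow from `x + 1` down to `x` cancels the flow from
`x` up to `x + 1`. -/
theorem sum_stringCount_weightStep (w : ℕ → ℝ) :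
    ∑ x ∈ Finset.range (n + 1), stringCount n x * weightStep n w x =
      ∑ x ∈ Finset.range (n + 1), stringCount n x * w x := by
  have key : ∑ x ∈ Finset.range (n + 1), stringCount n x * (downRate n x * (w (x - 1) - w x)) =
      - ∑ x ∈ Finset.range (n + 1), stringCount n x * (upRate n x * (w (x + 1) - w x)) := by
    rw [Finset.sum_range_succ', Finset.sum_range_succ]
    have h0 : downRate n 0 = 0 := by simp [downRate]
    have hn : upRate n n = 0 := by simp [upRate]
    rw [h0, hn]
    simp only [zero_mul, mul_zero, add_zero]
    have : ∀ x ∈ Finset.range n, stringCount n (x + 1) * (downRate n (x + 1) *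
        (w (x + 1 - 1) - w (x + 1))) = -(stringCount n x * (upRate n x * (w (x + 1) - w x))) := by
      intro x _
      rw [← mul_assoc, ← mul_assoc, detailed_balance, Nat.add_sub_cancel]
      ring
    rw [Finset.sum_congr rfl this]
    simp
  have : ∀ x, stringCount n x * weightStep n w x = stringCount n x * w x +
      stringCount n x * (upRate n x * (w (x + 1) - w x)) +
      stringCount n x * (downRate n x * (w (x - 1) - w x)) := by
    intro x; unfold weightStep; ring
  simp only [this, Finset.sum_add_distrib]
  rw [key]; ring

theorem sum_stringCount_iterate (w : ℕ → ℝ) (s : ℕ) :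
    ∑ x ∈ Finset.range (n + 1), stringCount n x * (weightStep n)^[s] w x =
      ∑ x ∈ Finset.range (n + 1), stringCount n x * w x := by
  induction s with
  | zero => rfl
  | succ s ih => simp only [Function.iterate_succ_apply', sum_stringCount_weightStep, ih]

theorem iterate_nonneg (hn : 2 ≤ n) {w : ℕ → ℝ} (hw : ∀ x, 0 ≤ w x) (s : ℕ) :
    ∀ x ≤ n, 0 ≤ (weightStep n)^[s] w x := by
  induction s with
  | zero => exact fun x _ => hw x
  | succ s ih =>
    intro x hx
    rw [Function.iterate_succ_apply']
    have := weightStep_mono hn (w := fun _ => 0) (w' := (weightStep n)^[s] w) hx (ih x hx)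
      (fun h => ih _ h) (fun h => ih _ (by omega))
    simpa [weightStep] using this

theorem stringCount_pos {x : ℕ} (hx : x ≤ n) : 0 < stringCount n x := by
  have := Nat.choose_pos hx
  unfold stringCount; positivity

/-- The stationary sum of the iterate is conserved and has nonnegative terms, so the single term at
`H` is at most the whole. The bound is uniform in `s`, hence applies whenever the chain visits `H`.
-/
theorem iterate_le_of_stationary (hn : 2 ≤ n) {w : ℕ → ℝ} (hw : ∀ x, 0 ≤ w x) (s : ℕ) {H : ℕ}
    (hH : H ≤ n) : (weightStep n)^[s] w H ≤
      (∑ x ∈ Finset.range (n + 1), stringCount n x * w x) / stringCount n H := by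
  rw [le_div_iff₀ (stringCount_pos hH), ← sum_stringCount_iterate w s, mul_comm]
  exact Finset.single_le_sum (f := fun x => stringCount n x * (weightStep n)^[s] w x)
    (fun x hx => mul_nonneg (stringCount_pos (by simpa [Nat.lt_succ_iff] using hx)).le
      (iterate_nonneg hn hw s x (by simpa [Nat.lt_succ_iff] using hx)))
    (Finset.mem_range.2 (by omega))

/-! ### The chain killed on leaving an interval -/

/-- The probability that the weight chain started at `x` stays in `[v, H)` for `s` steps. -/
def stayProb (n H v : ℕ) : ℕ → ℕ → ℝ
  | 0, x => if v ≤ x ∧ x < H then 1 else 0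
  | s + 1, x => if v ≤ x ∧ x < H then weightStep n (stayProb n H v s) x else 0

theorem stayProb_of_notMem {H v s x : ℕ} (h : ¬(v ≤ x ∧ x < H)) : stayProb n H v s x = 0 := by
  cases s <;> simp [stayProb, h]

theorem stayProb_succ {H v s x : ℕ} (h : v ≤ x ∧ x < H) :
    stayProb n H v (s + 1) x = weightStep n (stayProb n H v s) x := by
  simp [stayProb, h]

/-- The chain moves by at most one, so a path that leaves `[1, H)` upwards, or that comes down from
above `H`, must visit `H`; from there the expected value of `w` is at most `M`, whatever time
remains. A path that starts at `0` stays there, where `w` vanishes. -/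
theorem iterate_le_stayProb_add (hn : 2 ≤ n) {w : ℕ → ℝ} {H : ℕ} {M : ℝ} (hM : 0 ≤ M)
    (hw0 : w 0 = 0) (hw1 : ∀ x, w x ≤ 1) (hwH : ∀ x, H ≤ x → w x ≤ 0)
    (hu : ∀ s, (weightStep n)^[s] w H ≤ M) (s : ℕ) :
    ∀ x ≤ n, (weightStep n)^[s] w x ≤ stayProb n H 1 s x + M := by
  induction s with
  | zero =>
    intro x _
    simp only [Function.iterate_zero, id_eq, stayProb]
    split_ifs with h
    · linarith [hw1 x]
    · rcases Nat.eq_zero_or_pos x with rfl | h'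
      · simp [hw0, hM]
      · linarith [hwH x (by omega)]
  | succ s ih =>
    intro x hx
    rcases Nat.eq_zero_or_pos x with rfl | h'
    · have : ∀ s, (weightStep n)^[s] w 0 = 0 := by
        intro s
        induction s with
        | zero => simpa
        | succ s ih => rw [Function.iterate_succ_apply']; simp [weightStep, upRate, downRate, ih]
      rw [this, stayProb_of_notMem (by omega)]; simpa
    · rcases eq_or_ne x H with rfl | hxH
      · rw [stayProb_of_notMem (by omega), zero_add]; exact hu _
      · rw [Function.iterate_succ_apply']
        refine (weightStep_mono hn (w' := fun y => stayProb n H 1 s y + M) hx (ih x hx)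
          (fun h => ih _ h) (fun h => ih _ (by omega))).trans ?_
        rw [weightStep_add_const]
        rcases lt_or_gt_of_ne hxH with h | h
        · rw [stayProb_succ ⟨h', h⟩]
        · have : weightStep n (stayProb n H 1 s) x = 0 := by
            simp [weightStep, stayProb_of_notMem (n := n) (H := H) (v := 1) (s := s)
              (show ¬(1 ≤ x ∧ x < H) by omega),
              stayProb_of_notMem (n := n) (H := H) (v := 1) (s := s)
              (show ¬(1 ≤ x + 1 ∧ x + 1 < H) by omega),
              stayProb_of_notMem (n := n) (H := H) (v := 1) (s := s)
              (show ¬(1 ≤ x - 1 ∧ x - 1 < H) by omega)]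
          rw [this, stayProb_of_notMem (by omega)]

/-- A supersolution with decay `r` dominates the killed chain. -/
theorem stayProb_le_of_supersolution (hn : 2 ≤ n) {H v : ℕ} (hH : H ≤ n) {r : ℝ} (hr : 0 ≤ r)
    {V : ℕ → ℝ} (hV0 : ∀ x, 0 ≤ V x) (hV1 : ∀ x, v ≤ x → x < H → 1 ≤ V x)
    (hV : ∀ x, v ≤ x → x < H → weightStep n V x ≤ r * V x) (s : ℕ) :
    ∀ x, stayProb n H v s x ≤ r ^ s * V x := by
  induction s with
  | zero =>
    intro x
    simp only [stayProb, pow_zero, one_mul]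
    split_ifs with h
    · exact hV1 x h.1 h.2
    · exact hV0 x
  | succ s ih =>
    intro x
    by_cases h : v ≤ x ∧ x < H
    · rw [stayProb_succ h]
      refine (weightStep_mono hn (w' := fun y => r ^ s * V y) (by omega) (ih x)
        (fun _ => ih _) (fun _ => ih _)).trans ?_
      rw [weightStep_smul, pow_succ, mul_assoc]
      exact mul_le_mul_of_nonneg_left (hV x h.1 h.2) (by positivity)
    · rw [stayProb_of_notMem h]
      have := hV0 x
      positivity

/-! ### Two supersolutions and the sum over minimal weights -/

theorem choose_add_mul (x v : ℕ) (hx : 1 ≤ x) :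
    ((x + 1 + v - 1).choose v : ℝ) * x = (x + v - 1).choose v * (x + v) := by
  obtain ⟨y, rfl⟩ := Nat.exists_eq_add_of_le' hx
  have h := Nat.add_one_mul_choose_eq (y + v) y
  have e1 : (y + 1 + 1 + v - 1).choose v = (y + v + 1).choose (y + 1) := by
    rw [show y + 1 + 1 + v - 1 = y + v + 1 by omega]
    exact Nat.choose_symm_of_eq_add (by omega)
  have e2 : (y + 1 + v - 1).choose v = (y + v).choose y := by
    rw [show y + 1 + v - 1 = y + v by omega]
    exact Nat.choose_symm_of_eq_add (by omega)
  rw [e1, e2]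
  have : ((y + v + 1 : ℕ) : ℝ) * ((y + v).choose y : ℕ) =
    ((y + v + 1).choose (y + 1) : ℕ) * ((y + 1 : ℕ) : ℝ) := by exact_mod_cast h
  push_cast at this ⊢
  linarith

/-- The supersolution `x ↦ 1 / C(x + v - 1, v)` of the chain killed outside `[v, H)`. -/
theorem weightStep_inv_choose_le (hn : 2 ≤ n) {v x : ℕ} (hv : 1 ≤ v) (hvx : v ≤ x)
    (hx : 2 * x < n) :
    weightStep n (fun y => if v ≤ y then ((y + v - 1).choose v : ℝ)⁻¹ else 0) x ≤
      (1 - v / (20 * n)) * ((x + v - 1).choose v : ℝ)⁻¹ := by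
  have hD := denom_pos hn
  have hn' : (0 : ℝ) < n := by positivity
  set b : ℝ := ((x + v - 1).choose v : ℝ)⁻¹ with hb
  have hbpos : 0 < b := by
    have := Nat.choose_pos (show v ≤ x + v - 1 by omega)
    positivity
  have hxr : (1 : ℝ) ≤ x := by exact_mod_cast hv.trans hvx
  have hvr : (1 : ℝ) ≤ v := by exact_mod_cast hv
  have hvxr : (v : ℝ) ≤ x := by exact_mod_cast hvx
  have hxn : 2 * (x : ℝ) + 1 ≤ n := by exact_mod_cast hx
  have hup : ((x + 1 + v - 1).choose v : ℝ)⁻¹ = b * (x / (x + v)) := by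
    have := choose_add_mul x v (by omega)
    have h1 : ((x + 1 + v - 1).choose v : ℝ) = (x + v - 1).choose v * (x + v) / x := by
      field_simp; linarith
    rw [h1, hb, inv_div, div_eq_mul_inv, mul_inv]
    ring
  -- An inequality rather than an equality because at `x = v` the downward move is killed and
  -- contributes nothing.
  have hdown : downRate n x * (if v ≤ x - 1 then ((x - 1 + v - 1).choose v : ℝ)⁻¹ else 0) ≤
      b * (2 / 5 * x * (x - 1 + v) / (n * (n - 1))) := by
    split_ifs with h
    · have := choose_add_mul (x - 1) v (by omega)
      rw [show x - 1 + 1 + v - 1 = x + v - 1 by omega, Nat.cast_sub (by omega)] at this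
      push_cast at this
      have hc := Nat.choose_pos (show v ≤ x - 1 + v - 1 by omega)
      have hc' := Nat.choose_pos (show v ≤ x + v - 1 by omega)
      have h1 : (x - 1 : ℝ) * ((x - 1 + v - 1).choose v : ℝ)⁻¹ = b * (x - 1 + v) := by
        rw [hb]; field_simp; linarith
      unfold downRate
      rw [show 2 / 5 * (x : ℝ) * (x - 1) / (n * (n - 1)) * ((x - 1 + v - 1).choose v : ℝ)⁻¹ =
        2 / 5 * (x : ℝ) * ((x - 1) * ((x - 1 + v - 1).choose v : ℝ)⁻¹) / (n * (n - 1)) by ring, h1]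
      apply le_of_eq; ring
    · rw [mul_zero]
      have : (0 : ℝ) ≤ x - 1 + v := by linarith
      positivity
  -- The gain is `2/5 * v * x` and the loss at least `3/5 * v * (n - x)`, both over `n (n - 1)`.
  -- Since `x < n - x`, the loss wins by a margin proportional to `v / n`.
  have hmain : upRate n x * (x / (x + v) - 1) +
      (2 / 5 * x * (x - 1 + v) / (n * (n - 1)) - downRate n x) ≤ - (v / (20 * n)) := by
    have e1 : (x : ℝ) / (x + v) - 1 ≤ - (v / (2 * x)) := by
      have : (v : ℝ) / (2 * x) ≤ v / (x + v) :=
        div_le_div_of_nonneg_left (by positivity) (by positivity) (by linarith)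
      have e : (x : ℝ) / (x + v) - 1 = -(v / (x + v)) := by field_simp; ring
      linarith
    have e2 := mul_le_mul_of_nonneg_left e1 (upRate_nonneg hn (show x ≤ n by omega))
    have e3 : upRate n x * -(v / (2 * x)) = - (3 / 5 * v * (n - x)) / (n * (n - 1)) := by
      unfold upRate; field_simp; ring
    have e4 : 2 / 5 * x * (x - 1 + v) / (n * (n - 1)) - downRate n x =
      2 / 5 * x * v / (n * (n - 1)) := by unfold downRate; ring
    rw [e3] at e2
    rw [e4]
    refine (add_le_add_left e2 _).trans ?_
    rw [← add_div, div_le_iff₀ hD]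
    have : -((v : ℝ) / (20 * n)) * (n * (n - 1)) = - (v * (n - 1) / 20) := by field_simp
    rw [this]
    nlinarith
  simp only [weightStep, if_pos hvx, if_pos (show v ≤ x + 1 by omega), hup, ← hb]
  nlinarith [mul_le_mul_of_nonneg_left hmain hbpos.le]

theorem decay_nonneg {v x : ℕ} (hvx : v ≤ x) (hx : 2 * x < n) :
    (0 : ℝ) ≤ 1 - v / (20 * n) := by
  have h1 : (v : ℝ) ≤ n := by exact_mod_cast (by omega : v ≤ n)
  have h2 : (0 : ℝ) < n := by exact_mod_cast (by omega : 0 < n)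
  rw [sub_nonneg, div_le_one (by positivity)]
  linarith

/-- The supersolution is scaled by `(2 n) ^ v`, which exceeds every `C(x + v - 1, v)` with `x < H`,
so that it is at least `1` on `[v, H)`. -/
theorem stayProb_self_le (hn : 2 ≤ n) {H v : ℕ} (hv : 1 ≤ v) (hvH : v < H) (hH : 2 * H ≤ n + 1)
    (s : ℕ) : stayProb n H v s v ≤ (1 - v / (20 * n)) ^ s * (2 * n) ^ v := by
  set V : ℕ → ℝ := fun y => (2 * n) ^ v * (if v ≤ y then ((y + v - 1).choose v : ℝ)⁻¹ else 0)
  have hr : (0 : ℝ) ≤ 1 - v / (20 * n) := decay_nonneg le_rfl (by omega)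
  have := stayProb_le_of_supersolution (n := n) (H := H) (v := v) hn (by omega) hr (V := V)
    (fun x => by simp only [V]; positivity)
    (fun x h1 h2 => by
      simp only [V, if_pos h1]
      have hc := Nat.choose_pos (show v ≤ x + v - 1 by omega)
      rw [← div_eq_mul_inv, one_le_div (by positivity)]
      have : (x + v - 1).choose v ≤ (2 * n) ^ v :=
        (Nat.choose_le_pow _ _).trans (Nat.pow_le_pow_left (by omega) _)
      exact_mod_cast this)
    (fun x h1 h2 => by
      simp only [V]
      rw [weightStep_smul, if_pos h1, mul_left_comm]
      exact mul_le_mul_of_nonneg_left (weightStep_inv_choose_le hn hv h1 (by omega)) (by positivity))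
    s v
  refine this.trans (mul_le_mul_of_nonneg_left ?_ (by positivity))
  simp only [V, if_pos le_rfl]
  have hc := Nat.choose_pos (show v ≤ v + v - 1 by omega)
  have : ((v + v - 1).choose v : ℝ)⁻¹ ≤ 1 := inv_le_one_of_one_le₀ (by exact_mod_cast hc)
  exact mul_le_of_le_one_right (by positivity) this

/-- The weight function `2^x C(n, x)` that bounds the number of strings in the input state. -/
def inputWeight (n x : ℕ) : ℝ := 2 ^ x * n.choose x

theorem inputWeight_pos {x : ℕ} (hx : x ≤ n) : 0 < inputWeight n x := by
  have := Nat.choose_pos hx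
  unfold inputWeight; positivity

theorem inputWeight_succ (x : ℕ) :
    inputWeight n (x + 1) * (x + 1) = inputWeight n x * (2 * (n - x)) := by
  have := choose_succ_cast n x
  unfold inputWeight
  rw [pow_succ]
  linear_combination 2 ^ x * 2 * this

/-- For the function `1 / (c ^ x C(n, x))` the relative drift is, to leading order, `-(2/5) (3 - c)
x (n - x - x / c) / n²`. It vanishes at the stationary value `c = 3` and is negative for `x ≤ n / 2`
if `1 < c < 3`. The value `c = 2` leaves room for the lower-order terms once `n ≥ 20`. -/
theorem weightStep_inv_inputWeight_le (hn : 20 ≤ n) {v x : ℕ} (hvx : v ≤ x) (hx0 : 1 ≤ x)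
    (hx : 2 * x < n) :
    weightStep n (fun y => (inputWeight n y)⁻¹) x ≤ (1 - v / (20 * n)) * (inputWeight n x)⁻¹ := by
  have hD := denom_pos (show 2 ≤ n by omega)
  have hn' : (20 : ℝ) ≤ n := by exact_mod_cast hn
  set b : ℝ := (inputWeight n x)⁻¹ with hb
  have hbpos : 0 < b := inv_pos.2 (inputWeight_pos (by omega))
  have hxr : (1 : ℝ) ≤ x := by exact_mod_cast hx0
  have hvxr : (v : ℝ) ≤ x := by exact_mod_cast hvx
  have hxn : 2 * (x : ℝ) + 1 ≤ n := by exact_mod_cast hx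
  have p0 := inputWeight_pos (show x ≤ n by omega)
  have p1 := inputWeight_pos (show x + 1 ≤ n by omega)
  have p2 := inputWeight_pos (show x - 1 ≤ n by omega)
  have hnx : (0 : ℝ) < n - x := by linarith
  have hup : (inputWeight n (x + 1))⁻¹ = b * ((x + 1) / (2 * (n - x))) := by
    have := inputWeight_succ (n := n) x
    rw [hb]; field_simp; linarith
  have hdown : (inputWeight n (x - 1))⁻¹ = b * (2 * (n - x + 1) / x) := by
    have := inputWeight_succ (n := n) (x - 1)
    rw [show x - 1 + 1 = x by omega, Nat.cast_sub (by omega)] at this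
    push_cast at this
    rw [hb]; field_simp; linarith
  have hmain : upRate n x * ((x + 1) / (2 * (n - x)) - 1) +
      downRate n x * (2 * (n - x + 1) / x - 1) ≤ - (v / (20 * n)) := by
    have e1 : upRate n x * ((x + 1) / (2 * (n - x)) - 1) =
        (3 / 5 * x * (x + 1) - 6 / 5 * x * (n - x)) / (n * (n - 1)) := by
      unfold upRate; field_simp; ring
    have e2 : downRate n x * (2 * (n - x + 1) / x - 1) =
        (4 / 5 * (x - 1) * (n - x + 1) - 2 / 5 * x * (x - 1)) / (n * (n - 1)) := by
      unfold downRate; field_simp; ring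
    rw [e1, e2, ← add_div, div_le_iff₀ hD]
    have : -((v : ℝ) / (20 * n)) * (n * (n - 1)) = - (v * (n - 1) / 20) := by field_simp
    rw [this]
    nlinarith [mul_nonneg (by linarith : (0 : ℝ) ≤ x) (by linarith : (0 : ℝ) ≤ n - 2 * x - 1),
      mul_nonneg (by linarith : (0 : ℝ) ≤ x) (by linarith : (0 : ℝ) ≤ n - 20),
      mul_nonneg (by linarith : (0 : ℝ) ≤ x - v) (by linarith : (0 : ℝ) ≤ n - 1)]
  simp only [weightStep, hup, hdown, ← hb]
  nlinarith [mul_le_mul_of_nonneg_left hmain hbpos.le]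

/-- The difference is the probability that the path stays in `[v, H)` and touches `v`. Above `v` it
obeys the equation of the chain, for which `1 / inputWeight` is a supersolution; the boundary value
at `v` is `stayProb_self_le`. Both decay at the same rate `1 - v / (20 n)`, so the time at which `v`
is reached does not matter. -/
theorem stayProb_sub_le (hn : 20 ≤ n) {H v : ℕ} (hv : 1 ≤ v) (hvH : v < H) (hH : 2 * H ≤ n + 1)
    (s : ℕ) : ∀ x, v ≤ x → x ≤ n → stayProb n H v s x - stayProb n H (v + 1) s x ≤
      (1 - v / (20 * n)) ^ s * (2 * n) ^ v * inputWeight n v * (inputWeight n x)⁻¹ := by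
  have hr : (0 : ℝ) ≤ 1 - v / (20 * n) := decay_nonneg (n := n) le_rfl (by omega)
  have pv := inputWeight_pos (show v ≤ n by omega)
  have hpos : ∀ s x, x ≤ n → 0 ≤ (1 - v / (20 * n) : ℝ) ^ s * (2 * n) ^ v * inputWeight n v *
      (inputWeight n x)⁻¹ := by
    intro s x hx
    have := inputWeight_pos hx
    positivity
  have hself : ∀ s, stayProb n H v s v - stayProb n H (v + 1) s v ≤
      (1 - v / (20 * n) : ℝ) ^ s * (2 * n) ^ v * inputWeight n v * (inputWeight n v)⁻¹ := by
    intro s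
    rw [mul_assoc _ (inputWeight n v), mul_inv_cancel₀ pv.ne', mul_one,
      stayProb_of_notMem (v := v + 1) (by omega), sub_zero]
    exact stayProb_self_le (by omega) hv hvH hH s
  induction s with
  | zero =>
    intro x hvx hx
    rcases hvx.eq_or_lt with rfl | h
    · exact hself 0
    · refine le_trans (le_of_eq ?_) (hpos 0 x hx)
      by_cases hxH : x < H
      · simp [stayProb, hvx, hxH, show v + 1 ≤ x by omega]
      · simp [stayProb, hxH]
  | succ s ih =>
    intro x hvx hx
    rcases hvx.eq_or_lt with rfl | h
    · exact hself (s + 1)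
    · by_cases hxH : x < H
      · rw [stayProb_succ ⟨hvx, hxH⟩, stayProb_succ ⟨h, hxH⟩, ← weightStep_sub]
        refine (weightStep_mono (by omega) (w' := fun y => ((1 - v / (20 * n) : ℝ) ^ s *
          (2 * n) ^ v * inputWeight n v) * (inputWeight n y)⁻¹) hx (ih x hvx hx)
          (fun h' => ih _ (by omega) h') (fun h' => ih _ (by omega) (by omega))).trans ?_
        rw [weightStep_smul]
        refine (mul_le_mul_of_nonneg_left (weightStep_inv_inputWeight_le hn hvx (by omega)
          (by omega)) (by positivity)).trans (le_of_eq ?_)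
        rw [pow_succ]; ring
      · rw [stayProb_of_notMem (by omega), stayProb_of_notMem (by omega), sub_zero]
        exact hpos _ _ hx

/-- Telescoping over the minimal weight `v` of the path. The factor `inputWeight n x` cancels
against the cost of descending from `x` to `v`, leaving a bound independent of `x`. -/
theorem stayProb_one_le (hn : 20 ≤ n) {H : ℕ} (hH : 2 * H ≤ n + 1) (s : ℕ) {x : ℕ} (hx : x < H) :
    inputWeight n x * stayProb n H 1 s x ≤
      ∑ v ∈ Finset.Ico 1 H, (1 - v / (20 * n) : ℝ) ^ s * (2 * n) ^ v * inputWeight n v := by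
  have px := inputWeight_pos (show x ≤ n by omega)
  have htel : ∀ y ≤ x, stayProb n H 1 s x = (∑ v ∈ Finset.Ico 1 (y + 1),
      (stayProb n H v s x - stayProb n H (v + 1) s x)) + stayProb n H (y + 1) s x := by
    intro y
    induction y with
    | zero => simp
    | succ y ih =>
      intro hy
      rw [Finset.sum_Ico_succ_top (by omega), ih (by omega)]; ring
  rw [htel x le_rfl, stayProb_of_notMem (v := x + 1) (by omega), add_zero, Finset.mul_sum]
  calc _ ≤ ∑ v ∈ Finset.Ico 1 (x + 1), (1 - v / (20 * n) : ℝ) ^ s * (2 * n) ^ v *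
        inputWeight n v := by
        refine Finset.sum_le_sum fun v hv => ?_
        rw [Finset.mem_Ico] at hv
        have := mul_le_mul_of_nonneg_left (stayProb_sub_le hn hv.1 (by omega) hH s x (by omega)
          (by omega)) px.le
        refine this.trans (le_of_eq ?_)
        field_simp
    _ ≤ _ := by
        refine Finset.sum_le_sum_of_subset_of_nonneg
          (Finset.Ico_subset_Ico le_rfl (by omega)) fun v hv _ => ?_
        rw [Finset.mem_Ico] at hv
        have hr : (0 : ℝ) ≤ 1 - v / (20 * n) := decay_nonneg (n := n) le_rfl (by omega)
        have pv := inputWeight_pos (show v ≤ n by omega)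
        positivity

/-- With `y = 4 n² exp(-s / (20 n))`, the term for the minimal weight `v` is at most `y ^ v ≤ y`:
one factor `(2 n) ^ v` comes from the supersolution and one from `inputWeight n v`. At most `n`
values of `v` and `2 n` values of `x` remain. -/
theorem sum_inputWeight_stayProb_le (hn : 20 ≤ n) {H : ℕ} (hH : 2 * H ≤ n + 1) (s : ℕ)
    (hs : 4 * (n : ℝ) ^ 2 * Real.exp (-(s / (20 * n))) ≤ 1) :
    ∑ x ∈ Finset.range (n + 1), inputWeight n x * stayProb n H 1 s x ≤
      8 * (n : ℝ) ^ 4 * Real.exp (-(s / (20 * n))) := by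
  have hn0 : (0 : ℝ) < n := by exact_mod_cast (by omega : 0 < n)
  set y : ℝ := 4 * (n : ℝ) ^ 2 * Real.exp (-(s / (20 * n))) with hy
  have hy0 : 0 ≤ y := by positivity
  have hterm : ∀ v ∈ Finset.Ico 1 H, (1 - v / (20 * n) : ℝ) ^ s * (2 * n) ^ v * inputWeight n v ≤
      y := by
    intro v hv
    rw [Finset.mem_Ico] at hv
    have hr : (0 : ℝ) ≤ 1 - v / (20 * n) := decay_nonneg (n := n) le_rfl (by omega)
    have h1 : (1 - v / (20 * n) : ℝ) ^ s ≤ Real.exp (-(s / (20 * n))) ^ v := by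
      have := pow_le_pow_left₀ hr (Real.one_sub_le_exp_neg ((v : ℝ) / (20 * n))) s
      refine this.trans (le_of_eq ?_)
      rw [← Real.exp_nat_mul, ← Real.exp_nat_mul]
      congr 1; ring
    have h2 : inputWeight n v ≤ (2 * n) ^ v := by
      have : n.choose v ≤ n ^ v := Nat.choose_le_pow _ _
      have : (n.choose v : ℝ) ≤ n ^ v := by exact_mod_cast this
      unfold inputWeight
      rw [mul_pow]
      gcongr
    calc _ ≤ Real.exp (-(s / (20 * n))) ^ v * (2 * n) ^ v * (2 * n) ^ v := by
          have := inputWeight_pos (show v ≤ n by omega)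
          gcongr
      _ = y ^ v := by rw [hy, ← mul_pow, ← mul_pow]; congr 1; ring
      _ ≤ y := pow_le_of_le_one hy0 hs (by omega)
  have hx : ∀ x ∈ Finset.range (n + 1), inputWeight n x * stayProb n H 1 s x ≤ n * y := by
    intro x _
    by_cases h : x < H
    · refine (stayProb_one_le hn hH s h).trans ((Finset.sum_le_sum hterm).trans ?_)
      rw [Finset.sum_const, nsmul_eq_mul, Nat.card_Ico]
      gcongr
      omega
    · rw [stayProb_of_notMem (by omega), mul_zero]; positivity
  refine (Finset.sum_le_sum hx).trans ?_
  rw [Finset.sum_const, nsmul_eq_mul, Finset.card_range, hy]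
  have : ((n + 1 : ℕ) : ℝ) ≤ 2 * n := by
    push_cast
    have : (1 : ℝ) ≤ n := by exact_mod_cast (by omega : 1 ≤ n)
    linarith
  calc _ ≤ (2 * n) * (n * (4 * (n : ℝ) ^ 2 * Real.exp (-(s / (20 * n))))) := by gcongr
    _ = _ := by ring

theorem stayProb_nonneg (hn : 2 ≤ n) {H v : ℕ} (hH : H ≤ n) (s x : ℕ) :
    0 ≤ stayProb n H v s x := by
  induction s generalizing x with
  | zero => simp only [stayProb]; split_ifs <;> norm_num
  | succ s ih =>
    by_cases h : v ≤ x ∧ x < H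
    · rw [stayProb_succ h]
      have := weightStep_mono hn (w := fun _ => 0) (w' := stayProb n H v s) (x := x) (by omega)
        (ih x) (fun h => ih _) (fun h => ih _)
      simpa [weightStep] using this
    · rw [stayProb_of_notMem h]

/-- The expected number of low-weight strings, when the input contains `N x` strings of
weight `x`. -/
theorem sum_mul_iterate_le (hn : 20 ≤ n) {H : ℕ} (hH : 2 * H ≤ n + 1) {N w : ℕ → ℝ}
    (hN0 : ∀ x, 0 ≤ N x) (hN : ∀ x, N x ≤ inputWeight n x)
    (hw : ∀ x, 0 ≤ w x) (hw0 : w 0 = 0) (hw1 : ∀ x, w x ≤ 1) (hwH : ∀ x, H ≤ x → w x = 0)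
    (s : ℕ) (hs : 4 * (n : ℝ) ^ 2 * Real.exp (-(s / (20 * n))) ≤ 1) :
    ∑ x ∈ Finset.range (n + 1), N x * (weightStep n)^[s] w x ≤
      8 * (n : ℝ) ^ 4 * Real.exp (-(s / (20 * n))) + (∑ x ∈ Finset.range (n + 1), N x) *
        ((∑ x ∈ Finset.range (n + 1), stringCount n x * w x) / stringCount n H) := by
  set M : ℝ := (∑ x ∈ Finset.range (n + 1), stringCount n x * w x) / stringCount n H with hM
  have hM0 : 0 ≤ M := div_nonneg (Finset.sum_nonneg fun x hx => mul_nonneg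
    (stringCount_pos (by simpa [Nat.lt_succ_iff] using hx)).le (hw x))
    (stringCount_pos (by omega)).le
  have h1 := iterate_le_stayProb_add (n := n) (H := H) (M := M) (w := w) (by omega) hM0 hw0 hw1
    (fun x hx => (hwH x hx).le) (fun s => iterate_le_of_stationary (by omega) hw s (by omega)) s
  calc _ ≤ ∑ x ∈ Finset.range (n + 1), (inputWeight n x * stayProb n H 1 s x + N x * M) := by
        refine Finset.sum_le_sum fun x hx => ?_
        have hx' : x ≤ n := by simpa [Nat.lt_succ_iff] using hx
        refine (mul_le_mul_of_nonneg_left (h1 x hx') (hN0 x)).trans ?_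
        rw [mul_add]
        gcongr
        · exact stayProb_nonneg (by omega) (by omega) _ _
        · exact hN x
    _ ≤ _ := by
        rw [Finset.sum_add_distrib, Finset.sum_mul]
        gcongr
        exact sum_inputWeight_stayProb_le hn hH s hs

end RandomCircuit

namespace RandomCircuit

/-! ### Pauli matrices -/

theorem pauli_conjTranspose (a : Fin 4) : (pauli a)ᴴ = pauli a := by
  fin_cases a <;> ext i j <;> fin_cases i <;> fin_cases j <;> simp [pauli]

theorem pauli_zero : pauli 0 = 1 := by
  ext i j; fin_cases i <;> fin_cases j <;> simp [pauli]

theorem pauli_mul_self (a : Fin 4) : pauli a * pauli a = 1 := by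
  fin_cases a <;> ext i j <;> fin_cases i <;> fin_cases j <;>
    simp [pauli, Matrix.mul_apply, Fin.sum_univ_two]

theorem pauli_mul (a b : Fin 4) :
    ∃ c j : Fin 4, pauli a * pauli b = Complex.I ^ (j : ℕ) • pauli c := by
  have h01 : pauli 1 * pauli 2 = Complex.I ^ 1 • pauli 3 := by
    ext i j; fin_cases i <;> fin_cases j <;> simp [pauli, Matrix.mul_apply, Fin.sum_univ_two]
  have h12 : pauli 2 * pauli 3 = Complex.I ^ 1 • pauli 1 := by
    ext i j; fin_cases i <;> fin_cases j <;> simp [pauli, Matrix.mul_apply, Fin.sum_univ_two]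
  have h20 : pauli 3 * pauli 1 = Complex.I ^ 1 • pauli 2 := by
    ext i j; fin_cases i <;> fin_cases j <;> simp [pauli, Matrix.mul_apply, Fin.sum_univ_two]
  have h10 : pauli 2 * pauli 1 = Complex.I ^ 3 • pauli 3 := by
    ext i j; fin_cases i <;> fin_cases j <;> simp [pauli, Matrix.mul_apply, Fin.sum_univ_two]
  have h21 : pauli 3 * pauli 2 = Complex.I ^ 3 • pauli 1 := by
    ext i j; fin_cases i <;> fin_cases j <;> simp [pauli, Matrix.mul_apply, Fin.sum_univ_two]
  have h02 : pauli 1 * pauli 3 = Complex.I ^ 3 • pauli 2 := by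
    ext i j; fin_cases i <;> fin_cases j <;> simp [pauli, Matrix.mul_apply, Fin.sum_univ_two]
  rcases eq_or_ne a 0 with rfl | ha
  · exact ⟨b, 0, by simp [pauli_zero]⟩
  rcases eq_or_ne b 0 with rfl | hb
  · exact ⟨a, 0, by simp [pauli_zero]⟩
  rcases eq_or_ne a b with rfl | hab
  · exact ⟨0, 0, by simp [pauli_zero, pauli_mul_self]⟩
  fin_cases a <;> fin_cases b <;> first | contradiction | skip
  exacts [⟨3, 1, h01⟩, ⟨2, 3, h02⟩, ⟨3, 3, h10⟩, ⟨1, 1, h12⟩, ⟨2, 1, h20⟩, ⟨1, 3, h21⟩]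

/-- Two Pauli matrices anticommute. -/
def Anti (a b : Fin 4) : Prop := a ≠ 0 ∧ b ≠ 0 ∧ a ≠ b

instance (a b : Fin 4) : Decidable (Anti a b) := by unfold Anti; infer_instance

/-- The commutation sign of two Pauli matrices. -/
def commSign (a b : Fin 4) : ℂ := if Anti a b then -1 else 1

theorem pauli_comm (a b : Fin 4) : pauli a * pauli b = commSign a b • (pauli b * pauli a) := by
  unfold commSign
  split_ifs with h
  · obtain ⟨h1, h2, h3⟩ := h
    fin_cases a <;> fin_cases b <;> first | contradiction | skip
    all_goals ext i j; fin_cases i <;> fin_cases j <;>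
      simp [pauli, Matrix.mul_apply, Fin.sum_univ_two]
  · simp only [Anti, not_and_or, not_not] at h
    rcases h with rfl | rfl | rfl <;> simp [pauli_zero]

theorem sum_pauli_mul_star (x y x' y' : Fin 2) :
    ∑ a, pauli a x y * star (pauli a x' y') = if x = x' ∧ y = y' then 2 else 0 := by
  fin_cases x <;> fin_cases y <;> fin_cases x' <;> fin_cases y' <;>
    simp [pauli, Fin.sum_univ_four] <;> norm_num

/-- A family of matrices satisfying the completeness relation satisfies Parseval's identity. -/
theorem sum_norm_sq_of_complete {K ι : Type*} [Fintype K] [Fintype ι] [DecidableEq ι]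
    (σ : K → Matrix ι ι ℂ) (D : ℝ)
    (h : ∀ x y x' y', ∑ a, σ a x y * star (σ a x' y') = if x = x' ∧ y = y' then (D : ℂ) else 0)
    (Z : Matrix ι ι ℂ) :
    ∑ a, ‖(Z * σ a).trace‖ ^ 2 = D * ∑ x, ∑ y, ‖Z x y‖ ^ 2 := by
  have key : ∀ a, (((‖(Z * σ a).trace‖ ^ 2 : ℝ)) : ℂ) =
      ∑ p : ι × ι, ∑ q : ι × ι, Z p.1 p.2 * star (Z q.1 q.2) *
        (σ a p.2 p.1 * star (σ a q.2 q.1)) := by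
    intro a
    have ht : (Z * σ a).trace = ∑ p : ι × ι, Z p.1 p.2 * σ a p.2 p.1 := by
      simp [Matrix.trace, Matrix.mul_apply, Fintype.sum_prod_type]
    rw [ht, Complex.ofReal_pow, ← Complex.mul_conj', map_sum, Finset.sum_mul_sum]
    refine Finset.sum_congr rfl fun p _ => Finset.sum_congr rfl fun q _ => ?_
    simp only [map_mul, starRingEnd_apply]
    ring
  apply Complex.ofReal_injective
  rw [Complex.ofReal_sum, Finset.sum_congr rfl fun a _ => key a, Finset.sum_comm]
  simp_rw [Finset.sum_comm (s := (Finset.univ : Finset K)), ← Finset.mul_sum, h]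
  have : ∀ p q : ι × ι, (if p.2 = q.2 ∧ p.1 = q.1 then (D : ℂ) else 0) =
      if p = q then (D : ℂ) else 0 := by
    intro p q
    congr 1
    rw [Prod.ext_iff, and_comm]
  simp_rw [this, mul_ite, mul_zero]
  simp only [Finset.sum_ite_eq, Finset.mem_univ, if_true, Complex.ofReal_mul, Complex.ofReal_sum,
    Fintype.sum_prod_type, Finset.mul_sum]
  refine Finset.sum_congr rfl fun x _ => Finset.sum_congr rfl fun y _ => ?_
  rw [Complex.ofReal_pow, ← Complex.mul_conj', starRingEnd_apply]
  ring

/-! ### Two-qubit Pauli and Clifford operators -/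

/-- The two-qubit Pauli matrices. -/
def pauliPair (q : Fin 4 × Fin 4) : Matrix (Fin 2 × Fin 2) (Fin 2 × Fin 2) ℂ :=
  pauli q.1 ⊗ₖ pauli q.2

theorem pauliPair_conjTranspose (q : Fin 4 × Fin 4) : (pauliPair q)ᴴ = pauliPair q := by
  simp only [pauliPair, Matrix.conjTranspose_kronecker, pauli_conjTranspose]

theorem pauliPair_zero : pauliPair 0 = 1 := by
  simp [pauliPair, pauli_zero]

theorem pauliPair_mul_self (q : Fin 4 × Fin 4) : pauliPair q * pauliPair q = 1 := by
  simp only [pauliPair, ← Matrix.mul_kronecker_mul, pauli_mul_self, Matrix.one_kronecker_one]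

theorem I_pow_mod (j : ℕ) : Complex.I ^ j = Complex.I ^ ((Fin.ofNat 4 j : Fin 4) : ℕ) := by
  rw [Fin.val_ofNat, Complex.I_pow_eq_pow_mod]

theorem pauliPair_mul (p q : Fin 4 × Fin 4) :
    ∃ (r : Fin 4 × Fin 4) (j : ℕ), pauliPair p * pauliPair q = Complex.I ^ j • pauliPair r := by
  obtain ⟨c, j, h⟩ := pauli_mul p.1 q.1
  obtain ⟨c', j', h'⟩ := pauli_mul p.2 q.2
  refine ⟨(c, c'), j + j', ?_⟩
  simp only [pauliPair, ← Matrix.mul_kronecker_mul, h, h', Matrix.smul_kronecker,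
    Matrix.kronecker_smul, smul_smul, pow_add]
  rw [mul_comm]

/-- The commutation sign of two-qubit Pauli matrices. -/
def commSignPair (p q : Fin 4 × Fin 4) : ℂ := commSign p.1 q.1 * commSign p.2 q.2

theorem commSignPair_eq (p q : Fin 4 × Fin 4) : commSignPair p q = 1 ∨ commSignPair p q = -1 := by
  unfold commSignPair commSign
  split_ifs <;> simp

theorem pauliPair_comm (p q : Fin 4 × Fin 4) :
    pauliPair p * pauliPair q = commSignPair p q • (pauliPair q * pauliPair p) := by
  simp only [pauliPair, ← Matrix.mul_kronecker_mul, commSignPair]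
  rw [pauli_comm p.1, pauli_comm p.2, Matrix.smul_kronecker, Matrix.kronecker_smul, smul_smul]

/-- Two two-qubit Pauli matrices anticommute. -/
def AntiPair (p q : Fin 4 × Fin 4) : Prop := Xor (Anti p.1 q.1) (Anti p.2 q.2)

instance (p q : Fin 4 × Fin 4) : Decidable (AntiPair p q) := by unfold AntiPair; infer_instance

theorem AntiPair.commSignPair_eq_neg_one {p q : Fin 4 × Fin 4} (h : AntiPair p q) :
    commSignPair p q = -1 := by
  unfold commSignPair commSign
  rcases h with ⟨h1, h2⟩ | ⟨h1, h2⟩ <;> simp [h1, h2]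

/-- Makes the graph of anticommutation on the 15 nonidentity operators connected in two steps, so
that exchanges of anticommuting pairs act transitively. -/
theorem exists_antiPair : ∀ p q : Fin 4 × Fin 4, p ≠ 0 → q ≠ 0 →
    ∃ r, r ≠ 0 ∧ AntiPair p r ∧ AntiPair r q := by
  decide

theorem sum_pauliPair_mul_star (x y x' y' : Fin 2 × Fin 2) :
    ∑ a, pauliPair a x y * star (pauliPair a x' y') =
      if x = x' ∧ y = y' then ((4 : ℝ) : ℂ) else 0 := by
  have : ∑ a, pauliPair a x y * star (pauliPair a x' y') =
      (∑ a, pauli a x.1 y.1 * star (pauli a x'.1 y'.1)) *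
      ∑ a, pauli a x.2 y.2 * star (pauli a x'.2 y'.2) := by
    rw [Fintype.sum_prod_type, Finset.sum_mul_sum]
    refine Finset.sum_congr rfl fun p _ => Finset.sum_congr rfl fun q _ => ?_
    simp only [pauliPair, Matrix.kroneckerMap_apply, star_mul']
    ring
  rw [this, sum_pauli_mul_star, sum_pauli_mul_star]
  by_cases h1 : x.1 = x'.1 <;> by_cases h2 : x.2 = x'.2 <;> by_cases h3 : y.1 = y'.1 <;>
    by_cases h4 : y.2 = y'.2 <;> (simp [h1, h2, h3, h4, Prod.ext_iff]; try norm_num)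

/-- The matrix of the gate that exchanges two anticommuting Pauli operators. -/
def exchangeMatrix (p q : Fin 4 × Fin 4) : Matrix (Fin 2 × Fin 2) (Fin 2 × Fin 2) ℂ :=
  ((Real.sqrt 2)⁻¹ : ℂ) • (pauliPair p + pauliPair q)

theorem inv_sqrt_two_mul_self : ((Real.sqrt 2)⁻¹ : ℂ) * ((Real.sqrt 2)⁻¹ : ℂ) = 1 / 2 := by
  rw [← mul_inv, ← Complex.ofReal_mul, Real.mul_self_sqrt (by norm_num)]
  norm_num

theorem exchangeMatrix_conj (p q : Fin 4 × Fin 4) (X : Matrix (Fin 2 × Fin 2) (Fin 2 × Fin 2) ℂ) :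
    exchangeMatrix p q * X * exchangeMatrix p q =
      (1 / 2 : ℂ) • ((pauliPair p + pauliPair q) * X * (pauliPair p + pauliPair q)) := by
  unfold exchangeMatrix
  rw [Matrix.smul_mul, Matrix.smul_mul, Matrix.mul_smul, smul_smul, inv_sqrt_two_mul_self]

variable {p q : Fin 4 × Fin 4}

theorem AntiPair.mul_eq (h : AntiPair p q) :
    pauliPair p * pauliPair q = -(pauliPair q * pauliPair p) := by
  rw [pauliPair_comm, h.commSignPair_eq_neg_one, neg_one_smul]

theorem AntiPair.exchangeMatrix_mul_self (h : AntiPair p q) :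
    exchangeMatrix p q * exchangeMatrix p q = 1 := by
  have := exchangeMatrix_conj p q 1
  rw [mul_one, mul_one] at this
  rw [this, add_mul, mul_add, mul_add, pauliPair_mul_self, pauliPair_mul_self, h.mul_eq]
  rw [show (1 : Matrix (Fin 2 × Fin 2) (Fin 2 × Fin 2) ℂ) + -(pauliPair q * pauliPair p) +
    (pauliPair q * pauliPair p + 1) = (2 : ℂ) • 1 by rw [two_smul]; abel, smul_smul]
  norm_num

theorem AntiPair.exchangeMatrix_conj_left (h : AntiPair p q) :
    exchangeMatrix p q * pauliPair p * exchangeMatrix p q = pauliPair q := by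
  rw [exchangeMatrix_conj]
  have e1 : pauliPair q * pauliPair p * pauliPair q = - pauliPair p := by
    have := h.mul_eq
    rw [eq_neg_iff_add_eq_zero, add_comm, ← eq_neg_iff_add_eq_zero] at this
    rw [this, neg_mul, mul_assoc, pauliPair_mul_self, mul_one]
  rw [add_mul, pauliPair_mul_self, add_mul, mul_add, mul_add, e1, mul_assoc, pauliPair_mul_self,
    one_mul, one_mul, mul_one]
  rw [show pauliPair p + pauliPair q + (pauliPair q + -pauliPair p) = (2 : ℂ) • pauliPair q by
    rw [two_smul]; abel, smul_smul]
  norm_num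

theorem exchangeMatrix_conjTranspose : (exchangeMatrix p q)ᴴ = exchangeMatrix p q := by
  simp [exchangeMatrix, Matrix.conjTranspose_smul, pauliPair_conjTranspose]

/-- The Clifford gate that exchanges two anticommuting Pauli operators. -/
def AntiPair.gate (h : AntiPair p q) : TwoQubitGate :=
  ⟨exchangeMatrix p q, by
    rw [Matrix.mem_unitaryGroup_iff, Matrix.star_eq_conjTranspose, exchangeMatrix_conjTranspose,
      h.exchangeMatrix_mul_self]⟩

/-- If `σ_r` has the same commutation sign with `σ_p` and `σ_q`, conjugation returns `± σ_r`;
otherwise it returns `± σ_r σ_p σ_q`. Both are Pauli operators up to a power of `i`. -/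
theorem AntiPair.exchange_conj_mem (h : AntiPair p q) (r : Fin 4 × Fin 4) :
    ∃ (s : Fin 4 × Fin 4) (j : ℕ), exchangeMatrix p q * pauliPair r * exchangeMatrix p q =
      Complex.I ^ j • pauliPair s := by
  rw [exchangeMatrix_conj]
  have hp : pauliPair p * pauliPair r = commSignPair p r • (pauliPair r * pauliPair p) :=
    pauliPair_comm p r
  have hq : pauliPair q * pauliPair r = commSignPair q r • (pauliPair r * pauliPair q) :=
    pauliPair_comm q r
  have expand : (pauliPair p + pauliPair q) * pauliPair r * (pauliPair p + pauliPair q) =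
      (commSignPair p r + commSignPair q r) • pauliPair r +
      (commSignPair p r - commSignPair q r) • (pauliPair r * (pauliPair p * pauliPair q)) := by
    rw [add_mul, hp, hq, add_mul, mul_add, mul_add, Matrix.smul_mul, Matrix.smul_mul,
      Matrix.smul_mul, Matrix.smul_mul, mul_assoc, mul_assoc, mul_assoc, mul_assoc,
      pauliPair_mul_self, pauliPair_mul_self, mul_one, h.mul_eq, mul_neg, add_smul, sub_smul,
      smul_neg, smul_neg]
    abel
  have neg_case : ∀ (j : ℕ) (s : Fin 4 × Fin 4),
      -(Complex.I ^ j • pauliPair s) = Complex.I ^ (j + 2) • pauliPair s := by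
    intro j s; rw [pow_add, Complex.I_sq, mul_neg_one, neg_smul]
  obtain ⟨u, j, hu⟩ := pauliPair_mul p q
  obtain ⟨u', j', hu'⟩ := pauliPair_mul r u
  have hprod : pauliPair r * (pauliPair p * pauliPair q) = Complex.I ^ (j + j') • pauliPair u' := by
    rw [hu, Matrix.mul_smul, hu', smul_smul, pow_add]
  rw [expand, smul_add, smul_smul, smul_smul, hprod]
  rcases commSignPair_eq p r with h1 | h1 <;> rcases commSignPair_eq q r with h2 | h2 <;>
    rw [h1, h2]
  · exact ⟨r, 0, by norm_num⟩
  · exact ⟨u', j + j', by norm_num⟩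
  · exact ⟨u', j + j' + 2, by rw [← neg_case]; norm_num⟩
  · exact ⟨r, 0 + 2, by rw [← neg_case]; norm_num⟩

theorem AntiPair.gate_mem_cliffordGroup (h : AntiPair p q) : h.gate ∈ cliffordGroup := by
  have hsq : h.gate * h.gate = 1 := Subtype.ext h.exchangeMatrix_mul_self
  have hinv : h.gate⁻¹ = h.gate := inv_eq_of_mul_eq_one_left hsq
  have hmem : ∀ P ∈ pauliGroup, h.gate * P * h.gate⁻¹ ∈ pauliGroup := by
    rintro P ⟨a, b, j, hP⟩
    rw [hinv]
    obtain ⟨s, j', hs⟩ := h.exchange_conj_mem (a, b)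
    refine ⟨s.1, s.2, Fin.ofNat 4 (j + j'), ?_⟩
    rw [← I_pow_mod]
    change exchangeMatrix p q * (P : Matrix _ _ ℂ) * exchangeMatrix p q = _
    rw [hP, Matrix.mul_smul, Matrix.smul_mul]
    change Complex.I ^ (j : ℕ) • (exchangeMatrix p q * pauliPair (a, b) * exchangeMatrix p q) = _
    rw [hs, smul_smul, pow_add]
    rfl
  rw [cliffordGroup, Subgroup.mem_set_normalizer_iff]
  intro P
  refine ⟨hmem P, fun hP => ?_⟩
  have := hmem _ hP
  rw [hinv] at this
  have e : h.gate * (h.gate * P * h.gate) * h.gate = P := by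
    rw [← mul_assoc, ← mul_assoc, hsq, one_mul, mul_assoc, hsq, mul_one]
  rwa [e] at this

/-! ### Averages over a random gate -/

/-- The only property of the gate law that the second moments require; it lets both gate models be
treated together. -/
theorem integral_gateLaw_mul_left (model : GateModel) {V : TwoQubitGate} (hV : V ∈ cliffordGroup)
    (f : TwoQubitGate → ℝ) : ∫ U, f (V * U) ∂gateLaw model = ∫ U, f U ∂gateLaw model := by
  cases model
  · exact integral_mul_left_eq_self (μ := Measure.haarMeasure ⊤) f V
  · have hemb : MeasurableEmbedding (Subtype.val : cliffordGroup → TwoQubitGate) :=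
      MeasurableEmbedding.subtype_coe isClosed_cliffordGroup.measurableSet
    unfold gateLaw
    rw [hemb.integral_map, hemb.integral_map]
    exact integral_mul_left_eq_self (fun U : cliffordGroup => f U) ⟨V, hV⟩

/-- The squared component of `Z` along the Pauli matrix `q`, conjugated by the gate `U`. -/
def gateCoeff (Z : Matrix (Fin 2 × Fin 2) (Fin 2 × Fin 2) ℂ) (q : Fin 4 × Fin 4)
    (U : TwoQubitGate) : ℝ :=
  ‖(Z * ((U : Matrix (Fin 2 × Fin 2) (Fin 2 × Fin 2) ℂ)ᴴ * pauliPair q * U)).trace‖ ^ 2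

theorem continuous_gateCoeff (Z : Matrix (Fin 2 × Fin 2) (Fin 2 × Fin 2) ℂ)
    (q : Fin 4 × Fin 4) : Continuous (gateCoeff Z q) := by
  unfold gateCoeff
  have : Continuous fun U : TwoQubitGate => (U : Matrix (Fin 2 × Fin 2) (Fin 2 × Fin 2) ℂ) :=
    continuous_subtype_val
  fun_prop

theorem integrable_gateLaw (model : GateModel) {f : TwoQubitGate → ℝ} (hf : Continuous f) :
    Integrable f (gateLaw model) :=
  hf.integrable_of_hasCompactSupport (HasCompactSupport.of_compactSpace f)

theorem sum_norm_sq_eq_trace {ι : Type*} [Fintype ι] (X : Matrix ι ι ℂ) :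
    (((∑ x, ∑ y, ‖X x y‖ ^ 2 : ℝ)) : ℂ) = (Xᴴ * X).trace := by
  simp only [Matrix.trace, Matrix.diag, Matrix.mul_apply, Matrix.conjTranspose_apply,
    Complex.ofReal_sum, Complex.ofReal_pow]
  rw [Finset.sum_comm]
  refine Finset.sum_congr rfl fun x _ => Finset.sum_congr rfl fun y _ => ?_
  rw [← Complex.conj_mul', starRingEnd_apply]

/-- By Parseval the sum is four times the squared Hilbert–Schmidt norm of `U Z U†`, which does not
depend on the unitary `U`. -/
theorem sum_gateCoeff (Z : Matrix (Fin 2 × Fin 2) (Fin 2 × Fin 2) ℂ) (U : TwoQubitGate) :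
    ∑ q, gateCoeff Z q U = ∑ q, gateCoeff Z q 1 := by
  have hU : (U : Matrix (Fin 2 × Fin 2) (Fin 2 × Fin 2) ℂ)ᴴ * U = 1 := by
    have := Matrix.mem_unitaryGroup_iff'.1 U.2
    rwa [Matrix.star_eq_conjTranspose] at this
  have key : ∀ V : TwoQubitGate, ∑ q, gateCoeff Z q V =
      4 * ∑ x, ∑ y, ‖((V : Matrix (Fin 2 × Fin 2) (Fin 2 × Fin 2) ℂ) * Z *
        (V : Matrix (Fin 2 × Fin 2) (Fin 2 × Fin 2) ℂ)ᴴ) x y‖ ^ 2 := by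
    intro V
    rw [← sum_norm_sq_of_complete _ 4 sum_pauliPair_mul_star]
    refine Finset.sum_congr rfl fun q _ => ?_
    unfold gateCoeff
    rw [mul_assoc, ← mul_assoc, ← mul_assoc, Matrix.trace_mul_comm, ← mul_assoc, ← mul_assoc]
  rw [key, key]
  congr 1
  apply Complex.ofReal_injective
  rw [sum_norm_sq_eq_trace, sum_norm_sq_eq_trace]
  simp only [Matrix.conjTranspose_mul, Matrix.conjTranspose_conjTranspose, OneMemClass.coe_one,
    Matrix.conjTranspose_one, mul_one, one_mul]
  rw [mul_assoc, Matrix.trace_mul_comm]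
  simp only [mul_assoc, hU, mul_one]
  simp only [← mul_assoc]
  rw [mul_assoc (Zᴴ), hU, mul_one]

theorem gateCoeff_zero (Z : Matrix (Fin 2 × Fin 2) (Fin 2 × Fin 2) ℂ) (U : TwoQubitGate) :
    gateCoeff Z 0 U = gateCoeff Z 0 1 := by
  have hU : (U : Matrix (Fin 2 × Fin 2) (Fin 2 × Fin 2) ℂ)ᴴ * U = 1 := by
    have := Matrix.mem_unitaryGroup_iff'.1 U.2
    rwa [Matrix.star_eq_conjTranspose] at this
  simp [gateCoeff, pauliPair_zero, hU]

/-- Substituting `V U` for `U`, with `V` the exchange gate, turns `U† σ_p U` into `U† σ_q U`. -/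
theorem integral_gateCoeff_eq_of_antiPair (model : GateModel)
    (Z : Matrix (Fin 2 × Fin 2) (Fin 2 × Fin 2) ℂ) (h : AntiPair p q) :
    ∫ U, gateCoeff Z p U ∂gateLaw model = ∫ U, gateCoeff Z q U ∂gateLaw model := by
  rw [← integral_gateLaw_mul_left model h.gate_mem_cliffordGroup]
  refine integral_congr_ae (Filter.Eventually.of_forall fun U => ?_)
  simp only [gateCoeff]
  rw [← h.exchangeMatrix_conj_left]
  have : ((h.gate * U : TwoQubitGate) : Matrix (Fin 2 × Fin 2) (Fin 2 × Fin 2) ℂ) =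
    exchangeMatrix p q * U := rfl
  rw [this, Matrix.conjTranspose_mul, exchangeMatrix_conjTranspose]
  simp only [mul_assoc]

/-- A random two-qubit gate maps every non-identity Pauli operator to a uniformly random
non-identity Pauli operator, as far as second moments are concerned. -/
theorem integral_gateCoeff (model : GateModel) (Z : Matrix (Fin 2 × Fin 2) (Fin 2 × Fin 2) ℂ)
    (hp : p ≠ 0) : ∫ U, gateCoeff Z p U ∂gateLaw model =
      (∑ q ∈ Finset.univ.erase 0, gateCoeff Z q 1) / 15 := by
  have heq : ∀ q ∈ Finset.univ.erase (0 : Fin 4 × Fin 4),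
      ∫ U, gateCoeff Z q U ∂gateLaw model = ∫ U, gateCoeff Z p U ∂gateLaw model := by
    intro q hq
    obtain ⟨r, -, h1, h2⟩ := exists_antiPair q p (Finset.ne_of_mem_erase hq) hp
    rw [integral_gateCoeff_eq_of_antiPair model Z h1, integral_gateCoeff_eq_of_antiPair model Z h2]
  have hsum : ∫ U, ∑ q ∈ Finset.univ.erase (0 : Fin 4 × Fin 4), gateCoeff Z q U ∂gateLaw model =
      ∑ q ∈ Finset.univ.erase (0 : Fin 4 × Fin 4), gateCoeff Z q 1 := by
    have : ∀ U : TwoQubitGate, ∑ q ∈ Finset.univ.erase (0 : Fin 4 × Fin 4), gateCoeff Z q U =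
        ∑ q ∈ Finset.univ.erase (0 : Fin 4 × Fin 4), gateCoeff Z q 1 := by
      intro U
      rw [Finset.sum_erase_eq_sub (Finset.mem_univ _), Finset.sum_erase_eq_sub (Finset.mem_univ _),
        sum_gateCoeff, gateCoeff_zero]
    simp [this]
  rw [integral_finsetSum _ fun q _ => integrable_gateLaw model (continuous_gateCoeff Z q),
    Finset.sum_congr rfl heq, Finset.sum_const] at hsum
  have hc : (Finset.univ.erase (0 : Fin 4 × Fin 4)).card = 15 := by decide
  rw [hc] at hsum
  rw [← hsum]
  simp

end RandomCircuit

namespace RandomCircuit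

/-! ### Pauli strings -/

/-- The Pauli string `⨂ᵢ σ_{ν i}`. -/
def pauliString {ι : Type} [Fintype ι] (ν : ι → Fin 4) : Matrix (Bits ι) (Bits ι) ℂ :=
  Matrix.of fun b c => ∏ i, pauli (ν i) (b i) (c i)

theorem pauliString_zero {ι : Type} [Fintype ι] [DecidableEq ι] :
    pauliString (0 : ι → Fin 4) = 1 := by
  ext b c
  simp only [pauliString, Matrix.of_apply, Pi.zero_apply, pauli_zero, Matrix.one_apply]
  rw [Finset.prod_ite_zero]
  simp [funext_iff]

theorem pauliString_conjTranspose {ι : Type} [Fintype ι] (ν : ι → Fin 4) :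
    (pauliString ν)ᴴ = pauliString ν := by
  ext b c
  simp only [pauliString, Matrix.conjTranspose_apply, Matrix.of_apply, star_prod]
  refine Finset.prod_congr rfl fun i _ => ?_
  rw [← Matrix.conjTranspose_apply, pauli_conjTranspose]

theorem sum_pauliString_mul_star {ι : Type} [Fintype ι] [DecidableEq ι] (x y x' y' : Bits ι) :
    ∑ ν, pauliString ν x y * star (pauliString ν x' y') =
      if x = x' ∧ y = y' then ((2 ^ Fintype.card ι : ℝ) : ℂ) else 0 := by
  have : ∀ ν : ι → Fin 4, pauliString ν x y * star (pauliString ν x' y') =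
      ∏ i, pauli (ν i) (x i) (y i) * star (pauli (ν i) (x' i) (y' i)) := by
    intro ν
    simp only [pauliString, Matrix.of_apply, star_prod, Finset.prod_mul_distrib]
  simp_rw [this]
  rw [← Fintype.prod_sum fun i a => pauli a (x i) (y i) * star (pauli a (x' i) (y' i))]
  simp_rw [sum_pauli_mul_star]
  rw [Finset.prod_ite_zero]
  simp only [Finset.mem_univ, forall_const, funext_iff, forall_and, Finset.prod_const,
    Finset.card_univ]
  push_cast
  rfl

section Split

variable {n : ℕ} {i j : Fin n}

/-- The indices other than `i` and `j`. -/
abbrev Others (i j : Fin n) : Type := {k : Fin n // k ≠ i ∧ k ≠ j}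

/-- Splitting off the values at two indices. -/
def splitEquiv (hij : i ≠ j) (α : Type) : (Fin n → α) ≃ (α × α) × (Others i j → α) where
  toFun f := ((f i, f j), fun k => f k)
  invFun x k := if hi : k = i then x.1.1 else if hj : k = j then x.1.2 else x.2 ⟨k, hi, hj⟩
  left_inv f := by
    funext k
    by_cases hi : k = i
    · simp [hi]
    · by_cases hj : k = j
      · subst hj; simp [hi]
      · simp [hi, hj]
  right_inv x := by
    refine Prod.ext (Prod.ext (by simp) (by simp [hij.symm])) (funext fun k => ?_)
    simp [k.2.1, k.2.2]

theorem prod_split {R : Type*} [CommMonoid R] (hij : i ≠ j) (f : Fin n → R) :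
    ∏ k, f k = f i * f j * ∏ k : Others i j, f k := by
  rw [← Finset.mul_prod_erase Finset.univ f (Finset.mem_univ i),
    ← Finset.mul_prod_erase (Finset.univ.erase i) f (by simp [hij.symm] : j ∈ _), mul_assoc]
  congr 2
  exact Finset.prod_subtype _ (fun k => by simp [and_comm]) f

theorem gateMatrix_eq {p : QubitPair n} (U : TwoQubitGate) :
    gateMatrix (p, U) = ((U : Matrix (Fin 2 × Fin 2) (Fin 2 × Fin 2) ℂ) ⊗ₖ
      (1 : Matrix (Bits (Others p.1.1 p.1.2)) (Bits (Others p.1.1 p.1.2)) ℂ)).submatrix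
      (splitEquiv p.2.ne (Fin 2)) (splitEquiv p.2.ne (Fin 2)) := by
  ext b b'
  simp only [gateMatrix, Matrix.of_apply, Matrix.submatrix_apply, Matrix.kroneckerMap_apply,
    splitEquiv, Equiv.coe_fn_mk, Matrix.one_apply, funext_iff, Subtype.forall, mul_ite, mul_one,
    mul_zero, and_imp]

theorem pauliString_eq (hij : i ≠ j) (ν : Fin n → Fin 4) :
    pauliString ν = (pauliPair (splitEquiv hij _ ν).1 ⊗ₖ
      pauliString (splitEquiv hij _ ν).2).submatrix
      (splitEquiv hij (Fin 2)) (splitEquiv hij (Fin 2)) := by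
  ext b c
  simp only [pauliString, Matrix.of_apply, Matrix.submatrix_apply, Matrix.kroneckerMap_apply,
    splitEquiv, Equiv.coe_fn_mk, pauliPair]
  rw [prod_split hij]

theorem hammingNorm_eq_sum {ι : Type} [Fintype ι] (ν : ι → Fin 4) :
    hammingNorm ν = ∑ k, if ν k = 0 then 0 else 1 := by
  unfold hammingNorm
  rw [Finset.card_filter]
  exact Finset.sum_congr rfl fun k _ => by by_cases h : ν k = 0 <;> simp [h]

/-- The number of non-identity factors of a two-qubit Pauli operator. -/
def pairWeight (q : Fin 4 × Fin 4) : ℕ :=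
  (if q.1 = 0 then 0 else 1) + (if q.2 = 0 then 0 else 1)

theorem hammingNorm_split (hij : i ≠ j) (ν : Fin n → Fin 4) :
    hammingNorm ν = pairWeight (splitEquiv hij _ ν).1 + hammingNorm (splitEquiv hij _ ν).2 := by
  -- The sum is written multiplicatively so that `prod_split` applies to it.
  rw [hammingNorm_eq_sum, hammingNorm_eq_sum, ← toAdd_ofAdd (∑ k, if ν k = 0 then 0 else 1),
    ofAdd_sum, prod_split hij]
  rfl

end Split

/-- The partial contraction of `Γ` with an operator on the second tensor factor. -/
def contract {κ ρ : Type*} [Fintype ρ] (Γ : Matrix (κ × ρ) (κ × ρ) ℂ) (Y : Matrix ρ ρ ℂ) :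
    Matrix κ κ ℂ :=
  Matrix.of fun x y => ∑ r, ∑ r', Γ (x, r) (y, r') * Y r' r

theorem trace_mul_kronecker {κ ρ : Type*} [Fintype κ] [Fintype ρ] (Γ : Matrix (κ × ρ) (κ × ρ) ℂ)
    (X : Matrix κ κ ℂ) (Y : Matrix ρ ρ ℂ) :
    (Γ * (X ⊗ₖ Y)).trace = (contract Γ Y * X).trace := by
  simp only [Matrix.trace, Matrix.diag, Matrix.mul_apply, Fintype.sum_prod_type,
    Matrix.kroneckerMap_apply, contract, Matrix.of_apply, Finset.sum_mul]
  refine Finset.sum_congr rfl fun x _ => ?_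
  rw [Finset.sum_comm]
  refine Finset.sum_congr rfl fun y _ => Finset.sum_congr rfl fun r _ =>
    Finset.sum_congr rfl fun r' _ => by ring

/-! ### Evolution of the Pauli weights under a random gate -/

/-- The sum of the squared Pauli components of `Γ`, weighted by a function of the weight. -/
def pauliWeightSum {n : ℕ} (w : ℕ → ℝ) (Γ : Matrix (Bits (Fin n)) (Bits (Fin n)) ℂ) : ℝ :=
  ∑ ν : Fin n → Fin 4, w (hammingNorm ν) * ‖(Γ * pauliString ν).trace‖ ^ 2

variable {n : ℕ}

/-- Contracting `Γ` with the part of the string outside the pair leaves a two-qubit operator, so the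
gate average is a two-qubit problem for each outer string. -/
theorem trace_conj_gateMatrix (p : QubitPair n) (U : TwoQubitGate)
    (Γ : Matrix (Bits (Fin n)) (Bits (Fin n)) ℂ) (ν : Fin n → Fin 4) :
    ‖(gateMatrix (p, U) * Γ * (gateMatrix (p, U))ᴴ * pauliString ν).trace‖ ^ 2 =
      gateCoeff (contract (Γ.submatrix (splitEquiv p.2.ne (Fin 2)).symm
        (splitEquiv p.2.ne (Fin 2)).symm) (pauliString (splitEquiv p.2.ne _ ν).2))
        (splitEquiv p.2.ne _ ν).1 U := by
  set e := splitEquiv p.2.ne (Fin 2)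
  have hΓ : Γ = (Γ.submatrix e.symm e.symm).submatrix e e := by simp
  unfold gateCoeff
  rw [← trace_mul_kronecker, mul_assoc, mul_assoc, Matrix.trace_mul_comm, mul_assoc,
    pauliString_eq p.2.ne ν, gateMatrix_eq, Matrix.conjTranspose_submatrix,
    Matrix.conjTranspose_kronecker, Matrix.conjTranspose_one]
  conv_lhs => rw [hΓ]
  rw [Matrix.submatrix_mul_equiv, Matrix.submatrix_mul_equiv, Matrix.submatrix_mul_equiv,
    ← Matrix.mul_kronecker_mul, ← Matrix.mul_kronecker_mul, one_mul, mul_one]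
  have htr : ∀ X : Matrix ((Fin 2 × Fin 2) × Bits (Others p.1.1 p.1.2)) _ ℂ,
      (X.submatrix e e).trace = X.trace := fun X => e.sum_comp fun x => X x x
  rw [htr]

/-- The transition of a function of the weight when a random gate acts on the pair `p`. -/
def pairStep (w : ℕ → ℝ) (q : Fin 4 × Fin 4) (r : ℕ) : ℝ :=
  if q = 0 then w r else 2 / 5 * w (r + 1) + 3 / 5 * w (r + 2)

theorem sum_erase_pairWeight (w : ℕ → ℝ) (r : ℕ) :
    ∑ q ∈ Finset.univ.erase (0 : Fin 4 × Fin 4), w (pairWeight q + r) =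
      6 * w (r + 1) + 9 * w (r + 2) := by
  rw [Finset.sum_erase_eq_sub (Finset.mem_univ _), Fintype.sum_prod_type]
  simp [Fin.sum_univ_four, pairWeight]
  rw [add_comm 1 r, add_comm 2 r]
  ring

theorem sum_mul_integral_gateCoeff (model : GateModel) (w : ℕ → ℝ) (r : ℕ)
    (Z : Matrix (Fin 2 × Fin 2) (Fin 2 × Fin 2) ℂ) :
    ∑ q, w (pairWeight q + r) * ∫ U, gateCoeff Z q U ∂gateLaw model =
      ∑ q, pairStep w q r * gateCoeff Z q 1 := by
  rw [← Finset.add_sum_erase _ _ (Finset.mem_univ (0 : Fin 4 × Fin 4)),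
    ← Finset.add_sum_erase _ _ (Finset.mem_univ (0 : Fin 4 × Fin 4))]
  congr 1
  · simp [gateCoeff_zero, pairStep, pairWeight]
  · have h1 : ∀ q ∈ Finset.univ.erase (0 : Fin 4 × Fin 4),
        w (pairWeight q + r) * ∫ U, gateCoeff Z q U ∂gateLaw model =
        w (pairWeight q + r) * ((∑ q ∈ Finset.univ.erase 0, gateCoeff Z q 1) / 15) :=
      fun q hq => by rw [integral_gateCoeff model Z (Finset.ne_of_mem_erase hq)]
    have h2 : ∀ q ∈ Finset.univ.erase (0 : Fin 4 × Fin 4), pairStep w q r * gateCoeff Z q 1 =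
        (2 / 5 * w (r + 1) + 3 / 5 * w (r + 2)) * gateCoeff Z q 1 :=
      fun q hq => by rw [pairStep, if_neg (Finset.ne_of_mem_erase hq)]
    rw [Finset.sum_congr rfl h1, Finset.sum_congr rfl h2, ← Finset.sum_mul, ← Finset.mul_sum,
      sum_erase_pairWeight]
    ring

theorem gateMatrix_one (p : QubitPair n) : gateMatrix (p, (1 : TwoQubitGate)) = 1 := by
  rw [gateMatrix_eq]
  simp

theorem integral_pauliWeightSum_pair (model : GateModel) (w : ℕ → ℝ) (p : QubitPair n)
    (Γ : Matrix (Bits (Fin n)) (Bits (Fin n)) ℂ) :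
    ∫ U, pauliWeightSum w (gateMatrix (p, U) * Γ * (gateMatrix (p, U))ᴴ) ∂gateLaw model =
      ∑ ν : Fin n → Fin 4, pairStep w (ν p.1.1, ν p.1.2)
        (hammingNorm (splitEquiv p.2.ne _ ν).2) * ‖(Γ * pauliString ν).trace‖ ^ 2 := by
  set e := splitEquiv p.2.ne (Fin 4) with he
  set Z : (Others p.1.1 p.1.2 → Fin 4) → Matrix (Fin 2 × Fin 2) (Fin 2 × Fin 2) ℂ := fun τ =>
    contract (Γ.submatrix (splitEquiv p.2.ne (Fin 2)).symm
        (splitEquiv p.2.ne (Fin 2)).symm) (pauliString τ) with hZ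
  have h1 : ∀ U, pauliWeightSum w (gateMatrix (p, U) * Γ * (gateMatrix (p, U))ᴴ) =
      ∑ τ, ∑ q, w (pairWeight q + hammingNorm τ) * gateCoeff (Z τ) q U := by
    intro U
    unfold pauliWeightSum
    rw [Finset.sum_comm, ← Fintype.sum_prod_type (f := fun x : (Fin 4 × Fin 4) × _ =>
      w (pairWeight x.1 + hammingNorm x.2) * gateCoeff (Z x.2) x.1 U), ← e.sum_comp]
    refine Finset.sum_congr rfl fun ν _ => ?_
    rw [trace_conj_gateMatrix, hammingNorm_split p.2.ne]
  have h2 : ∑ ν : Fin n → Fin 4, pairStep w (ν p.1.1, ν p.1.2)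
        (hammingNorm (e ν).2) * ‖(Γ * pauliString ν).trace‖ ^ 2 =
      ∑ τ, ∑ q, pairStep w q (hammingNorm τ) * gateCoeff (Z τ) q 1 := by
    rw [Finset.sum_comm, ← Fintype.sum_prod_type (f := fun x : (Fin 4 × Fin 4) × _ =>
      pairStep w x.1 (hammingNorm x.2) * gateCoeff (Z x.2) x.1 1), ← e.sum_comp]
    refine Finset.sum_congr rfl fun ν _ => ?_
    rw [← trace_conj_gateMatrix, gateMatrix_one, one_mul, Matrix.conjTranspose_one, mul_one]
    rfl
  simp_rw [h1]
  rw [h2, integral_finsetSum _ fun τ _ => integrable_finsetSum _ fun q _ =>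
    (integrable_gateLaw model (continuous_gateCoeff _ q)).const_mul _]
  refine Finset.sum_congr rfl fun τ _ => ?_
  rw [integral_finsetSum _ fun q _ =>
    (integrable_gateLaw model (continuous_gateCoeff _ q)).const_mul _]
  simp_rw [integral_const_mul]
  exact sum_mul_integral_gateCoeff model w _ _

theorem sum_qubitPair {g : Fin n → Fin n → ℝ} (hg : ∀ i j, g i j = g j i) :
    2 * ∑ p : QubitPair n, g p.1.1 p.1.2 = (∑ i, ∑ j, g i j) - ∑ i, g i i := by
  have h1 : ∑ p : QubitPair n, g p.1.1 p.1.2 = ∑ i, ∑ j, if i < j then g i j else 0 := by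
    rw [← Fintype.sum_prod_type (f := fun x : Fin n × Fin n => if x.1 < x.2 then g x.1 x.2 else 0),
      ← Finset.sum_filter]
    exact (Finset.sum_subtype _ (fun x => by simp) fun x : Fin n × Fin n => g x.1 x.2).symm
  have h2 : ∑ i, ∑ j, (if i < j then g i j else 0) = ∑ i, ∑ j, if j < i then g i j else 0 := by
    rw [Finset.sum_comm]
    exact Finset.sum_congr rfl fun i _ => Finset.sum_congr rfl fun j _ => by rw [hg]
  have h3 : ∀ i, g i i = ∑ j, if i = j then g i j else 0 := fun i => by simp
  rw [two_mul]
  nth_rewrite 2 [h1]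
  rw [h1, h2, Finset.sum_congr rfl fun i _ => h3 i, ← h2]
  nth_rewrite 2 [h2]
  rw [← Finset.sum_add_distrib, ← Finset.sum_sub_distrib]
  refine Finset.sum_congr rfl fun i _ => ?_
  rw [← Finset.sum_add_distrib, ← Finset.sum_sub_distrib]
  refine Finset.sum_congr rfl fun j _ => ?_
  rcases lt_trichotomy i j with h | h | h
  · simp [h, h.not_gt, h.ne]
  · simp [h]
  · simp [h, h.not_gt, h.ne']

theorem card_qubitPair : 2 * (Fintype.card (QubitPair n) : ℝ) = n * (n - 1) := by
  have := sum_qubitPair (n := n) (g := fun _ _ => 1) fun _ _ => rfl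
  simp only [Finset.sum_const, nsmul_eq_mul, mul_one, Finset.card_univ, Fintype.card_fin] at this
  rw [this]; ring

/-- With the indicator `a i` of `ν i ≠ 0`, the step on a pair is a polynomial in `a i` and `a j`:
weight drops with probability `2/5` if both are `1` and rises with probability `3/5` if exactly one
is. Its sum over pairs thus depends on `ν` only through `∑ a i = x`. -/
theorem sum_pairStep (hn : 2 ≤ n) (w : ℕ → ℝ) (ν : Fin n → Fin 4) :
    ∑ p : QubitPair n, pairStep w (ν p.1.1, ν p.1.2) (hammingNorm (splitEquiv p.2.ne _ ν).2) =
      Fintype.card (QubitPair n) * weightStep n w (hammingNorm ν) := by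
  set x := hammingNorm ν with hx
  set a : Fin n → ℝ := fun i => if ν i = 0 then 0 else 1 with ha
  have hsum : ∑ i, a i = x := by
    rw [hx, hammingNorm_eq_sum]; push_cast; rfl
  have hsq : ∀ i, a i * a i = a i := fun i => by simp only [ha]; split_ifs <;> simp
  set g : Fin n → Fin n → ℝ := fun i j => w x + a i * a j * (2 / 5 * (w (x - 1) - w x)) +
    (a i * (1 - a j) + a j * (1 - a i)) * (3 / 5 * (w (x + 1) - w x)) with hg
  have h1 : ∀ p : QubitPair n, pairStep w (ν p.1.1, ν p.1.2)
      (hammingNorm (splitEquiv p.2.ne _ ν).2) = g p.1.1 p.1.2 := by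
    intro p
    have hs := hammingNorm_split p.2.ne ν
    rw [← hx] at hs
    set r := hammingNorm (splitEquiv p.2.ne _ ν).2
    change x = pairWeight (ν p.1.1, ν p.1.2) + r at hs
    simp only [hg, ha]
    unfold pairStep pairWeight at *
    by_cases h1 : ν p.1.1 = 0 <;> by_cases h2 : ν p.1.2 = 0 <;>
      simp only [h1, h2, if_true, if_false] at hs ⊢
    · rw [hs]; simp
    · rw [hs, if_neg (by simp [Prod.ext_iff, h2]), show 0 + 1 + r + 1 = r + 2 by omega,
        show 0 + 1 + r = r + 1 by omega]; ring
    · rw [hs, if_neg (by simp [Prod.ext_iff, h1]), show 1 + 0 + r + 1 = r + 2 by omega,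
        show 1 + 0 + r = r + 1 by omega]; ring
    · rw [hs, if_neg (by simp [Prod.ext_iff, h1]), show 1 + 1 + r - 1 = r + 1 by omega,
        show 1 + 1 + r = r + 2 by omega]; ring
  rw [Finset.sum_congr rfl fun p _ => h1 p]
  have h2 := sum_qubitPair (g := g) fun i j => by simp only [hg]; ring
  have h3 : ∑ i, ∑ j, g i j = n * n * w x + x * x * (2 / 5 * (w (x - 1) - w x)) +
      2 * (x * (n - x)) * (3 / 5 * (w (x + 1) - w x)) := by
    simp only [hg, Finset.sum_add_distrib, ← Finset.sum_mul, ← Finset.mul_sum,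
      Finset.sum_sub_distrib, hsum, Finset.sum_const, Finset.card_univ, Fintype.card_fin,
      nsmul_eq_mul, mul_one]
    ring
  have h4 : ∑ i, g i i = n * w x + x * (2 / 5 * (w (x - 1) - w x)) := by
    have : ∀ i, g i i = w x + a i * (2 / 5 * (w (x - 1) - w x)) := by
      intro i
      simp only [hg, mul_sub, hsq]; ring
    rw [Finset.sum_congr rfl fun i _ => this i]
    simp only [Finset.sum_add_distrib, ← Finset.sum_mul, hsum, Finset.sum_const, Finset.card_univ,
      Fintype.card_fin, nsmul_eq_mul]
  rw [h3, h4] at h2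
  have hD := (denom_pos hn).ne'
  have hc := card_qubitPair (n := n)
  have h5 : n * (n - 1) * weightStep n w x = n * (n - 1) * w x +
      6 / 5 * x * (n - x) * (w (x + 1) - w x) + 2 / 5 * x * (x - 1) * (w (x - 1) - w x) := by
    unfold weightStep upRate downRate
    rw [mul_add, mul_add, ← mul_assoc, ← mul_assoc _ (_ / _), mul_div_cancel₀ _ hD,
      mul_div_cancel₀ _ hD]
  have : 2 * (Fintype.card (QubitPair n) * weightStep n w x) =
      2 * ∑ p : QubitPair n, g p.1.1 p.1.2 := by
    rw [h2, ← mul_assoc, hc, h5]; ring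
  linarith

theorem sum_integral_pauliWeightSum (model : GateModel) (hn : 2 ≤ n) (w : ℕ → ℝ)
    (Γ : Matrix (Bits (Fin n)) (Bits (Fin n)) ℂ) :
    ∑ p : QubitPair n,
      ∫ U, pauliWeightSum w (gateMatrix (p, U) * Γ * (gateMatrix (p, U))ᴴ) ∂gateLaw model =
      Fintype.card (QubitPair n) * pauliWeightSum (weightStep n w) Γ := by
  simp_rw [integral_pauliWeightSum_pair]
  rw [Finset.sum_comm]
  simp_rw [← Finset.sum_mul, sum_pairStep hn]
  unfold pauliWeightSum
  rw [Finset.mul_sum]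
  exact Finset.sum_congr rfl fun ν _ => by ring

end RandomCircuit

namespace RandomCircuit

/-! ### The decoupling error in terms of Pauli components -/

-- Cauchy–Schwarz for the singular values, whose squares sum to the squared Hilbert–Schmidt norm.
open scoped ComplexOrder in
theorem traceNorm_sq_le {ι : Type*} [Fintype ι] [DecidableEq ι] (X : Matrix ι ι ℂ) :
    traceNorm X ^ 2 ≤ Fintype.card ι * ∑ x, ∑ y, ‖X x y‖ ^ 2 := by
  unfold traceNorm
  have hX := Matrix.isHermitian_conjTranspose_mul_self X
  have hnn : ∀ i, 0 ≤ hX.eigenvalues i :=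
    (Matrix.posSemidef_conjTranspose_mul_self X).eigenvalues_nonneg
  have htr : ∑ i, hX.eigenvalues i = ∑ x, ∑ y, ‖X x y‖ ^ 2 := by
    apply Complex.ofReal_injective
    rw [sum_norm_sq_eq_trace, hX.trace_eq_sum_eigenvalues, Complex.ofReal_sum]
    rfl
  have := sq_sum_le_card_mul_sum_sq (s := Finset.univ)
    (f := fun i => Real.sqrt (hX.eigenvalues i))
  simp only [Real.sq_sqrt (hnn _), htr, Finset.card_univ] at this
  exact this

theorem traceNorm_nonneg {ι : Type*} [Fintype ι] [DecidableEq ι] (X : Matrix ι ι ℂ) :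
    0 ≤ traceNorm X :=
  Finset.sum_nonneg fun _ _ => Real.sqrt_nonneg _

theorem trace_pauli {a : Fin 4} (ha : a ≠ 0) : (pauli a).trace = 0 := by
  fin_cases a
  · contradiction
  all_goals simp [pauli, Matrix.trace, Fin.sum_univ_two]

theorem trace_pauliString {ι : Type} [Fintype ι] [DecidableEq ι] (ν : ι → Fin 4) :
    (pauliString ν).trace = if ν = 0 then 2 ^ Fintype.card ι else 0 := by
  have h : (pauliString ν).trace = ∏ i, (pauli (ν i)).trace := by
    simp only [Matrix.trace, Matrix.diag, pauliString, Matrix.of_apply]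
    rw [Fintype.prod_sum fun i b => pauli (ν i) b b]
  rw [h]
  split_ifs with h0
  · subst h0
    simp [pauli_zero, Matrix.trace_one]
  · obtain ⟨i, hi⟩ := Function.ne_iff.1 h0
    exact Finset.prod_eq_zero (Finset.mem_univ i) (trace_pauli hi)

/-- The block `⟨μ| tr_A |φ⟩⟨φ| |μ'⟩` of the density operator of `φ`. -/
def block {M A : Type} [Fintype A] {n : ℕ} (φ : M × Bits (Fin n) × A → ℂ) (μ μ' : M) :
    Matrix (Bits (Fin n)) (Bits (Fin n)) ℂ :=
  Matrix.of fun b b' => ∑ a, φ (μ, b, a) * star (φ (μ', b', a))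

theorem block_applyB {M A : Type} [Fintype A] {n : ℕ} (U : Matrix (Bits (Fin n)) (Bits (Fin n)) ℂ)
    (φ : M × Bits (Fin n) × A → ℂ) (μ μ' : M) :
    block (applyB U φ) μ μ' = U * block φ μ μ' * Uᴴ := by
  ext b b'
  simp only [block, applyB, Matrix.of_apply, Matrix.mul_apply, Matrix.conjTranspose_apply,
    star_sum, star_mul', Finset.sum_mul, Finset.mul_sum]
  rw [Finset.sum_comm]
  refine Finset.sum_congr rfl fun c _ => ?_
  rw [Finset.sum_comm]
  refine Finset.sum_congr rfl fun c' _ => Finset.sum_congr rfl fun a _ => by ring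

variable {n : ℕ}

/-- The indicator function of the weights between `1` and `W`. -/
def lowWeight (W x : ℕ) : ℝ := if 1 ≤ x ∧ x ≤ W then 1 else 0

theorem lowWeight_nonneg (W x : ℕ) : 0 ≤ lowWeight W x := by
  unfold lowWeight; split_ifs <;> norm_num

/-- The extension of a Pauli string on `S` by identities. -/
def extendString (S : Finset (Fin n)) (ν : {i // i ∈ S} → Fin 4) (i : Fin n) : Fin 4 :=
  if h : i ∈ S then ν ⟨i, h⟩ else 0

theorem extendString_injective (S : Finset (Fin n)) : Function.Injective (extendString S) := by
  intro ν ν' h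
  funext i
  have := congrFun h i
  simpa [extendString] using this

theorem hammingNorm_extendString (S : Finset (Fin n)) (ν : {i // i ∈ S} → Fin 4) :
    hammingNorm (extendString S ν) = hammingNorm ν := by
  rw [hammingNorm_eq_sum, hammingNorm_eq_sum,
    ← Fintype.sum_subtype_add_sum_subtype (fun i => i ∈ S)]
  have h1 : ∀ i : {i // i ∈ S}, extendString S ν i = ν i := fun i => by simp [extendString]
  have h2 : ∀ i : {i // i ∉ S}, extendString S ν i = 0 := fun i => by simp [extendString, i.2]
  simp only [h1, h2, if_true, Finset.sum_const_zero, add_zero]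
  exact Finset.sum_congr (by ext; simp) fun _ _ => rfl

theorem pauliString_extendString_merge (S : Finset (Fin n)) (ν : {i // i ∈ S} → Fin 4)
    (s s' : Bits {i // i ∈ S}) (r r' : Bits {i // i ∉ S}) :
    pauliString (extendString S ν) (merge S s r) (merge S s' r') =
      if r = r' then pauliString ν s s' else 0 := by
  simp only [pauliString, Matrix.of_apply]
  rw [← Fintype.prod_subtype_mul_prod_subtype (fun i => i ∈ S)]
  have h1 : ∀ i : {i // i ∈ S}, pauli (extendString S ν i) (merge S s r i) (merge S s' r' i) =
      pauli (ν i) (s i) (s' i) := fun i => by simp [extendString, merge]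
  have h2 : ∀ i : {i // i ∉ S}, pauli (extendString S ν i) (merge S s r i) (merge S s' r' i) =
      if r i = r' i then 1 else 0 := fun i => by
    simp [extendString, merge, i.2, pauli_zero, Matrix.one_apply]
  simp_rw [h1, h2]
  rw [Finset.prod_ite_zero]
  simp only [Finset.mem_univ, forall_const, Finset.prod_const_one, funext_iff, mul_ite, mul_one,
    mul_zero]
  congr 1
  exact Finset.prod_congr (by ext; simp) fun _ _ => rfl

theorem trace_mul_pauliString_extendString (S : Finset (Fin n)) (ν : {i // i ∈ S} → Fin 4)
    (Γ : Matrix (Bits (Fin n)) (Bits (Fin n)) ℂ) :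
    (Γ * pauliString (extendString S ν)).trace =
      ((Matrix.of fun s s' => ∑ r, Γ (merge S s r) (merge S s' r)) * pauliString ν).trace := by
  have hsum : ∀ F : Bits (Fin n) → ℂ, ∑ b, F b =
      ∑ s : Bits {i // i ∈ S}, ∑ r : Bits {i // i ∉ S}, F (merge S s r) := by
    intro F
    rw [← (Equiv.piEquivPiSubtypeProd (fun i => i ∈ S) fun _ => Fin 2).symm.sum_comp,
      Fintype.sum_prod_type]
    rfl
  simp only [Matrix.trace, Matrix.diag, Matrix.mul_apply, Matrix.of_apply, hsum,
    pauliString_extendString_merge, mul_ite, mul_zero, Finset.sum_ite_eq', Finset.mem_univ,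
    if_true, Finset.sum_mul]
  refine Finset.sum_congr rfl fun s _ => ?_
  rw [Finset.sum_comm]

/-- If `M` is maximally mixed, then the distance of `ρ_{MS}` from the maximally mixed state is
controlled by the low-weight Pauli components, simultaneously for all small sets `S`. -/
theorem traceNorm_reducedMS_sq_le {A : Type} [Fintype A] {m : ℕ}
    (φ : Bits (Fin m) × Bits (Fin n) × A → ℂ)
    (hφ : ∀ μ μ', (block φ μ μ').trace = if μ = μ' then ((2 : ℂ) ^ m)⁻¹ else 0)
    {W : ℕ} (S : Finset (Fin n)) (hS : S.card ≤ W) :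
    traceNorm (reducedMS (pureDensity φ) S - maxMixed (Fin m) ⊗ₖ maxMixed {i // i ∈ S}) ^ 2 ≤
      2 ^ m * ∑ μ, ∑ μ', pauliWeightSum (lowWeight W) (block φ μ μ') := by
  set X := reducedMS (pureDensity φ) S - maxMixed (Fin m) ⊗ₖ maxMixed {i // i ∈ S} with hX
  set Y : Bits (Fin m) → Bits (Fin m) → Matrix (Bits {i // i ∈ S}) (Bits {i // i ∈ S}) ℂ :=
    fun μ μ' => Matrix.of fun s s' => X (μ, s) (μ', s') with hY
  have hcard : Fintype.card (Bits (Fin m) × Bits {i // i ∈ S}) = 2 ^ m * 2 ^ S.card := by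
    simp
  have hred : ∀ μ μ', Y μ μ' = (Matrix.of fun s s' => ∑ r, block φ μ μ' (merge S s r)
      (merge S s' r)) - ((if μ = μ' then ((2 : ℂ) ^ m)⁻¹ else 0) * ((2 : ℂ) ^ S.card)⁻¹) • 1 := by
    intro μ μ'
    ext s s'
    simp only [hY, hX, Matrix.of_apply, Matrix.sub_apply, reducedMS, pureDensity, block,
      Matrix.vecMulVec_apply, Pi.star_apply, Matrix.kroneckerMap_apply, maxMixed,
      Matrix.smul_apply, Matrix.one_apply, Fintype.card_fin, Fintype.card_coe, smul_eq_mul]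
    congr 1
    split_ifs <;> simp
  -- The identity component of the difference vanishes by `hφ`; every other string on `S` has weight
  -- between `1` and `W`.
  have hcoef : ∀ μ μ' (ν : {i // i ∈ S} → Fin 4), ‖(Y μ μ' * pauliString ν).trace‖ ^ 2 ≤
      lowWeight W (hammingNorm (extendString S ν)) *
        ‖(block φ μ μ' * pauliString (extendString S ν)).trace‖ ^ 2 := by
    intro μ μ' ν
    rw [hred, Matrix.sub_mul, Matrix.trace_sub, ← trace_mul_pauliString_extendString,
      Matrix.smul_mul, Matrix.trace_smul, one_mul, trace_pauliString, hammingNorm_extendString]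
    by_cases hν : ν = 0
    · subst hν
      have : extendString S 0 = 0 := by funext i; simp [extendString]
      rw [this, pauliString_zero, mul_one, hφ, if_pos rfl, Fintype.card_coe, smul_eq_mul, mul_assoc,
        inv_mul_cancel₀ (pow_ne_zero _ two_ne_zero), mul_one, sub_self, norm_zero,
        zero_pow two_ne_zero]
      have := lowWeight_nonneg W (hammingNorm (0 : {i // i ∈ S} → Fin 4))
      positivity
    · rw [if_neg hν, smul_zero, sub_zero]
      have h1 : 1 ≤ hammingNorm ν := Nat.one_le_iff_ne_zero.2 (hammingNorm_ne_zero_iff.2 hν)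
      have h2 : hammingNorm ν ≤ W := by
        refine hammingNorm_le_card_fintype.trans ?_
        simpa using hS
      rw [lowWeight, if_pos ⟨h1, h2⟩, one_mul]
  -- Parseval on `S` absorbs the dimension factor `2 ^ S.card` of the trace-norm bound. Adding the
  -- strings not supported in `S` removes the dependence on `S`.
  have hpars : ∀ μ μ', 2 ^ S.card * ∑ s, ∑ s', ‖X (μ, s) (μ', s')‖ ^ 2 ≤
      pauliWeightSum (lowWeight W) (block φ μ μ') := by
    intro μ μ'
    have := sum_norm_sq_of_complete (pauliString (ι := {i // i ∈ S})) _ sum_pauliString_mul_star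
      (Y μ μ')
    rw [Fintype.card_coe] at this
    have h0 : ∑ s, ∑ s', ‖X (μ, s) (μ', s')‖ ^ 2 = ∑ s, ∑ s', ‖Y μ μ' s s'‖ ^ 2 := rfl
    rw [h0, ← this]
    refine (Finset.sum_le_sum fun ν _ => hcoef μ μ' ν).trans ?_
    refine (Finset.sum_map Finset.univ ⟨extendString S, extendString_injective S⟩
      (fun ν => lowWeight W (hammingNorm ν) *
        ‖(block φ μ μ' * pauliString ν).trace‖ ^ 2)).symm.trans_le ?_
    refine Finset.sum_le_sum_of_subset_of_nonneg (Finset.subset_univ _) fun ν _ _ => ?_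
    have := lowWeight_nonneg W (hammingNorm ν)
    positivity
  refine (traceNorm_sq_le X).trans ?_
  rw [hcard]
  push_cast
  rw [mul_assoc]
  refine mul_le_mul_of_nonneg_left ?_ (by positivity)
  have hre : ∑ x : Bits (Fin m) × Bits {i // i ∈ S}, ∑ y : Bits (Fin m) × Bits {i // i ∈ S},
      ‖X x y‖ ^ 2 = ∑ μ, ∑ μ', ∑ s, ∑ s', ‖X (μ, s) (μ', s')‖ ^ 2 := by
    simp only [Fintype.sum_prod_type]
    exact Finset.sum_congr rfl fun μ _ => Finset.sum_comm
  rw [hre]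
  simp only [Finset.mul_sum] at hpars ⊢
  exact Finset.sum_le_sum fun μ _ => Finset.sum_le_sum fun μ' _ => hpars μ μ'

/-! ### Unitarity of circuits -/

theorem gateMatrix_conjTranspose_mul (g : QubitPair n × TwoQubitGate) :
    (gateMatrix g)ᴴ * gateMatrix g = 1 := by
  obtain ⟨p, U⟩ := g
  have hU : (U : Matrix (Fin 2 × Fin 2) (Fin 2 × Fin 2) ℂ)ᴴ * U = 1 := by
    have := Matrix.mem_unitaryGroup_iff'.1 U.2
    rwa [Matrix.star_eq_conjTranspose] at this
  rw [gateMatrix_eq, Matrix.conjTranspose_submatrix, Matrix.submatrix_mul_equiv,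
    Matrix.conjTranspose_kronecker, ← Matrix.mul_kronecker_mul, hU]
  simp

theorem circuitUnitary_succ {t : ℕ} (ω : Circuit n (t + 1)) :
    circuitUnitary ω = circuitUnitary (fun i => ω i.succ) * gateMatrix (ω 0) := by
  simp [circuitUnitary, List.ofFn_succ]

theorem circuitUnitary_conjTranspose_mul {t : ℕ} (ω : Circuit n t) :
    (circuitUnitary ω)ᴴ * circuitUnitary ω = 1 := by
  induction t with
  | zero => simp [circuitUnitary]
  | succ t ih =>
    rw [circuitUnitary_succ, Matrix.conjTranspose_mul, mul_assoc, ← mul_assoc _ _ (gateMatrix _),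
      ih, one_mul, gateMatrix_conjTranspose_mul]

theorem decouplingError_sq_le {A : Type} [Fintype A] {m a t : ℕ} (ψ : A × Bits (Fin a) → ℂ)
    (hψ : ∀ μ μ', (block (inputState m a ψ) μ μ').trace =
      if μ = μ' then ((2 : ℂ) ^ m)⁻¹ else 0)
    (ω : Circuit (m + a) t) {W : ℕ} (S : Finset (Fin (m + a))) (hS : S.card ≤ W) :
    decouplingError ψ ω S ^ 2 ≤ 2 ^ m * ∑ μ, ∑ μ', pauliWeightSum (lowWeight W)
      (circuitUnitary ω * block (inputState m a ψ) μ μ' * (circuitUnitary ω)ᴴ) := by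
  have := traceNorm_reducedMS_sq_le
    (applyB (circuitUnitary ω) (inputState m a ψ)) (fun μ μ' => by
      rw [block_applyB, mul_assoc, Matrix.trace_mul_comm, mul_assoc,
        circuitUnitary_conjTranspose_mul, mul_one, hψ]) S hS
  simp only [block_applyB] at this
  exact this

end RandomCircuit

namespace RandomCircuit

/-! ### Pauli components of the input states -/

/-- The reduced state of `ψ` on the ancillas. -/
def ancillaState {A : Type} [Fintype A] {a : ℕ} (ψ : A × Bits (Fin a) → ℂ) :
    Matrix (Bits (Fin a)) (Bits (Fin a)) ℂ :=
  Matrix.of fun y y' => ∑ α, ψ (α, y) * star (ψ (α, y'))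

theorem pauliString_append {m a : ℕ} (ν : Fin m → Fin 4) (τ : Fin a → Fin 4)
    (x x' : Bits (Fin m)) (y y' : Bits (Fin a)) :
    pauliString (Fin.append ν τ) (Fin.append x y) (Fin.append x' y') =
      pauliString ν x x' * pauliString τ y y' := by
  simp [pauliString, Fin.prod_univ_add]

theorem hammingNorm_append {m a : ℕ} (ν : Fin m → Fin 4) (τ : Fin a → Fin 4) :
    hammingNorm (Fin.append ν τ) = hammingNorm ν + hammingNorm τ := by
  simp [hammingNorm_eq_sum, Fin.sum_univ_add]

theorem sum_append {m a : ℕ} {α R : Type*} [Fintype α] [AddCommMonoid R]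
    (F : (Fin (m + a) → α) → R) : ∑ b, F b = ∑ x, ∑ y, F (Fin.append x y) := by
  rw [← (Fin.appendEquiv m a).sum_comp, Fintype.sum_prod_type]
  rfl

variable {A : Type} [Fintype A] {m a : ℕ}

/-- The block is `2 ^ (-m) |μ⟩⟨μ'|` tensored with the ancilla state, so its Pauli components
factorize. -/
theorem trace_block_inputState_mul (ψ : A × Bits (Fin a) → ℂ) (μ μ' : Bits (Fin m))
    (ν : Fin m → Fin 4) (τ : Fin a → Fin 4) :
    (block (inputState m a ψ) μ μ' * pauliString (Fin.append ν τ)).trace =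
      ((2 : ℂ) ^ m)⁻¹ * pauliString ν μ' μ * (ancillaState ψ * pauliString τ).trace := by
  have hc : (((Real.sqrt (2 ^ m))⁻¹ : ℝ) : ℂ) * (((Real.sqrt (2 ^ m))⁻¹ : ℝ) : ℂ) =
      ((2 : ℂ) ^ m)⁻¹ := by
    rw [← Complex.ofReal_mul, ← mul_inv, Real.mul_self_sqrt (by positivity)]
    push_cast; rfl
  have hb : ∀ x x' y y', block (inputState m a ψ) μ μ' (Fin.append x y) (Fin.append x' y') =
      if μ = x then (if μ' = x' then ((2 : ℂ) ^ m)⁻¹ * ancillaState ψ y y' else 0) else 0 := by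
    intro x x' y y'
    simp only [block, inputState, Matrix.of_apply, Fin.append_left, Fin.append_right, maxEntangled,
      ancillaState]
    by_cases h1 : μ = x <;> by_cases h2 : μ' = x' <;> simp only [h1, h2, if_true, if_false,
      zero_mul, mul_zero, star_zero, Finset.sum_const_zero]
    rw [Finset.mul_sum, ← hc]
    refine Finset.sum_congr rfl fun α _ => ?_
    rw [star_mul', Complex.star_def, Complex.conj_ofReal]
    ring
  simp only [Matrix.trace, Matrix.diag, Matrix.mul_apply, sum_append, hb, pauliString_append]
  rw [Finset.sum_eq_single μ (fun x _ hx => by simp [hx.symm]) (by simp)]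
  simp only [if_true, Finset.mul_sum]
  refine Finset.sum_congr rfl fun y _ => ?_
  rw [Finset.sum_eq_single μ' (fun x _ hx => by simp [hx.symm]) (by simp)]
  refine Finset.sum_congr rfl fun y' _ => ?_
  rw [if_pos rfl]
  ring

theorem trace_block_inputState (ψ : A × Bits (Fin a) → ℂ) (hψ : (ancillaState ψ).trace = 1)
    (μ μ' : Bits (Fin m)) : (block (inputState m a ψ) μ μ').trace =
      if μ = μ' then ((2 : ℂ) ^ m)⁻¹ else 0 := by
  have h0 : Fin.append (0 : Fin m → Fin 4) (0 : Fin a → Fin 4) = 0 := by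
    funext i; refine Fin.addCases (fun i => ?_) (fun i => ?_) i <;> simp
  have := trace_block_inputState_mul (m := m) ψ μ μ' 0 0
  rw [h0, pauliString_zero, pauliString_zero, pauliString_zero, mul_one, mul_one, hψ, mul_one,
    Matrix.one_apply] at this
  rw [this]
  simp [eq_comm]

theorem pauliString_mul_self {ι : Type} [Fintype ι] [DecidableEq ι] (ν : ι → Fin 4) :
    pauliString ν * pauliString ν = 1 := by
  rw [← pauliString_zero]
  ext b c
  simp only [Matrix.mul_apply, pauliString, Matrix.of_apply, ← Finset.prod_mul_distrib]
  rw [← Fintype.prod_sum fun i x => pauli (ν i) (b i) x * pauli (ν i) x (c i)]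
  refine Finset.prod_congr rfl fun i _ => ?_
  rw [← Matrix.mul_apply, pauli_mul_self, Pi.zero_apply, pauli_zero]

theorem sum_norm_sq_pauliString {ι : Type} [Fintype ι] [DecidableEq ι] (ν : ι → Fin 4) :
    ∑ x, ∑ y, ‖pauliString ν x y‖ ^ 2 = 2 ^ Fintype.card ι := by
  apply Complex.ofReal_injective
  rw [sum_norm_sq_eq_trace, pauliString_conjTranspose, pauliString_mul_self, Matrix.trace_one]
  simp

/-- Summing over the blocks gives `∑ ‖pauliString ν μ' μ‖² = 2 ^ m`, which with the prefactor `2 ^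
m` cancels `2 ^ (-2 m)`: each string on the input qubits counts exactly once. -/
theorem sum_pauliWeightSum_inputState (ψ : A × Bits (Fin a) → ℂ) (w : ℕ → ℝ) :
    2 ^ m * ∑ μ, ∑ μ', pauliWeightSum w (block (inputState m a ψ) μ μ') =
      ∑ ν : Fin m → Fin 4, ∑ τ : Fin a → Fin 4, w (hammingNorm ν + hammingNorm τ) *
        ‖(ancillaState ψ * pauliString τ).trace‖ ^ 2 := by
  have h : ∀ μ μ', pauliWeightSum w (block (inputState m a ψ) μ μ') =
      ∑ ν : Fin m → Fin 4, ∑ τ : Fin a → Fin 4, w (hammingNorm ν + hammingNorm τ) *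
        ‖(ancillaState ψ * pauliString τ).trace‖ ^ 2 * (((2 : ℝ) ^ m)⁻¹ ^ 2 *
          ‖pauliString ν μ' μ‖ ^ 2) := by
    intro μ μ'
    unfold pauliWeightSum
    rw [sum_append]
    refine Finset.sum_congr rfl fun ν _ => Finset.sum_congr rfl fun τ _ => ?_
    rw [trace_block_inputState_mul, hammingNorm_append, norm_mul, norm_mul, norm_inv, norm_pow,
      Complex.norm_ofNat]
    ring
  simp_rw [h]
  have hs : ∀ F : Bits (Fin m) → Bits (Fin m) → (Fin m → Fin 4) → (Fin a → Fin 4) → ℝ,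
      ∑ μ, ∑ μ', ∑ ν, ∑ τ, F μ μ' ν τ = ∑ ν, ∑ τ, ∑ μ', ∑ μ, F μ μ' ν τ := by
    intro F
    rw [Finset.sum_comm]
    simp_rw [Finset.sum_comm (γ := Fin m → Fin 4), Finset.sum_comm (γ := Fin a → Fin 4)]
  rw [hs]
  simp_rw [← Finset.mul_sum, sum_norm_sq_pauliString, Fintype.card_fin]
  rw [Finset.mul_sum]
  refine Finset.sum_congr rfl fun ν _ => ?_
  rw [Finset.mul_sum]
  refine Finset.sum_congr rfl fun τ _ => ?_
  field_simp

/-- Factor by factor: `3 m ≤ 2 n` implies `3 (m - x) ≤ 2 (n - x)`, also with truncated subtraction.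
-/
theorem three_pow_mul_choose_le {m n : ℕ} (h : 3 * m ≤ 2 * n) (x : ℕ) :
    3 ^ x * m.choose x ≤ 2 ^ x * n.choose x := by
  have key : 3 ^ x * m.descFactorial x ≤ 2 ^ x * n.descFactorial x := by
    induction x with
    | zero => simp
    | succ x ih =>
      rw [Nat.descFactorial_succ, Nat.descFactorial_succ, pow_succ, pow_succ]
      calc 3 ^ x * 3 * ((m - x) * m.descFactorial x)
          = (3 * (m - x)) * (3 ^ x * m.descFactorial x) := by ring
        _ ≤ (2 * (n - x)) * (2 ^ x * n.descFactorial x) := Nat.mul_le_mul (by omega) ih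
        _ = _ := by ring
  rw [Nat.descFactorial_eq_factorial_mul_choose, Nat.descFactorial_eq_factorial_mul_choose,
    mul_left_comm, mul_left_comm (2 ^ x)] at key
  exact Nat.le_of_mul_le_mul_left key (Nat.factorial_pos x)

/-! ### Weight enumerators of the input strings -/

section Enumerator

open Polynomial

/-- The weight enumerator of a set of one-qubit Pauli operators with multiplicities. -/
def weightPoly (χ : Fin 4 → ℕ) : ℕ[X] := ∑ q, C (χ q) * X ^ (if q = 0 then 0 else 1)

theorem weightPoly_pow (χ : Fin 4 → ℕ) (n : ℕ) :
    weightPoly χ ^ n = ∑ ν : Fin n → Fin 4, C (∏ i, χ (ν i)) * X ^ hammingNorm ν := by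
  have : ∀ ν : Fin n → Fin 4, (C (∏ i, χ (ν i)) * X ^ hammingNorm ν : ℕ[X]) =
      ∏ i, C (χ (ν i)) * X ^ (if ν i = 0 then 0 else 1) := by
    intro ν
    rw [Finset.prod_mul_distrib, map_prod, Finset.prod_pow_eq_pow_sum, hammingNorm_eq_sum]
  simp_rw [this]
  rw [← Fintype.prod_sum fun (_ : Fin n) q => (C (χ q) * X ^ (if q = 0 then 0 else 1) : ℕ[X])]
  simp [weightPoly]

/-- The weight enumerator of the Pauli strings that occur in the input state. -/
def inputPoly (χ : Fin 4 → ℕ) (m a : ℕ) : ℕ[X] := weightPoly (fun _ => 1) ^ m * weightPoly χ ^ a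

theorem inputPoly_eq (χ : Fin 4 → ℕ) (m a : ℕ) :
    inputPoly χ m a = ∑ ν : Fin m → Fin 4, ∑ τ : Fin a → Fin 4,
      C (∏ i, χ (τ i)) * X ^ (hammingNorm ν + hammingNorm τ) := by
  rw [inputPoly, weightPoly_pow, weightPoly_pow, Finset.sum_mul_sum]
  refine Finset.sum_congr rfl fun ν _ => Finset.sum_congr rfl fun τ _ => ?_
  rw [Finset.prod_const_one, C_1, one_mul, pow_add]
  ring

theorem sum_coeff_inputPoly (χ : Fin 4 → ℕ) (m a : ℕ) (w : ℕ → ℝ) :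
    ∑ x ∈ Finset.range (m + a + 1), ((inputPoly χ m a).coeff x : ℝ) * w x =
      ∑ ν : Fin m → Fin 4, ∑ τ : Fin a → Fin 4, w (hammingNorm ν + hammingNorm τ) *
        ((∏ i, χ (τ i) : ℕ) : ℝ) := by
  simp only [inputPoly_eq, finsetSum_coeff, coeff_C_mul_X_pow, Nat.cast_sum, Finset.sum_mul]
  rw [Finset.sum_comm]
  refine Finset.sum_congr rfl fun ν _ => ?_
  rw [Finset.sum_comm]
  refine Finset.sum_congr rfl fun τ _ => ?_
  have h1 : hammingNorm ν ≤ m := by simpa using hammingNorm_le_card_fintype (x := ν)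
  have h2 : hammingNorm τ ≤ a := by simpa using hammingNorm_le_card_fintype (x := τ)
  rw [Finset.sum_eq_single (hammingNorm ν + hammingNorm τ)]
  · rw [if_pos rfl, mul_comm]
  · intro x _ hx; simp [hx]
  · intro h; exact absurd (Finset.mem_range.2 (by omega)) h

theorem weightPoly_one : weightPoly (fun _ => 1) = 1 + 3 * X := by
  simp [weightPoly, Fin.sum_univ_four]
  ring

theorem eval_weightPoly (χ : Fin 4 → ℕ) : (weightPoly χ).eval 1 = ∑ q, χ q := by
  simp only [weightPoly, eval_finsetSum, eval_mul, eval_C, eval_pow, eval_X, one_pow, mul_one]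

theorem sum_coeff_inputPoly_one (χ : Fin 4 → ℕ) (m a : ℕ) :
    ∑ x ∈ Finset.range (m + a + 1), ((inputPoly χ m a).coeff x : ℝ) =
      4 ^ m * (∑ q, χ q : ℕ) ^ a := by
  have h := sum_coeff_inputPoly χ m a fun _ => 1
  simp only [mul_one, one_mul] at h
  rw [h]
  have h2 : (inputPoly χ m a).eval 1 = ∑ ν : Fin m → Fin 4, ∑ τ : Fin a → Fin 4,
      ∏ i, χ (τ i) := by
    rw [inputPoly_eq]
    simp only [eval_finsetSum, eval_mul, eval_C, eval_pow, eval_X, one_pow, mul_one]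
  have h3 : (inputPoly χ m a).eval 1 = 4 ^ m * (∑ q, χ q) ^ a := by
    rw [inputPoly, eval_mul, eval_pow, eval_pow, eval_weightPoly, eval_weightPoly]; simp
  rw [h3] at h2
  exact_mod_cast h2.symm

/-- Coefficientwise comparison of polynomials with natural coefficients. -/
def CoeffLE (p q : ℕ[X]) : Prop := ∀ k, p.coeff k ≤ q.coeff k

theorem CoeffLE.mul {p q p' q' : ℕ[X]} (h : CoeffLE p q) (h' : CoeffLE p' q') :
    CoeffLE (p * p') (q * q') := by
  intro k
  rw [coeff_mul, coeff_mul]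
  exact Finset.sum_le_sum fun x _ => Nat.mul_le_mul (h _) (h' _)

theorem CoeffLE.pow {p q : ℕ[X]} (h : CoeffLE p q) (m : ℕ) : CoeffLE (p ^ m) (q ^ m) := by
  induction m with
  | zero => intro k; simp
  | succ m ih => rw [pow_succ, pow_succ]; exact ih.mul h

theorem coeff_one_add_mul_X_pow (c n x : ℕ) :
    ((1 + C c * X : ℕ[X]) ^ n).coeff x = c ^ x * n.choose x := by
  have : (1 + C c * X : ℕ[X]) = (1 + X).comp (C c * X) := by simp
  rw [this, ← pow_comp, comp_C_mul_X_coeff, coeff_one_add_X_pow, mul_comm]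
  simp

/-- Ancillas in the state `|0⟩`: only `𝟙` and `σ₃` occur. -/
theorem coeff_inputPoly_diagonal_le {m a : ℕ} (hm : m ≤ a) (x : ℕ) :
    (inputPoly (fun q => if q = 0 ∨ q = 3 then 1 else 0) m a).coeff x ≤
      2 ^ x * (m + a).choose x := by
  obtain ⟨d, rfl⟩ := Nat.exists_eq_add_of_le hm
  -- Each input qubit is paired with an ancilla: `1 + 4 X + 3 X²` is dominated by `(1 + 2 X)² = 1 +
  -- 4 X + 4 X²`. The `d` ancillas left over contribute `1 + X ≤ 1 + 2 X`.
  have h1 : CoeffLE ((1 + 3 * X) * (1 + X)) ((1 + C 2 * X) * (1 + C 2 * X)) := by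
    intro k
    have e1 : ((1 + 3 * X) * (1 + X) : ℕ[X]) = C 3 * X ^ 2 + C 4 * X + C 1 := by
      simp only [map_ofNat, map_one]; ring
    have e2 : ((1 + C 2 * X) * (1 + C 2 * X) : ℕ[X]) = C 4 * X ^ 2 + C 4 * X + C 1 := by
      simp only [map_ofNat, map_one]; ring
    rw [e1, e2]
    simp only [coeff_add, coeff_C_mul_X_pow]
    gcongr
    split_ifs <;> omega
  have h2 : CoeffLE (1 + X) (1 + C 2 * X) := by
    intro k
    simp only [coeff_add, coeff_C_mul]
    omega
  have h3 := (h1.pow m).mul (h2.pow d) x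
  have e : weightPoly (fun q => if q = 0 ∨ q = 3 then 1 else 0) = 1 + X := by
    simp [weightPoly, Fin.sum_univ_four]
  rw [inputPoly, weightPoly_one, e]
  have e2 : ((1 + C 2 * X) * (1 + C 2 * X)) ^ m * (1 + C 2 * X) ^ d =
      (1 + C 2 * X : ℕ[X]) ^ (m + (m + d)) := by
    rw [← pow_two, ← pow_mul, ← pow_add]; congr 1; ring
  rwa [e2, coeff_one_add_mul_X_pow, mul_pow, mul_assoc, ← pow_add] at h3

/-- Ancillas that are maximally entangled with `A`: only `𝟙` occurs. -/
theorem coeff_inputPoly_identity_le {m a : ℕ} (hm : 3 * m ≤ 2 * (m + a)) (x : ℕ) :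
    (inputPoly (fun q => if q = 0 then 1 else 0) m a).coeff x ≤ 2 ^ x * (m + a).choose x := by
  have e : weightPoly (fun q => if q = 0 then 1 else 0) = 1 := by
    simp [weightPoly, Fin.sum_univ_four]
  have e3 : (1 + 3 * X : ℕ[X]) = 1 + C 3 * X := by simp
  rw [inputPoly, weightPoly_one, e, one_pow, mul_one, e3, coeff_one_add_mul_X_pow]
  exact three_pow_mul_choose_le hm x

end Enumerator

theorem norm_trace_zeroAncilla (τ : Fin a → Fin 4) :
    ‖(ancillaState (zeroAncilla a) * pauliString τ).trace‖ ^ 2 =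
      ((∏ i, (if τ i = 0 ∨ τ i = 3 then 1 else 0) : ℕ) : ℝ) := by
  have h : (ancillaState (zeroAncilla a) * pauliString τ).trace = pauliString τ 0 0 := by
    have hd : ∀ y y', ancillaState (zeroAncilla a) y y' =
        if y = 0 then (if y' = 0 then 1 else 0) else 0 := by
      intro y y'
      by_cases h1 : y = 0 <;> by_cases h2 : y' = 0 <;> simp [ancillaState, zeroAncilla, h1, h2]
    simp [Matrix.trace, Matrix.mul_apply, hd]
  rw [h, pauliString, Matrix.of_apply, norm_prod, ← Finset.prod_pow]
  push_cast
  refine Finset.prod_congr rfl fun i _ => ?_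
  generalize τ i = q
  fin_cases q <;> simp [pauli]

theorem trace_zeroAncilla : (ancillaState (zeroAncilla a)).trace = 1 := by
  simp [Matrix.trace, ancillaState, zeroAncilla]

theorem ancillaState_maxEntangled :
    ancillaState (maxEntangled a) = ((2 : ℂ) ^ a)⁻¹ • (1 : Matrix (Bits (Fin a)) (Bits (Fin a)) ℂ)
    := by
  have hc : (((Real.sqrt (2 ^ a))⁻¹ : ℝ) : ℂ) * (((Real.sqrt (2 ^ a))⁻¹ : ℝ) : ℂ) =
      ((2 : ℂ) ^ a)⁻¹ := by
    rw [← Complex.ofReal_mul, ← mul_inv, Real.mul_self_sqrt (by positivity)]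
    push_cast; rfl
  ext y y'
  simp only [ancillaState, maxEntangled, Matrix.of_apply, Matrix.smul_apply, smul_eq_mul,
    Matrix.one_apply, ite_mul, zero_mul]
  rw [Finset.sum_ite_eq' Finset.univ y, if_pos (Finset.mem_univ _), ← hc]
  split_ifs with h <;> simp

theorem trace_maxEntangled : (ancillaState (maxEntangled a)).trace = 1 := by
  rw [ancillaState_maxEntangled, Matrix.trace_smul, Matrix.trace_one]
  simp

theorem norm_trace_maxEntangled (τ : Fin a → Fin 4) :
    ‖(ancillaState (maxEntangled a) * pauliString τ).trace‖ ^ 2 =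
      ((∏ i, (if τ i = 0 then 1 else 0) : ℕ) : ℝ) := by
  rw [ancillaState_maxEntangled, Matrix.smul_mul, one_mul, Matrix.trace_smul, trace_pauliString,
    Finset.prod_ite_zero]
  by_cases h : τ = 0
  · simp [h]
  · rw [if_neg h, if_neg (fun h' => h (funext fun i => h' i (Finset.mem_univ i)))]
    simp

end RandomCircuit

namespace RandomCircuit

/-! ### Expectations over random circuits -/

/-- The state reached from `x` under the steps `ω 0, ω 1, …`. -/
def runSteps {α S : Type*} (step : α → S → S) : {t : ℕ} → (Fin t → α) → S → S
  | 0, _, x => x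
  | _ + 1, ω, x => runSteps step (fun i => ω i.succ) (step (ω 0) x)

/-- Supermartingale argument in the number of remaining steps, splitting off the first one. Only the
inequality half of Tonelli's theorem is used, which holds without measurability of `step` or `V`. -/
theorem lintegral_runSteps_le {α S : Type*} [MeasurableSpace α] (μ : Measure α)
    [IsProbabilityMeasure μ] (step : α → S → S) (V : ℕ → S → ENNReal)
    (hV : ∀ s x, ∫⁻ g, V s (step g x) ∂μ ≤ V (s + 1) x) (t : ℕ) (x : S) :
    ∫⁻ ω : Fin t → α, V 0 (runSteps step ω x) ∂Measure.pi (fun _ => μ) ≤ V t x := by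
  induction t generalizing x with
  | zero => simp [runSteps]
  | succ t ih =>
    have hmp := (measurePreserving_piFinSuccAbove (fun _ : Fin (t + 1) => μ) 0).symm
    rw [← hmp.lintegral_comp_emb (MeasurableEquiv.measurableEmbedding _)]
    refine (lintegral_prod_le _).trans (le_trans (lintegral_mono fun g => ?_)
      (hV t x))
    refine le_trans (le_of_eq ?_) (ih (step g x))
    refine lintegral_congr fun ω => ?_
    simp [runSteps, MeasurableEquiv.piFinSuccAbove]

theorem lintegral_uniformOn_univ {α : Type*} [Fintype α] [MeasurableSpace α]
    [MeasurableSingletonClass α] (f : α → ENNReal) :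
    ∫⁻ x, f x ∂ProbabilityTheory.uniformOn Set.univ = (Fintype.card α : ENNReal)⁻¹ * ∑ x, f x := by
  rw [ProbabilityTheory.uniformOn, ProbabilityTheory.cond, Measure.restrict_univ,
    lintegral_smul_measure, lintegral_count, tsum_fintype, Measure.count_univ, smul_eq_mul]
  simp

variable {n : ℕ}

theorem card_qubitPair_pos (hn : 2 ≤ n) : (0 : ℝ) < Fintype.card (QubitPair n) := by
  have := card_qubitPair (n := n)
  have := denom_pos hn
  linarith

theorem isProbabilityMeasure_uniformOn_qubitPair (hn : 2 ≤ n) :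
    IsProbabilityMeasure (ProbabilityTheory.uniformOn (Set.univ : Set (QubitPair n))) := by
  have : Nonempty (QubitPair n) := Fintype.card_pos_iff.1 (by exact_mod_cast card_qubitPair_pos hn)
  exact ProbabilityTheory.isProbabilityMeasure_uniformOn Set.finite_univ Set.univ_nonempty

/-- The average of a nonnegative function over a random gate. -/
theorem lintegral_gate_le (model : GateModel) (hn : 2 ≤ n)
    (F : QubitPair n × TwoQubitGate → ℝ) (hF0 : ∀ g, 0 ≤ F g)
    (hF : ∀ p, Continuous fun U => F (p, U)) :
    ∫⁻ g, ENNReal.ofReal (F g) ∂(ProbabilityTheory.uniformOn Set.univ).prod (gateLaw model) ≤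
      ENNReal.ofReal ((∑ p, ∫ U, F (p, U) ∂gateLaw model) / Fintype.card (QubitPair n)) := by
  refine (lintegral_prod_le _).trans ?_
  have h : ∀ p, ∫⁻ U, ENNReal.ofReal (F (p, U)) ∂gateLaw model =
      ENNReal.ofReal (∫ U, F (p, U) ∂gateLaw model) := fun p =>
    (ofReal_integral_eq_lintegral_ofReal (integrable_gateLaw model (hF p))
      (Filter.Eventually.of_forall fun U => hF0 _)).symm
  rw [lintegral_uniformOn_univ, Finset.sum_congr rfl fun p _ => h p,
    ← ENNReal.ofReal_sum_of_nonneg fun p _ => integral_nonneg fun U => hF0 _, div_eq_inv_mul,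
    ENNReal.ofReal_mul (by positivity), ENNReal.ofReal_inv_of_pos (card_qubitPair_pos hn),
    ENNReal.ofReal_natCast]

theorem continuous_gateMatrix (p : QubitPair n) :
    Continuous fun U : TwoQubitGate => gateMatrix (p, U) := by
  refine continuous_matrix fun b b' => ?_
  simp only [gateMatrix, Matrix.of_apply]
  have : Continuous fun U : TwoQubitGate => (U : Matrix (Fin 2 × Fin 2) (Fin 2 × Fin 2) ℂ) :=
    continuous_subtype_val
  split_ifs
  · exact this.matrix_elem _ _
  · fun_prop

theorem continuous_pauliWeightSum (w : ℕ → ℝ) :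
    Continuous (pauliWeightSum w : Matrix (Bits (Fin n)) (Bits (Fin n)) ℂ → ℝ) := by
  unfold pauliWeightSum
  fun_prop

theorem pauliWeightSum_nonneg {w : ℕ → ℝ} (hw : ∀ x ≤ n, 0 ≤ w x)
    (Γ : Matrix (Bits (Fin n)) (Bits (Fin n)) ℂ) : 0 ≤ pauliWeightSum w Γ :=
  Finset.sum_nonneg fun ν _ => mul_nonneg
    (hw _ (by simpa using hammingNorm_le_card_fintype (x := ν))) (by positivity)

/-- The evolution of an operator under a gate. -/
def conjGate (g : QubitPair n × TwoQubitGate) (Γ : Matrix (Bits (Fin n)) (Bits (Fin n)) ℂ) :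
    Matrix (Bits (Fin n)) (Bits (Fin n)) ℂ :=
  gateMatrix g * Γ * (gateMatrix g)ᴴ

theorem runSteps_conjGate {t : ℕ} (ω : Circuit n t)
    (Γ : Matrix (Bits (Fin n)) (Bits (Fin n)) ℂ) :
    runSteps conjGate ω Γ = circuitUnitary ω * Γ * (circuitUnitary ω)ᴴ := by
  induction t generalizing Γ with
  | zero => simp [runSteps, circuitUnitary]
  | succ t ih =>
    rw [runSteps, ih, circuitUnitary_succ, conjGate, Matrix.conjTranspose_mul]
    simp only [mul_assoc]

/-- The potential with `s` gates remaining is the weight sum for the `s`-fold iterate of the chain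
applied to `w`; averaging over the next gate adds one iterate. -/
theorem lintegral_pauliWeightSum_le (model : GateModel) (hn : 2 ≤ n) {w : ℕ → ℝ}
    (hw : ∀ x, 0 ≤ w x) (t : ℕ) (Γ : Matrix (Bits (Fin n)) (Bits (Fin n)) ℂ) :
    ∫⁻ ω, ENNReal.ofReal (pauliWeightSum w (circuitUnitary ω * Γ * (circuitUnitary ω)ᴴ))
      ∂circuitLaw model n t ≤ ENNReal.ofReal (pauliWeightSum ((weightStep n)^[t] w) Γ) := by
  have := isProbabilityMeasure_uniformOn_qubitPair hn
  have h := lintegral_runSteps_le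
    ((ProbabilityTheory.uniformOn (Set.univ : Set (QubitPair n))).prod (gateLaw model)) conjGate
    (fun s Γ => ENNReal.ofReal (pauliWeightSum ((weightStep n)^[s] w) Γ)) (fun s Γ => by
      refine (lintegral_gate_le model hn (fun g => pauliWeightSum _ (conjGate g Γ))
        (fun g => pauliWeightSum_nonneg (iterate_nonneg hn hw s) _) (fun p => ?_)).trans ?_
      · have := continuous_gateMatrix p
        exact (continuous_pauliWeightSum _).comp (by unfold conjGate; fun_prop)
      · simp only [conjGate]
        rw [sum_integral_pauliWeightSum model hn, mul_div_cancel_left₀ _ (card_qubitPair_pos hn).ne',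
          Function.iterate_succ_apply']) t Γ
  simp only [runSteps_conjGate] at h
  exact h

theorem measurable_gateMatrix_apply (b b' : Bits (Fin n)) :
    Measurable fun g : QubitPair n × TwoQubitGate => gateMatrix g b b' :=
  measurable_from_prod_countable_right fun p =>
    ((continuous_gateMatrix p).matrix_elem b b').measurable

theorem measurable_circuitUnitary_apply {t : ℕ} (b b' : Bits (Fin n)) :
    Measurable fun ω : Circuit n t => circuitUnitary ω b b' := by
  induction t generalizing b b' with
  | zero => simp [circuitUnitary]
  | succ t ih =>
    simp_rw [circuitUnitary_succ, Matrix.mul_apply]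
    refine Finset.measurable_sum _ fun c _ => ?_
    refine ((ih b c).comp ?_).mul ((measurable_gateMatrix_apply c b').comp (measurable_pi_apply 0))
    exact measurable_pi_lambda _ fun i => measurable_pi_apply i.succ

theorem measurable_pauliWeightSum {t : ℕ} (w : ℕ → ℝ)
    (Γ : Matrix (Bits (Fin n)) (Bits (Fin n)) ℂ) : Measurable fun ω : Circuit n t =>
      pauliWeightSum w (circuitUnitary ω * Γ * (circuitUnitary ω)ᴴ) := by
  unfold pauliWeightSum
  simp only [Matrix.trace, Matrix.diag, Matrix.mul_apply, Matrix.conjTranspose_apply]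
  have h := fun b b' => measurable_circuitUnitary_apply (n := n) (t := t) b b'
  have h' : ∀ b b', Measurable fun ω : Circuit n t => star (circuitUnitary ω b b') :=
    fun b b' => continuous_star.measurable.comp (h b b')
  fun_prop

/-! ### Depth -/

/-- The number of layers up to each qubit, after a further gate is placed greedily. -/
def stackGate (g : QubitPair n × TwoQubitGate) (h : Fin n → ℕ) (q : Fin n) : ℕ :=
  if q = g.1.1.1 ∨ q = g.1.1.2 then max (h g.1.1.1) (h g.1.1.2) + 1 else h q

theorem le_stackGate (g : QubitPair n × TwoQubitGate) (h : Fin n → ℕ) (q : Fin n) :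
    h q ≤ stackGate g h q := by
  unfold stackGate
  split_ifs with hq
  · rcases hq with rfl | rfl <;> omega
  · exact le_rfl

theorem le_runSteps_stackGate {t : ℕ} (ω : Circuit n t) (h : Fin n → ℕ) (q : Fin n) :
    h q ≤ runSteps stackGate ω h q := by
  induction t generalizing h with
  | zero => exact le_rfl
  | succ t ih => exact (le_stackGate (ω 0) h q).trans (ih _ _)

/-- Heights `h` record the layers already occupied. The last clause drives the induction: the later
gates lie at or above the heights raised by the first gate, hence strictly above its layer if they
share a qubit with it. -/
theorem exists_layering {t : ℕ} (ω : Circuit n t) (h : Fin n → ℕ) {D : ℕ}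
    (hD : ∀ q, runSteps stackGate ω h q ≤ D) : ∃ layer : Fin t → ℕ, (∀ i, layer i < D) ∧
      (∀ i j, i < j → Overlap (ω i).1 (ω j).1 → layer i < layer j) ∧
      ∀ i, h (ω i).1.1.1 ≤ layer i ∧ h (ω i).1.1.2 ≤ layer i := by
  induction t generalizing h with
  | zero => exact ⟨Fin.elim0, fun i => i.elim0, fun i => i.elim0, fun i => i.elim0⟩
  | succ t ih =>
    obtain ⟨layer, h1, h2, h3⟩ := ih (fun i => ω i.succ) (stackGate (ω 0) h) hD
    have hfirst : stackGate (ω 0) h (ω 0).1.1.1 = max (h (ω 0).1.1.1) (h (ω 0).1.1.2) + 1 := by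
      simp [stackGate]
    have hsecond : stackGate (ω 0) h (ω 0).1.1.2 = max (h (ω 0).1.1.1) (h (ω 0).1.1.2) + 1 := by
      simp [stackGate]
    refine ⟨Fin.cons (max (h (ω 0).1.1.1) (h (ω 0).1.1.2)) layer, ?_, ?_, ?_⟩
    · refine Fin.cases ?_ fun i => ?_
      · have := (le_runSteps_stackGate (fun i => ω i.succ) (stackGate (ω 0) h)
          (ω 0).1.1.1).trans (hD _)
        rw [Fin.cons_zero]
        omega
      · rw [Fin.cons_succ]; exact h1 i
    · intro i j hij hov
      obtain ⟨j, rfl⟩ := Fin.exists_succ_eq.2 (Fin.ne_zero_of_lt hij)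
      rw [Fin.cons_succ]
      refine Fin.cases (fun hij hov => ?_) (fun i hij hov => ?_) i hij hov
      · rw [Fin.cons_zero]
        have h4 := h3 j
        rcases hov with e | e | e | e
        · rw [← e, hfirst] at h4; omega
        · rw [← e, hfirst] at h4; omega
        · rw [← e, hsecond] at h4; omega
        · rw [← e, hsecond] at h4; omega
      · rw [Fin.cons_succ]
        exact h2 i j (Fin.succ_lt_succ_iff.1 hij) hov
    · refine Fin.cases ?_ fun i => ?_
      · rw [Fin.cons_zero]; omega
      · rw [Fin.cons_succ]
        exact ⟨(le_stackGate _ _ _).trans (h3 i).1, (le_stackGate _ _ _).trans (h3 i).2⟩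

theorem parallelDepth_le {t : ℕ} (ω : Circuit n t) {D : ℕ}
    (hD : ∀ q, runSteps stackGate ω 0 q ≤ D) : parallelDepth ω ≤ D := by
  obtain ⟨layer, h1, h2, -⟩ := exists_layering ω 0 hD
  exact Nat.sInf_le ⟨fun i => ⟨layer i, h1 i⟩, fun i j hij hov => h2 i j hij hov⟩

/-- Both qubits reach height `max + 1`, contributing `4 * 2 ^ max`, at most four times the sum of
their old contributions. -/
theorem sum_two_pow_stackGate_le (g : QubitPair n × TwoQubitGate) (h : Fin n → ℕ) :
    ∑ q, (2 : ℝ) ^ stackGate g h q ≤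
      ∑ q, (2 : ℝ) ^ h q + 3 * ((2 : ℝ) ^ h g.1.1.1 + (2 : ℝ) ^ h g.1.1.2) := by
  have hne := g.1.2.ne
  have hj : g.1.1.2 ∈ Finset.univ.erase g.1.1.1 := by simp [hne.symm]
  have hsplit : ∀ F : Fin n → ℝ, ∑ q, F q = F g.1.1.1 + (F g.1.1.2 +
      ∑ q ∈ (Finset.univ.erase g.1.1.1).erase g.1.1.2, F q) := fun F => by
    rw [Finset.add_sum_erase _ _ hj, Finset.add_sum_erase _ _ (Finset.mem_univ _)]
  rw [hsplit, hsplit fun q => (2 : ℝ) ^ h q]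
  have hrest : ∑ q ∈ (Finset.univ.erase g.1.1.1).erase g.1.1.2, (2 : ℝ) ^ stackGate g h q =
      ∑ q ∈ (Finset.univ.erase g.1.1.1).erase g.1.1.2, (2 : ℝ) ^ h q := by
    refine Finset.sum_congr rfl fun q hq => ?_
    simp only [Finset.mem_erase] at hq
    rw [stackGate, if_neg (by tauto)]
  have e1 : stackGate g h g.1.1.1 = max (h g.1.1.1) (h g.1.1.2) + 1 := by simp [stackGate]
  have e2 : stackGate g h g.1.1.2 = max (h g.1.1.1) (h g.1.1.2) + 1 := by simp [stackGate]
  have hmax : (2 : ℝ) ^ max (h g.1.1.1) (h g.1.1.2) ≤ 2 ^ h g.1.1.1 + 2 ^ h g.1.1.2 := by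
    rcases le_total (h g.1.1.1) (h g.1.1.2) with hle | hle
    · rw [max_eq_right hle]; linarith [pow_pos (two_pos (α := ℝ)) (h g.1.1.1)]
    · rw [max_eq_left hle]; linarith [pow_pos (two_pos (α := ℝ)) (h g.1.1.2)]
  rw [hrest, e1, e2, pow_succ]
  linarith

/-- A given qubit belongs to the random pair with probability `2 / n`, so the increase `3 (2 ^ h i +
2 ^ h j)` averages to `6 / n` times the potential. -/
theorem lintegral_sum_two_pow_le (model : GateModel) (hn : 2 ≤ n) (t : ℕ) :
    ∫⁻ ω, ENNReal.ofReal (∑ q, (2 : ℝ) ^ runSteps stackGate ω (0 : Fin n → ℕ) q)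
      ∂circuitLaw model n t ≤ ENNReal.ofReal ((1 + 6 / n) ^ t * n) := by
  have := isProbabilityMeasure_uniformOn_qubitPair hn
  have hn0 : (0 : ℝ) < n := by exact_mod_cast (by omega : 0 < n)
  have h := lintegral_runSteps_le
    ((ProbabilityTheory.uniformOn (Set.univ : Set (QubitPair n))).prod (gateLaw model)) stackGate
    (fun s h => ENNReal.ofReal ((1 + 6 / n) ^ s * ∑ q, (2 : ℝ) ^ h q)) (fun s h => by
      refine (lintegral_mono fun g => ENNReal.ofReal_le_ofReal (mul_le_mul_of_nonneg_left
        (sum_two_pow_stackGate_le g h) (by positivity))).trans ?_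
      refine (lintegral_gate_le model hn (fun g => (1 + 6 / n) ^ s * (∑ q, (2 : ℝ) ^ h q +
        3 * ((2 : ℝ) ^ h g.1.1.1 + (2 : ℝ) ^ h g.1.1.2))) (fun g => by positivity)
        (fun p => by fun_prop)).trans (le_of_eq ?_)
      congr 1
      have hs := sum_qubitPair (n := n) (g := fun i j => (2 : ℝ) ^ h i + (2 : ℝ) ^ h j)
        fun i j => add_comm _ _
      have hc := card_qubitPair (n := n)
      simp only [Finset.sum_add_distrib, Finset.sum_const, Finset.card_univ, Fintype.card_fin,
        nsmul_eq_mul, ← Finset.mul_sum] at hs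
      simp only [integral_const, probReal_univ, one_smul, ← Finset.mul_sum,
        Finset.sum_add_distrib, Finset.sum_const, Finset.card_univ, nsmul_eq_mul]
      rw [div_eq_iff (card_qubitPair_pos hn).ne', pow_succ]
      generalize ∑ q, (2 : ℝ) ^ h q = Z at *
      generalize (Fintype.card (QubitPair n) : ℝ) = c at *
      generalize ∑ p : QubitPair n, (2 : ℝ) ^ h p.1.1 = z1 at *
      generalize ∑ p : QubitPair n, (2 : ℝ) ^ h p.1.2 = z2 at *
      have hc' : c = n * (n - 1) / 2 := by linarith
      have hz : z1 + z2 = (n - 1) * Z := by linarith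
      rw [hz, hc']
      field_simp
      ring) t 0
  simp only [pow_zero, one_mul, Pi.zero_apply, Finset.sum_const, Finset.card_univ,
    Fintype.card_fin, nsmul_eq_mul, mul_one] at h
  exact h

theorem measurable_sum_two_pow {t : ℕ} : Measurable fun ω : Circuit n t =>
    ∑ q, (2 : ℝ) ^ runSteps stackGate ω (0 : Fin n → ℕ) q := by
  -- The heights depend only on the pairs, which range over a countable space where every function
  -- is measurable.
  have hdep : ∀ (t : ℕ) (ω ω' : Circuit n t) (h : Fin n → ℕ), (∀ i, (ω i).1 = (ω' i).1) →
      runSteps stackGate ω h = runSteps stackGate ω' h := by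
    intro t
    induction t with
    | zero => intro ω ω' h _; rfl
    | succ t ih =>
      intro ω ω' h hω
      rw [runSteps, runSteps, ih _ (fun i => ω' i.succ) _ fun i => hω i.succ]
      congr 1
      funext q
      simp only [stackGate, hω 0]
  have : (fun ω : Circuit n t => ∑ q, (2 : ℝ) ^ runSteps stackGate ω (0 : Fin n → ℕ) q) =
      (fun π : Fin t → QubitPair n => ∑ q, (2 : ℝ) ^ runSteps stackGate
        (fun i => (π i, (1 : TwoQubitGate))) (0 : Fin n → ℕ) q) ∘ fun ω i => (ω i).1 := by
    funext ω
    simp only [Function.comp]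
    rw [hdep t ω (fun i => ((ω i).1, 1)) 0 fun i => rfl]
  rw [this]
  exact (measurable_of_countable _).comp
    (measurable_pi_lambda _ fun i => measurable_fst.comp (measurable_pi_apply i))

/-! ### The good event -/

theorem measure_ge_le {α : Type*} [MeasurableSpace α] {μ : Measure α} {f : α → ℝ}
    (hf : Measurable f) {E c : ℝ} (hc : 0 < c) (hE : ∫⁻ x, ENNReal.ofReal (f x) ∂μ ≤ ENNReal.ofReal E) :
    μ {x | c ≤ f x} ≤ ENNReal.ofReal (E / c) := by
  have h1 : {x | c ≤ f x} ⊆ {x | ENNReal.ofReal c ≤ ENNReal.ofReal (f x)} :=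
    fun x hx => ENNReal.ofReal_le_ofReal hx
  refine (measure_mono h1).trans ((meas_ge_le_lintegral_div hf.ennreal_ofReal.aemeasurable
    (by simpa using hc) ENNReal.ofReal_ne_top).trans ?_)
  rw [ENNReal.ofReal_div_of_pos hc]
  gcongr

instance (model : GateModel) (n t : ℕ) : IsFiniteMeasure (circuitLaw model n t) := by
  unfold circuitLaw; infer_instance

/-- Two Markov bounds: a qubit of height above `D` forces the potential to be at least `2 ^ (D +
1)`, and an error above `ε` for some `S` forces the low-weight sum to exceed `ε ^ 2`. -/
theorem real_goodEvent_ge {A : Type} [Fintype A] {m a : ℕ} (model : GateModel) (t : ℕ)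
    (hn : 2 ≤ m + a) (ψ : A × Bits (Fin a) → ℂ) (hψ : (ancillaState ψ).trace = 1)
    {f d ε : ℝ} (hε : 0 < ε) {W D : ℕ} (hW : ∀ x : ℕ, (x : ℝ) ≤ f * (m + a : ℕ) → x ≤ W)
    (hD : (D : ℝ) ≤ d) :
    1 - (1 + 6 / (m + a : ℕ)) ^ t * (m + a : ℕ) / 2 ^ (D + 1) -
      (2 ^ m * ∑ μ, ∑ μ', pauliWeightSum ((weightStep (m + a))^[t] (lowWeight W))
        (block (inputState m a ψ) μ μ')) / ε ^ 2 ≤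
      (circuitLaw model (m + a) t).real (goodEvent ψ f d ε) := by
  have := isProbabilityMeasure_uniformOn_qubitPair hn
  have hprob : IsProbabilityMeasure (circuitLaw model (m + a) t) := by
    unfold circuitLaw; infer_instance
  set Z : Circuit (m + a) t → ℝ :=
    fun ω => ∑ q, (2 : ℝ) ^ runSteps stackGate ω (0 : Fin (m + a) → ℕ) q with hZ
  set X : Circuit (m + a) t → ℝ := fun ω => 2 ^ m * ∑ μ, ∑ μ', pauliWeightSum (lowWeight W)
    (circuitUnitary ω * block (inputState m a ψ) μ μ' * (circuitUnitary ω)ᴴ) with hX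
  have hlow : ∀ x, 0 ≤ lowWeight W x := lowWeight_nonneg W
  have hit : ∀ x ≤ m + a, 0 ≤ (weightStep (m + a))^[t] (lowWeight W) x := iterate_nonneg hn hlow t
  have hXm : Measurable X := by
    have := fun μ μ' => measurable_pauliWeightSum (t := t) (lowWeight W)
      (block (inputState m a ψ) μ μ')
    simp only [hX]
    fun_prop
  have hXE : ∫⁻ ω, ENNReal.ofReal (X ω) ∂circuitLaw model (m + a) t ≤ ENNReal.ofReal
      (2 ^ m * ∑ μ, ∑ μ', pauliWeightSum ((weightStep (m + a))^[t] (lowWeight W))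
        (block (inputState m a ψ) μ μ')) := by
    have h1 : ∀ ω, ENNReal.ofReal (X ω) = ENNReal.ofReal (2 ^ m) * ∑ μ, ∑ μ', ENNReal.ofReal
        (pauliWeightSum (lowWeight W)
          (circuitUnitary ω * block (inputState m a ψ) μ μ' * (circuitUnitary ω)ᴴ)) := by
      intro ω
      have hp : ∀ μ μ', 0 ≤ pauliWeightSum (lowWeight W)
          (circuitUnitary ω * block (inputState m a ψ) μ μ' * (circuitUnitary ω)ᴴ) :=
        fun μ μ' => pauliWeightSum_nonneg (fun x _ => hlow x) _
      simp only [hX]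
      rw [ENNReal.ofReal_mul (by positivity), ENNReal.ofReal_sum_of_nonneg fun μ _ =>
        Finset.sum_nonneg fun μ' _ => hp μ μ']
      congr 1
      exact Finset.sum_congr rfl fun μ _ => ENNReal.ofReal_sum_of_nonneg fun μ' _ => hp μ μ'
    have hm := fun μ μ' => (measurable_pauliWeightSum (t := t) (lowWeight W)
      (block (inputState m a ψ) μ μ')).ennreal_ofReal
    simp_rw [h1]
    rw [lintegral_const_mul' _ _ ENNReal.ofReal_ne_top, lintegral_finsetSum _ fun μ _ =>
      Finset.measurable_sum _ fun μ' _ => hm μ μ', ENNReal.ofReal_mul (by positivity),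
      ENNReal.ofReal_sum_of_nonneg fun μ _ => Finset.sum_nonneg fun μ' _ =>
        pauliWeightSum_nonneg hit _]
    gcongr with μ _
    rw [lintegral_finsetSum _ fun μ' _ => hm μ μ', ENNReal.ofReal_sum_of_nonneg fun μ' _ =>
        pauliWeightSum_nonneg hit _]
    gcongr with μ' _
    exact lintegral_pauliWeightSum_le model hn hlow t _
  have hZb := measure_ge_le (measurable_sum_two_pow (n := m + a) (t := t))
    (show (0 : ℝ) < 2 ^ (D + 1) by positivity) (lintegral_sum_two_pow_le model hn t)
  have hXb := measure_ge_le hXm (show 0 < ε ^ 2 by positivity) hXE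
  have hsub : (goodEvent ψ f d ε)ᶜ ⊆ {ω | 2 ^ (D + 1) ≤ Z ω} ∪ {ω | ε ^ 2 ≤ X ω} := by
    intro ω hω
    by_contra hcon
    simp only [Set.mem_union, Set.mem_ofPred_eq, not_or, not_le] at hcon
    refine hω ⟨?_, fun S hS => ?_⟩
    · refine le_trans ?_ hD
      exact_mod_cast parallelDepth_le ω fun q => by
        by_contra hq
        rw [not_le] at hq
        have h1 : (2 : ℝ) ^ (D + 1) ≤ 2 ^ runSteps stackGate ω 0 q :=
          pow_le_pow_right₀ (by norm_num) hq
        have h2 := Finset.single_le_sum (f := fun q => (2 : ℝ) ^ runSteps stackGate ω 0 q)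
          (fun q _ => by positivity) (Finset.mem_univ q)
        exact absurd (h1.trans h2) (not_le.2 hcon.1)
    · have h1 := decouplingError_sq_le ψ (trace_block_inputState ψ hψ) ω S (hW _ hS)
      exact (pow_le_pow_iff_left₀ (traceNorm_nonneg _) hε.le two_ne_zero).1
        (h1.trans hcon.2.le)
  set e1 := (1 + 6 / ((m + a : ℕ) : ℝ)) ^ t * (m + a : ℕ) / 2 ^ (D + 1) with he1
  set e2 := (2 ^ m * ∑ μ, ∑ μ', pauliWeightSum ((weightStep (m + a))^[t] (lowWeight W))
        (block (inputState m a ψ) μ μ')) / ε ^ 2 with he2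
  have he1n : 0 ≤ e1 := by positivity
  have he2n : 0 ≤ e2 := div_nonneg (mul_nonneg (by positivity) (Finset.sum_nonneg fun μ _ =>
    Finset.sum_nonneg fun μ' _ => pauliWeightSum_nonneg hit _)) (by positivity)
  have hbad : (circuitLaw model (m + a) t).real (goodEvent ψ f d ε)ᶜ ≤ e1 + e2 := by
    refine ENNReal.toReal_le_of_le_ofReal (by positivity) ?_
    rw [ENNReal.ofReal_add he1n he2n]
    exact (measure_mono hsub).trans ((measure_union_le _ _).trans (add_le_add hZb hXb))
  have hone := measureReal_union_le (μ := circuitLaw model (m + a) t) (goodEvent ψ f d ε)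
    (goodEvent ψ f d ε)ᶜ
  rw [Set.union_compl_self, probReal_univ] at hone
  linarith

end RandomCircuit

namespace RandomCircuit

/-! ### Asymptotics -/

theorem two_pow_le_mul_choose_half (n : ℕ) :
    (2 : ℝ) ^ n ≤ (n + 1) * n.choose ((n + 1) / 2) := by
  have h1 : 2 ^ n ≤ (n + 1) * n.choose ((n + 1) / 2) := by
    rw [← Nat.choose_symm_of_eq_add (show n = n / 2 + (n + 1) / 2 by omega),
      ← Nat.sum_range_choose n]
    refine (Finset.sum_le_sum fun x _ => Nat.choose_le_middle x n).trans ?_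
    simp
  exact_mod_cast h1

theorem exp_le_mul_stringCount_half (n : ℕ) :
    Real.exp (n * Real.log 2 * (1 + Real.logb 2 3 / 2)) ≤
      (n + 1) * stringCount n ((n + 1) / 2) := by
  have hlog : Real.log 2 * Real.logb 2 3 = Real.log 3 :=
    mul_div_cancel₀ _ (Real.log_pos (by norm_num)).ne'
  have e : (n : ℝ) * Real.log 2 * (1 + Real.logb 2 3 / 2) =
      n * Real.log 2 + n / 2 * Real.log 3 := by rw [← hlog]; ring
  have h3 : Real.exp (n / 2 * Real.log 3) ≤ 3 ^ ((n + 1) / 2) := by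
    rw [← Real.exp_log (show (0 : ℝ) < 3 by norm_num), ← Real.exp_nat_mul, Real.exp_log (by norm_num)]
    refine Real.exp_le_exp.2 (mul_le_mul_of_nonneg_right ?_ (Real.log_nonneg (by norm_num)))
    have : n ≤ 2 * ((n + 1) / 2) := by omega
    have : (n : ℝ) ≤ 2 * ((n + 1) / 2 : ℕ) := by exact_mod_cast this
    linarith
  rw [e, Real.exp_add, Real.exp_nat_mul, Real.exp_log (by norm_num), stringCount]
  calc (2 : ℝ) ^ n * Real.exp (n / 2 * Real.log 3)
      ≤ ((n + 1) * n.choose ((n + 1) / 2)) * 3 ^ ((n + 1) / 2) :=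
        mul_le_mul (two_pow_le_mul_choose_half n) h3 (by positivity) (by positivity)
    _ = _ := by ring

theorem sum_stringCount_lowWeight_le (n : ℕ) {f : ℝ} (hf0 : 0 ≤ f) (hf : f < 1 / 2) {W : ℕ}
    (hW : (W : ℝ) ≤ f * n) :
    ∑ x ∈ Finset.range (n + 1), stringCount n x * lowWeight W x ≤
      Real.exp (n * Real.log 2 * (f * Real.logb 2 3 + binaryEntropy f)) := by
  have hlog2 : Real.log 2 ≠ 0 := (Real.log_pos (by norm_num)).ne'
  rcases hf0.eq_or_lt with rfl | hf0
  -- For `f = 0` the Chernoff parameter below would be `0`; here there are no nonzero weights to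
  -- count.
  · have : W = 0 := by
      rw [zero_mul] at hW
      exact_mod_cast le_antisymm hW (Nat.cast_nonneg W)
    subst this
    have : ∀ x, lowWeight 0 x = 0 := fun x => if_neg (by omega)
    simp only [this, mul_zero, Finset.sum_const_zero]
    positivity
  -- Chernoff bound: `z` minimizes `(1 + 3 z) ^ n * z ^ (-f n)`, and `z ≤ 1` makes `z ^ (x - f n) ≥
  -- 1` for `x ≤ f n`.
  set z : ℝ := f / (3 * (1 - f)) with hz
  have h1f : 0 < 1 - f := by linarith
  have hz0 : 0 < z := by positivity
  have hz1 : z ≤ 1 := by rw [hz, div_le_one (by positivity)]; linarith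
  have hlz : Real.log z = Real.log f - Real.log 3 - Real.log (1 - f) := by
    rw [hz, Real.log_div hf0.ne' (by positivity), Real.log_mul (by norm_num) h1f.ne']; ring
  have hterm : ∀ x ∈ Finset.range (n + 1), stringCount n x * lowWeight W x ≤
      (3 * z) ^ x * 1 ^ (n - x) * n.choose x * Real.exp (-(f * n * Real.log z)) := by
    intro x hx
    have hc := (stringCount_pos (Finset.mem_range_succ_iff.1 hx)).le
    have e : (3 * z) ^ x * 1 ^ (n - x) * n.choose x * Real.exp (-(f * n * Real.log z)) =
        stringCount n x * Real.exp ((x - f * n) * Real.log z) := by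
      rw [sub_mul, sub_eq_add_neg, Real.exp_add, Real.exp_nat_mul, Real.exp_log hz0, stringCount,
        mul_pow]
      ring
    rw [e]
    refine mul_le_mul_of_nonneg_left ?_ hc
    unfold lowWeight
    split_ifs with h
    · refine Real.one_le_exp (mul_nonneg_of_nonpos_of_nonpos ?_ (Real.log_nonpos hz0.le hz1))
      have : (x : ℝ) ≤ W := by exact_mod_cast h.2
      linarith
    · positivity
  refine (Finset.sum_le_sum hterm).trans (le_of_eq ?_)
  have h3z : 3 * z + 1 = (1 - f)⁻¹ := by rw [hz]; field_simp; ring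
  rw [← Finset.sum_mul, ← add_pow, h3z, ← Real.exp_log (inv_pos.2 h1f), ← Real.exp_nat_mul,
    ← Real.exp_add, Real.log_inv, hlz]
  congr 1
  have e : (n : ℝ) * Real.log 2 * (f * Real.logb 2 3 + binaryEntropy f) =
      n * (f * Real.log 3 - f * Real.log f - (1 - f) * Real.log (1 - f)) := by
    unfold binaryEntropy Real.logb
    field_simp
    ring
  rw [e]; ring

/-- The expected number of low-weight Pauli components of the output of a circuit. -/
theorem sum_pauliWeightSum_iterate_le {A : Type} [Fintype A] {m a : ℕ} (ψ : A × Bits (Fin a) → ℂ)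
    {χ : Fin 4 → ℕ} (hχ : ∀ τ : Fin a → Fin 4,
      ‖(ancillaState ψ * pauliString τ).trace‖ ^ 2 = ((∏ i, χ (τ i) : ℕ) : ℝ))
    (hN : ∀ x, (inputPoly χ m a).coeff x ≤ 2 ^ x * (m + a).choose x) (hn : 20 ≤ m + a)
    {f σ : ℝ} (hf0 : 0 ≤ f) (hf : f < 1 / 2)
    (hσ : (4 : ℝ) ^ m * (∑ q, χ q : ℕ) ^ a ≤ Real.exp ((m + a : ℕ) * σ)) (t : ℕ)
    (ht : 4 * ((m + a : ℕ) : ℝ) ^ 2 * Real.exp (-(t / (20 * (m + a : ℕ)))) ≤ 1) :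
    2 ^ m * ∑ μ, ∑ μ', pauliWeightSum ((weightStep (m + a))^[t]
        (lowWeight ⌊f * (m + a : ℕ)⌋₊)) (block (inputState m a ψ) μ μ') ≤
      8 * ((m + a : ℕ) : ℝ) ^ 4 * Real.exp (-(t / (20 * (m + a : ℕ)))) +
      ((m + a : ℕ) + 1) * Real.exp ((m + a : ℕ) * (σ - Real.log 2 *
        (1 + Real.logb 2 3 / 2 - f * Real.logb 2 3 - binaryEntropy f))) := by
  rw [sum_pauliWeightSum_inputState]
  simp_rw [hχ]
  rw [← sum_coeff_inputPoly]
  set n := m + a with hn'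
  have hn0 : (0 : ℝ) < n := by exact_mod_cast (by omega : 0 < n)
  set W := ⌊f * (n : ℝ)⌋₊ with hW
  have hWf : (W : ℝ) ≤ f * n := Nat.floor_le (by positivity)
  have hWH : W < (n + 1) / 2 := by
    have h1 : (W : ℝ) < n / 2 := hWf.trans_lt (by nlinarith)
    have h2 : 2 * (W : ℝ) < n := by linarith
    have h3 : 2 * W < n := by exact_mod_cast h2
    omega
  -- `H = ⌈n / 2⌉`: every `x < H` satisfies `2 x < n`, where the supersolutions decay, while `3 ^ H
  -- C(n, H)` is already at least `2 ^ n 3 ^ (n / 2) / (n + 1)`.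
  refine (sum_mul_iterate_le hn (H := (n + 1) / 2) (by omega)
    (N := fun x => ((inputPoly χ m a).coeff x : ℝ)) (fun x => Nat.cast_nonneg _)
    (fun x => by unfold inputWeight; exact_mod_cast hN x) (lowWeight_nonneg W)
    (if_neg (by omega)) (fun x => by unfold lowWeight; split_ifs <;> norm_num)
    (fun x hx => if_neg (by omega)) t ht).trans ?_
  refine add_le_add le_rfl ?_
  rw [sum_coeff_inputPoly_one, mul_div_assoc']
  have hpos : 0 < stringCount n ((n + 1) / 2) := stringCount_pos (by omega)
  rw [div_le_iff₀ hpos]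
  have hS := sum_stringCount_lowWeight_le n hf0 hf hWf
  have hS0 : 0 ≤ ∑ x ∈ Finset.range (n + 1), stringCount n x * lowWeight W x :=
    Finset.sum_nonneg fun x hx => mul_nonneg
      (stringCount_pos (Finset.mem_range_succ_iff.1 hx)).le (lowWeight_nonneg W x)
  calc _ ≤ Real.exp (n * σ) * Real.exp (n * Real.log 2 * (f * Real.logb 2 3 + binaryEntropy f)) :=
        mul_le_mul hσ hS hS0 (by positivity)
    _ = Real.exp (n * (σ - Real.log 2 *
        (1 + Real.logb 2 3 / 2 - f * Real.logb 2 3 - binaryEntropy f))) *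
        Real.exp (n * Real.log 2 * (1 + Real.logb 2 3 / 2)) := by
        rw [← Real.exp_add, ← Real.exp_add]; congr 1; ring
    _ ≤ Real.exp (n * (σ - Real.log 2 *
        (1 + Real.logb 2 3 / 2 - f * Real.logb 2 3 - binaryEntropy f))) *
        ((n + 1) * stringCount n ((n + 1) / 2)) :=
        mul_le_mul_of_nonneg_left (exp_le_mul_stringCount_half n) (by positivity)
    _ = _ := by ring

theorem log_le_logb_two {x : ℝ} (hx : 1 ≤ x) : Real.log x ≤ Real.logb 2 x := by
  rw [Real.logb, le_div_iff₀ (Real.log_pos (by norm_num))]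
  exact mul_le_of_le_one_right (Real.log_nonneg hx) (by linarith [Real.log_two_lt_d9])

theorem one_le_logb_two {x : ℝ} (hx : 2 ≤ x) : 1 ≤ Real.logb 2 x := by
  rw [Real.le_logb_iff_rpow_le (by norm_num) (by linarith), Real.rpow_one]
  exact hx

theorem exp_neg_gates_le {n t : ℕ} (hn : 2 ≤ n) (s : ℕ)
    (ht : 20 * (s : ℝ) * n * Real.logb 2 n ^ 2 ≤ t) :
    Real.exp (-(t / (20 * n))) ≤ ((n : ℝ) ^ s)⁻¹ := by
  have hn' : (2 : ℝ) ≤ n := by exact_mod_cast hn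
  have hL := one_le_logb_two hn'
  have hlog := log_le_logb_two (show (1 : ℝ) ≤ n by linarith)
  rw [Real.exp_neg, ← Real.exp_log (show (0 : ℝ) < n by linarith), ← Real.exp_nat_mul,
    Real.exp_log (by linarith)]
  refine inv_anti₀ (Real.exp_pos _) (Real.exp_le_exp.2 ?_)
  rw [le_div_iff₀ (by linarith)]
  refine le_trans ?_ ht
  have : Real.log n ≤ Real.logb 2 n ^ 2 := hlog.trans (by nlinarith)
  calc _ = 20 * (s : ℝ) * n * Real.log n := by ring
    _ ≤ _ := by gcongr

/-- With `L = log₂ n ≥ log n`, the expected potential is at most `exp ((6 c₁ + 1) L²)`. The target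
`n ^ (-k) / 2` costs another `k + 1` in the coefficient of `L²`, using `2 ≤ n`; the leading `2` in
the constant compensates `log 2 ≥ 1/2`. -/
theorem depth_bound {n t k : ℕ} (hn : 2 ≤ n) {c₁ : ℝ} (hc₁ : 0 ≤ c₁)
    (ht : (t : ℝ) ≤ c₁ * n * Real.logb 2 n ^ 2) :
    (1 + 6 / n) ^ t * n / 2 ^ (⌊2 * (6 * c₁ + k + 2) * Real.logb 2 n ^ 3⌋₊ + 1) ≤
      ((n : ℝ) ^ k)⁻¹ / 2 := by
  have hn' : (2 : ℝ) ≤ n := by exact_mod_cast hn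
  have hn0 : (0 : ℝ) < n := by linarith
  set L := Real.logb 2 n with hLdef
  have hL : 1 ≤ L := one_le_logb_two hn'
  have hlog : Real.log n ≤ L ^ 2 :=
    (log_le_logb_two (show (1 : ℝ) ≤ n by linarith)).trans (by nlinarith)
  set C := 2 * (6 * c₁ + k + 2) with hC
  have hC0 : 0 ≤ C := by positivity
  have h1 : (1 + 6 / n : ℝ) ^ t ≤ Real.exp (6 * c₁ * L ^ 2) := by
    have h : (1 + 6 / n : ℝ) ≤ Real.exp (6 / n) := by linarith [Real.add_one_le_exp (6 / n : ℝ)]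
    refine (pow_le_pow_left₀ (by positivity) h t).trans ?_
    rw [← Real.exp_nat_mul]
    refine Real.exp_le_exp.2 ?_
    rw [mul_div_assoc', div_le_iff₀ hn0]
    linarith
  have h2 : (n : ℝ) ≤ Real.exp (L ^ 2) := by
    rw [← Real.log_le_iff_le_exp hn0]; exact hlog
  have h3 : Real.exp (C / 2 * L ^ 2) ≤ 2 ^ (⌊C * L ^ 3⌋₊ + 1) := by
    rw [← Real.exp_log (show (0 : ℝ) < 2 by norm_num), ← Real.exp_nat_mul,
      Real.exp_log (by norm_num)]
    refine Real.exp_le_exp.2 ?_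
    have h4 : C * L ^ 3 ≤ (⌊C * L ^ 3⌋₊ + 1 : ℕ) := by
      push_cast; exact (Nat.lt_floor_add_one _).le
    have h5 : L ^ 2 ≤ L ^ 3 := pow_le_pow_right₀ hL (by norm_num)
    have h6 : (1 / 2 : ℝ) ≤ Real.log 2 := by linarith [Real.log_two_gt_d9]
    calc C / 2 * L ^ 2 = C * L ^ 2 * (1 / 2) := by ring
      _ ≤ C * L ^ 3 * Real.log 2 := by gcongr
      _ ≤ _ := mul_le_mul_of_nonneg_right h4 (by linarith)
  rw [show ((n : ℝ) ^ k)⁻¹ / 2 = 1 / (2 * n ^ k) by field_simp,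
    div_le_div_iff₀ (by positivity) (by positivity), one_mul]
  calc (1 + 6 / n : ℝ) ^ t * n * (2 * n ^ k)
      ≤ Real.exp (6 * c₁ * L ^ 2) * Real.exp (L ^ 2) *
        (Real.exp (L ^ 2) * Real.exp (L ^ 2) ^ k) := by
        gcongr
        linarith
    _ = Real.exp (C / 2 * L ^ 2) := by
        rw [← Real.exp_nat_mul, ← Real.exp_add, ← Real.exp_add, ← Real.exp_add, hC]
        congr 1; ring
    _ ≤ _ := h3

theorem exists_poly_mul_exp_le (k : ℕ) {δ : ℝ} (hδ : 0 < δ) :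
    ∃ n₀ : ℕ, ∀ n ≥ n₀, 2 * (n : ℝ) ^ (3 * k + 1) * Real.exp (-(n * δ)) ≤ 1 / 4 := by
  have h := tendsto_pow_const_mul_const_pow_of_abs_lt_one (3 * k + 1) (r := Real.exp (-δ))
    (by rw [abs_of_pos (Real.exp_pos _)]; simpa using hδ)
  obtain ⟨n₀, hn₀⟩ := Filter.eventually_atTop.1
    (h.eventually (gt_mem_nhds (show (0 : ℝ) < 1 / 8 by norm_num)))
  refine ⟨n₀, fun n hn => ?_⟩
  have := hn₀ n hn
  rw [← Real.exp_nat_mul, mul_neg] at this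
  linarith

/-- Both cases follow from two data of the input: its weight enumerator is dominated by `2 ^ x C(n,
x)`, and its total number of strings is at most `exp (n σ)`. The failure probability splits as `1/2`
for depth, `1/4` for paths staying low and `1/4` for paths through `H`, each in units of `n ^ (-k)`.
-/
theorem decouplesWHP_of_input (model : GateModel) {A : ℕ → Type} [∀ a, Fintype (A a)]
    (ψ : ∀ a, A a × Bits (Fin a) → ℂ) (hψ : ∀ a, (ancillaState (ψ a)).trace = 1)
    {χ : Fin 4 → ℕ} (hχ : ∀ a (τ : Fin a → Fin 4),
      ‖(ancillaState (ψ a) * pauliString τ).trace‖ ^ 2 = ((∏ i, χ (τ i) : ℕ) : ℝ))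
    (k : ℕ) {c₁ β f σ : ℝ} (hc₁ : 0 ≤ c₁) (hf0 : 0 ≤ f) (hf : f < 1 / 2)
    (hN : ∀ m a : ℕ, (m : ℝ) < β * (m + a : ℕ) → ∀ x,
      (inputPoly χ m a).coeff x ≤ 2 ^ x * (m + a).choose x)
    (hσ : ∀ m a : ℕ, (m : ℝ) < β * (m + a : ℕ) →
      (4 : ℝ) ^ m * (∑ q, χ q : ℕ) ^ a ≤ Real.exp ((m + a : ℕ) * σ))
    (hδ : σ < Real.log 2 * (1 + Real.logb 2 3 / 2 - f * Real.logb 2 3 - binaryEntropy f)) :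
    DecouplesWHP model ψ k (20 * (3 * k + 6 : ℕ)) c₁ (2 * (6 * c₁ + k + 2)) β f := by
  obtain ⟨n₀, hn₀⟩ := exists_poly_mul_exp_le k (sub_pos.2 hδ)
  refine ⟨max n₀ 20, fun m a t hn hm ht₀ ht₁ => ?_⟩
  have hn20 : 20 ≤ m + a := (le_max_right _ _).trans hn
  have hnn₀ : n₀ ≤ m + a := (le_max_left _ _).trans hn
  have hexp := exp_neg_gates_le (by omega) (3 * k + 6) ht₀
  have hdepth := depth_bound (k := k) (by omega) hc₁ ht₁
  have hsmall := hn₀ _ hnn₀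
  have hr : (20 : ℝ) ≤ (m + a : ℕ) := by exact_mod_cast hn20
  set n : ℝ := ((m + a : ℕ) : ℝ) with hnr
  have hn1 : 1 ≤ n := by linarith
  have hn0 : 0 < n := by linarith
  have hE := sum_pauliWeightSum_iterate_le (ψ a) (hχ a) (hN m a hm) hn20 hf0 hf (hσ m a hm) t (by
    refine (mul_le_mul_of_nonneg_left hexp (by positivity)).trans ?_
    rw [← div_eq_mul_inv, div_le_one (by positivity)]
    calc 4 * n ^ 2 ≤ n ^ 1 * n ^ 2 := by gcongr; linarith
      _ = n ^ 3 := by ring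
      _ ≤ n ^ (3 * k + 6) := pow_le_pow_right₀ hn1 (by omega))
  have hgood := real_goodEvent_ge model t (by omega) (ψ a) (hψ a) (f := f)
    (d := 2 * (6 * c₁ + k + 2) * Real.logb 2 n ^ 3) (ε := (n ^ k)⁻¹) (by positivity)
    (W := ⌊f * n⌋₊) (D := ⌊2 * (6 * c₁ + k + 2) * Real.logb 2 n ^ 3⌋₊)
    (fun x hx => Nat.le_floor hx) (Nat.floor_le (by
      have := one_le_logb_two (show (2 : ℝ) ≤ n by linarith)
      positivity))
  refine le_trans ?_ hgood
  -- The exponent `3 k + 6` pays `n ^ 4` from the chain, `n ^ (2 k)` from Markov with `ε = n ^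
  -- (-k)`, `n ^ k` for the target, and `n ^ 2 ≥ 32` for the constants.
  have hb1 : 8 * n ^ 4 * Real.exp (-(t / (20 * n))) * (n ^ k) ^ 2 ≤ (n ^ k)⁻¹ / 4 := by
    calc _ ≤ 8 * n ^ 4 * (n ^ (3 * k + 6))⁻¹ * (n ^ k) ^ 2 := by gcongr
      _ = 8 / n ^ 2 * (n ^ k)⁻¹ := by field_simp; ring
      _ ≤ 1 / 4 * (n ^ k)⁻¹ := by
        refine mul_le_mul_of_nonneg_right ?_ (by positivity)
        rw [div_le_div_iff₀ (by positivity) (by norm_num)]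
        nlinarith
      _ = _ := by ring
  have hb2 : (n + 1) * Real.exp (n * (σ - Real.log 2 *
      (1 + Real.logb 2 3 / 2 - f * Real.logb 2 3 - binaryEntropy f))) * (n ^ k) ^ 2 ≤
      (n ^ k)⁻¹ / 4 := by
    rw [show n * (σ - Real.log 2 * (1 + Real.logb 2 3 / 2 - f * Real.logb 2 3 - binaryEntropy f)) =
      -(n * (Real.log 2 * (1 + Real.logb 2 3 / 2 - f * Real.logb 2 3 - binaryEntropy f) - σ)) by
      ring]
    set e := Real.exp (-(n * (Real.log 2 *
      (1 + Real.logb 2 3 / 2 - f * Real.logb 2 3 - binaryEntropy f) - σ)))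
    calc (n + 1) * e * (n ^ k) ^ 2 ≤ (2 * n) * e * (n ^ k) ^ 2 := by
          gcongr
          linarith
      _ = 2 * n ^ (3 * k + 1) * e * (n ^ k)⁻¹ := by field_simp; ring
      _ ≤ 1 / 4 * (n ^ k)⁻¹ := by gcongr
      _ = _ := by ring
  have hsum : (2 ^ m * ∑ μ, ∑ μ', pauliWeightSum ((weightStep (m + a))^[t]
      (lowWeight ⌊f * n⌋₊)) (block (inputState m a (ψ a)) μ μ')) / (n ^ k)⁻¹ ^ 2 ≤
      (n ^ k)⁻¹ / 2 := by
    rw [inv_pow, div_inv_eq_mul]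
    refine (mul_le_mul_of_nonneg_right hE (by positivity)).trans ?_
    rw [add_mul]
    linarith
  linarith

end RandomCircuit

end

/-! ### The two input states -/

open RandomCircuit in
theorem mainTheorem5 (model : GateModel) (k : ℕ) :
    ∃ c₀ : ℝ, 0 < c₀ ∧ ∀ c₁ : ℝ, c₀ ≤ c₁ → ∃ C : ℝ, 0 < C ∧ ∀ β f : ℝ, 0 ≤ f → f < 1 / 2 →
      (β < 1 / 9 → β < Real.logb 2 3 / 2 - f * Real.logb 2 3 - binaryEntropy f →
        DecouplesWHP model zeroAncilla k c₀ c₁ C β f) ∧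
      (β < 2 / 3 → β < (1 + Real.logb 2 3 / 2 - f * Real.logb 2 3 - binaryEntropy f) / 2 →
        DecouplesWHP model maxEntangled k c₀ c₁ C β f) := by
  have hc₀ : (0 : ℝ) < 20 * (3 * k + 6 : ℕ) := by positivity
  have hlog2 : 0 < Real.log 2 := Real.log_pos (by norm_num)
  refine ⟨20 * (3 * k + 6 : ℕ), hc₀, fun c₁ hc₁ => ?_⟩
  have hc₁0 : 0 ≤ c₁ := hc₀.le.trans hc₁
  refine ⟨2 * (6 * c₁ + k + 2), by positivity, fun β f hf0 hf => ⟨fun hβ hβf => ?_,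
    fun hβ hβf => ?_⟩⟩
  · refine decouplesWHP_of_input model zeroAncilla (fun a => trace_zeroAncilla)
      (fun a => norm_trace_zeroAncilla) k hc₁0 hf0 hf (σ := Real.log 2 * (1 + β))
      (fun m a hm => coeff_inputPoly_diagonal_le ?_) (fun m a hm => ?_)
      (mul_lt_mul_of_pos_left (by linarith) hlog2)
    · have hx : (0 : ℝ) ≤ (m + a : ℕ) := Nat.cast_nonneg _
      have h1 : (m : ℝ) ≤ 1 / 9 * (m + a : ℕ) := hm.le.trans (by gcongr)
      push_cast at h1
      have : (m : ℝ) ≤ a := by linarith [(Nat.cast_nonneg a : (0 : ℝ) ≤ a)]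
      exact_mod_cast this
    -- Four operators per input qubit and two per ancilla: `4 ^ m 2 ^ a = 2 ^ (n + m) ≤ 2 ^ (n (1 +
    -- β))`.
    · have h2 : ∑ q : Fin 4, (if q = 0 ∨ q = 3 then 1 else 0) = 2 := by decide
      have h3 : (4 : ℝ) ^ m * ((2 : ℕ) : ℝ) ^ a = Real.exp (Real.log 2 * (2 * m + a)) := by
        rw [mul_comm (Real.log 2), show (2 * m + a : ℝ) = ((2 * m + a : ℕ) : ℝ) by push_cast; ring,
          Real.exp_nat_mul, Real.exp_log (by norm_num), pow_add, pow_mul]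
        norm_num
      rw [h2, h3]
      refine Real.exp_le_exp.2 ?_
      rw [mul_left_comm]
      refine mul_le_mul_of_nonneg_left ?_ hlog2.le
      push_cast at hm ⊢
      linarith
  · refine decouplesWHP_of_input model maxEntangled (fun a => trace_maxEntangled)
      (fun a => norm_trace_maxEntangled) k hc₁0 hf0 hf (σ := Real.log 2 * (2 * β))
      (fun m a hm => coeff_inputPoly_identity_le ?_) (fun m a hm => ?_)
      (mul_lt_mul_of_pos_left (by linarith) hlog2)
    · have hx : (0 : ℝ) ≤ (m + a : ℕ) := Nat.cast_nonneg _
      have h1 : (m : ℝ) ≤ 2 / 3 * (m + a : ℕ) := hm.le.trans (by gcongr)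
      have : 3 * (m : ℝ) ≤ 2 * (m + a : ℕ) := by linarith
      exact_mod_cast this
    -- Only the identity occurs on the ancillas: `4 ^ m ≤ 2 ^ (2 β n)`.
    · have h2 : ∑ q : Fin 4, (if q = 0 then 1 else 0) = 1 := by decide
      have h3 : (4 : ℝ) ^ m = Real.exp (Real.log 2 * (2 * m)) := by
        rw [mul_comm (Real.log 2), show (2 * m : ℝ) = ((2 * m : ℕ) : ℝ) by push_cast; ring,
          Real.exp_nat_mul, Real.exp_log (by norm_num), pow_mul]
        norm_num
      rw [h2, Nat.cast_one, one_pow, mul_one, h3]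
      refine Real.exp_le_exp.2 ?_
      rw [mul_left_comm _ (Real.log 2)]
      refine mul_le_mul_of_nonneg_left ?_ hlog2.le
      linarith
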